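/- **Algebraic setting.** Let $n\ge 1$, let $e_1,\dots,e_{2n}$ be the standard basis of $\mathbb C^{2n}$, and let $Q(x,y)=\tfrac12\sum_{i=1}^n(-1)^{i-1}(x_iy_{n+i}+x_{n+i}y_i)$. Put $W=\operatorname{Span}(e_1,\dots,e_n)$ and $e_i^\vee=(-1)^{i-1}e_{n+i}$, so that $\mathbb C^{2n}=W\oplus W^\vee$. The Clifford algebra $\mathrm{Cl}(Q)$ (with $x\otimes x=Q(x,x)$) acts on $S=\bigwedge^\bullet W=S_+\oplus S_-$ (even and odd part): $W$ by exterior multiplication and $W^\vee$ by contraction. The group $\mathrm{Spin}(Q)\subset \mathrm{Cl}(Q)$ acts on $S_\pm$, and on $\mathbb C^{2n}$ through the covering $\rho:\mathrm{Spin}(Q)\to \mathrm{SO}(Q)$. Let $\operatorname{OG}_+(n,2n)$ and $\operatorname{OG}_-(n,2n)$ be the $\mathrm{Spin}(Q)$-orbits of $\operatorname{Span}(e_{n+1},\dots,e_{2n})$ and $\operatorname{Span}(e_1,e_{n+2},\dots,e_{2n})$, and let $\operatorname{Ca}_\pm:\operatorname{OG}_\pm(n,2n)\to\mathbb P(S_\pm)$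 be the equivariant maps sending these two points to $[1]$ and $[e_1]$. The decorated orthogonal Grassmannian $\widetilde{\operatorname{OG}}(n+1,2n)$ consists of the triples $(X,s_+,s_-)$, where $X\subset\mathbb C^{2n}$ is a coisotropic $(n+1)$-dimensional subspace and $s_\pm$ is a vector of the line $\operatorname{Ca}_\pm(X_\pm)$, where $X_\pm\in\operatorname{OG}_\pm(n,2n)$ are the maximal isotropic subspaces contained in $X$. For $I\subseteq[n]$ the Cartan coordinate $\Sigma_I(X,s_+,s_-)$ is the coefficient of $\sigma(I)e_I$ in $s_+$ if $\#I$ is even and in $s_-$ if $\#I$ is odd, where $\sigma(I)=-1$ if $\#I\equiv2 \pmod 4$ and $\sigma(I)=1$ otherwise. The decorated Grassmannian $\widetilde{\operatorname{Gr}}(k,N)$ consists of the pairs $(X,v)$ with $X\subseteq\mathbb C^N$, $\dim X=k$ and $v\in\bigwedge^kX$; $\Delta_I(X,v)$ is the coefficient of $e_I$ in $v$. The subsets where all Cartan (resp. Plücker) coordinates are positive real numbers are denoted by $\widetilde{\operatorname{OG}}_{>0}$ (resp. $\widetilde{\operatorname{Gr}}_{>0}$). **Graphs.** Let $G$ be a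 well-connected graph embedded in the disk with boundary vertices $b_1,\dots,b_n$ in clockwise order. That is: let $t_1,\dots,t_{2n}$ be the boundary vertices of the medial graph of $G$, with $b_i$ between $t_{2i-1}$ and $t_{2i}$. Then no medial strand is closed, none intersects itself, no two intersect twice, and the strands pair $t_i$ with $t_{n+i}$ for $i\in[n]$. For a vertex or face $u$ of $G$, let $J(u)\subseteq[n]$ be the set of the $i$ such that $u$ is on the left of the medial strand from $t_{n+i}$ to $t_i$. Let $G_+$ be the bipartite graph in the disk with a black vertex $\mathrm b_e$ for every edge $e$ of $G$ and a white vertex $\mathrm w_u$ for every $u\in V(G)\sqcup F(G)$, where $\mathrm b_e$ is joined to $\mathrm w_u$ whenever $u$ is incident to $e$. Its boundary vertices are $d_1,\dots,d_{2n}$, where $d_{2i-1}=\mathrm w_{b_i}$ and $d_{2i}=\mathrm w_f$ for the face $f$ at the boundary arc between $b_i$ and $b_{i+1}$. A strand of $G_+$ is a path that turns maximally left at white and maximally right at black vertices. For a face $g$ of $G_+$, let $S(g)\subseteq[2n]$ be the set of the $i$ such that $g$ is on the left of the strand ending at $d_i$. Let $\mathcal B_G=\mathbb R_{>0}^{V(G)\sqcup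 F(G)}$ and $\mathcal A_{G_+}=\mathbb R_{>0}^{F(G_+)}$, and define $$\Psi_G(X,s_+,s_-)=(\Sigma_{J(u)}(X,s_+,s_-))_u,\qquad \Phi_{G_+}(X,v)=(\Delta_{S(g)}(X,v))_g,\qquad i_G^+(B)_g=B_vB_f,$$ where $\mathrm w_v$ and $\mathrm w_f$, with $v\in V(G)$ and $f\in F(G)$, are the white vertices incident to $g$. **Proposition.** There is a unique map $\eta:\widetilde{\operatorname{OG}}(n+1,2n)\to\widetilde{\operatorname{Gr}}(n+1,2n)$, $(X,s_+,s_-)\mapsto(X,v)$, that is $\mathrm{Spin}(Q)$-equivariant, homogeneous of degree one in each of $s_+$ and $s_-$, and satisfies $$\eta(X_0,1,e_1)=(X_0,\;e_1\wedge e_{n+1}\wedge e_{n+2}\wedge\cdots\wedge e_{2n}),\qquad X_0=\operatorname{Span}(e_1,e_{n+1},\dots,e_{2n}).$$ It has the following properties. 1. Let $(X,v)=\eta(X,s_+,s_-)$ and $I\in\binom{[2n]}{n+1}$, and put $J=I\cap[n]$ and $J^\vee=\{i-n: i\in I\cap[n+1,2n]\}$. If $\#(J\cap J^\vee)=1$,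 then $$\Delta_I(X,v)=\Sigma_J(X,s_+,s_-)\,\Sigma_{[n]\setminus J^\vee}(X,s_+,s_-).$$ 2. $\eta$ maps $\widetilde{\operatorname{OG}}_{>0}(n+1,2n)$ into $\widetilde{\operatorname{Gr}}_{>0}(n+1,2n)$. If $n\ge2$ and $G$ is a well-connected graph as above, then every face $g$ of $G_+$ is incident to exactly one $\mathrm w_v$ with $v\in V(G)$ and exactly one $\mathrm w_f$ with $f\in F(G)$, and $\#S(g)=n+1$. For every $(X,s_+,s_-)\in\widetilde{\operatorname{OG}}_{>0}(n+1,2n)$ with $(X,v')=\eta(X,s_+,s_-)$ we have $$\Delta_{S(g)}(X,v')=\Sigma_{J(v)}(X,s_+,s_-)\,\Sigma_{J(f)}(X,s_+,s_-);$$ that is, $\Phi_{G_+}\circ\eta=i_G^+\circ\Psi_G$ on $\widetilde{\operatorname{OG}}_{>0}(n+1,2n)$. -/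

import Mathlib

/-! ## The quadratic space `ℂ^{2n}`, its Clifford algebra and spin group

The index set `[2n]` is `Fin (n + n)`; the index `i ∈ [n]` is `Fin.castAdd n i` and the index
`n + i` is `Fin.natAdd n i`.  Indices start at `0`, so that a sign `(-1)^(i-1)` with one-based `i`
is `(-1)^i` here. -/

namespace ElecOG

open scoped ComplexOrder

/-- The form `Q(x,y) = 1/2 ∑ (-1)^(i-1) (x_i y_{n+i} + x_{n+i} y_i)` on `ℂ^{2n}`. -/
noncomputable def bilinQ (n : ℕ) : LinearMap.BilinForm ℂ (Fin (n + n) → ℂ) :=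
  ∑ i : Fin n, ((1 / 2 : ℂ) * (-1) ^ (i : ℕ)) •
    (LinearMap.BilinForm.linMulLin (LinearMap.proj (Fin.castAdd n i))
        (LinearMap.proj (Fin.natAdd n i)) +
      LinearMap.BilinForm.linMulLin (LinearMap.proj (Fin.natAdd n i))
        (LinearMap.proj (Fin.castAdd n i)))

/-- The quadratic form `x ↦ Q(x,x)`. -/
noncomputable def quadQ (n : ℕ) : QuadraticForm ℂ (Fin (n + n) → ℂ) :=
  (bilinQ n).toQuadraticMap

/-- The Clifford algebra `Cl(Q)`, with `x ⊗ x = Q(x,x)`. -/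
abbrev Cl (n : ℕ) : Type := CliffordAlgebra (quadQ n)

/-- The spin representation space `S`, the exterior algebra of `W = span (e_1, …, e_n)`. -/
abbrev SpinModule (n : ℕ) : Type := ExteriorAlgebra ℂ (Fin n → ℂ)

/-- The component in `W` of a vector. -/
noncomputable def wPart (n : ℕ) : (Fin (n + n) → ℂ) →ₗ[ℂ] (Fin n → ℂ) :=
  LinearMap.funLeft ℂ ℂ (Fin.castAdd n)

/-- The component in the dual of `W` of a vector, under `e_{n+i} ↦ (-1)^(i-1) e_i^∨`. -/
noncomputable def dualPart (n : ℕ) : (Fin (n + n) → ℂ) →ₗ[ℂ] Module.Dual ℂ (Fin n → ℂ) :=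
  ∑ i : Fin n, LinearMap.smulRight
    ((-1 : ℂ) ^ (i : ℕ) • (LinearMap.proj (Fin.natAdd n i) : (Fin (n + n) → ℂ) →ₗ[ℂ] ℂ))
    (LinearMap.proj i : (Fin n → ℂ) →ₗ[ℂ] ℂ)

theorem quadQ_apply (n : ℕ) (x : Fin (n + n) → ℂ) :
    quadQ n x = ∑ i : Fin n, (-1) ^ (i : ℕ) * (x (Fin.castAdd n i) * x (Fin.natAdd n i)) := by
  simp only [quadQ, bilinQ, LinearMap.BilinMap.toQuadraticMap_apply, LinearMap.sum_apply,
    LinearMap.smul_apply, LinearMap.add_apply, LinearMap.BilinForm.linMulLin_apply,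
    LinearMap.proj_apply, smul_eq_mul]
  refine Finset.sum_congr rfl fun i _ => ?_
  ring

theorem dualPart_wPart (n : ℕ) (x : Fin (n + n) → ℂ) :
    dualPart n x (wPart n x) = quadQ n x := by
  rw [quadQ_apply]
  simp only [dualPart, wPart, LinearMap.sum_apply, LinearMap.smulRight_apply,
    LinearMap.smul_apply, LinearMap.proj_apply, smul_eq_mul, LinearMap.funLeft_apply]
  refine Finset.sum_congr rfl fun i _ => ?_
  ring

/-- A vector acts on `S` by exterior multiplication by its `W`-component plus contraction with its
dual component. -/
noncomputable def vecAct (n : ℕ) : (Fin (n + n) → ℂ) →ₗ[ℂ] Module.End ℂ (SpinModule n) :=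
  (LinearMap.mul ℂ (SpinModule n)) ∘ₗ (ExteriorAlgebra.ι ℂ) ∘ₗ wPart n +
    (CliffordAlgebra.contractLeft (Q := (0 : QuadraticForm ℂ (Fin n → ℂ)))) ∘ₗ dualPart n

theorem vecAct_apply (n : ℕ) (x : Fin (n + n) → ℂ) (s : SpinModule n) :
    vecAct n x s = ExteriorAlgebra.ι ℂ (wPart n x) * s +
      CliffordAlgebra.contractLeft (Q := (0 : QuadraticForm ℂ (Fin n → ℂ))) (dualPart n x) s :=
  rfl

theorem vecAct_sq (n : ℕ) (x : Fin (n + n) → ℂ) :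
    vecAct n x * vecAct n x = algebraMap ℂ (Module.End ℂ (SpinModule n)) (quadQ n x) := by
  refine LinearMap.ext fun s => ?_
  have h1 := CliffordAlgebra.contractLeft_ι_mul (Q := (0 : QuadraticForm ℂ (Fin n → ℂ)))
    (dualPart n x) (wPart n x) s
  have h2 := CliffordAlgebra.contractLeft_contractLeft (Q := (0 : QuadraticForm ℂ (Fin n → ℂ)))
    (dualPart n x) s
  have h3 : ExteriorAlgebra.ι ℂ (wPart n x) * (ExteriorAlgebra.ι ℂ (wPart n x) * s) = 0 := by
    rw [← mul_assoc, ExteriorAlgebra.ι_sq_zero, zero_mul]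
  rw [Module.End.mul_apply, vecAct_apply n x s, map_add, vecAct_apply, vecAct_apply, h2, h3,
    Module.algebraMap_end_apply, ← dualPart_wPart]
  erw [h1]
  change 0 + (_ - ExteriorAlgebra.ι ℂ (wPart n x) * _) + (_ + 0) = _
  abel

/-- The spin representation `Γ` of `Cl(Q)` on `S`. -/
noncomputable def spinRep (n : ℕ) : Cl n →ₐ[ℂ] Module.End ℂ (SpinModule n) :=
  CliffordAlgebra.lift (quadQ n) ⟨vecAct n, vecAct_sq n⟩

/-- A linear left inverse of the inclusion of `ℂ^{2n}` in `Cl(Q)`. -/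
noncomputable def toVec (n : ℕ) : Cl n →ₗ[ℂ] (Fin (n + n) → ℂ) :=
  haveI : Invertible (2 : ℂ) := invertibleOfNonzero two_ne_zero
  ExteriorAlgebra.ιInv ∘ₗ (CliffordAlgebra.equivExterior (quadQ n)).toLinearMap

theorem toVec_ι (n : ℕ) (x : Fin (n + n) → ℂ) :
    toVec n (CliffordAlgebra.ι (quadQ n) x) = x := by
  let _ : Invertible (2 : ℂ) := invertibleOfNonzero two_ne_zero
  have h : CliffordAlgebra.equivExterior (quadQ n) (CliffordAlgebra.ι (quadQ n) x) =
      ExteriorAlgebra.ι ℂ x := by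
    simp only [CliffordAlgebra.equivExterior, CliffordAlgebra.changeFormEquiv_apply]
    exact CliffordAlgebra.changeForm_ι _ _
  change ExteriorAlgebra.ιInv (CliffordAlgebra.equivExterior (quadQ n) _) = x
  rw [h]
  exact ExteriorAlgebra.ι_leftInverse x

/-- The vector representation `ρ(g) : x ↦ α(g) ⊗ x ⊗ g^*` (`star` is the conjugation of `Cl(Q)` and
`involute` its main involution); it is meant for `g` in the spin group, see `ι_rho`. -/
noncomputable def rho (n : ℕ) (g : Cl n) : (Fin (n + n) → ℂ) →ₗ[ℂ] (Fin (n + n) → ℂ) :=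
  toVec n ∘ₗ LinearMap.mulRight ℂ (star g) ∘ₗ
    LinearMap.mulLeft ℂ (CliffordAlgebra.involute g) ∘ₗ CliffordAlgebra.ι (quadQ n)

theorem ι_rho (n : ℕ) {g : Cl n} (hg : g ∈ spinGroup (quadQ n)) (x : Fin (n + n) → ℂ) :
    CliffordAlgebra.ι (quadQ n) (rho n g x) =
      CliffordAlgebra.involute g * CliffordAlgebra.ι (quadQ n) x * star g := by
  let _ : Invertible (2 : ℂ) := invertibleOfNonzero two_ne_zero
  let u : (Cl n)ˣ := spinGroup.toUnits (⟨g, hg⟩ : spinGroup (quadQ n))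
  have hu : (u : Cl n) = g := rfl
  have hui : ((u⁻¹ : (Cl n)ˣ) : Cl n) = star g := rfl
  obtain ⟨y, hy⟩ := spinGroup.involute_act_ι_mem_range_ι (Q := quadQ n) (x := u) (hu ▸ hg) x
  rw [hui, hu] at hy
  have : rho n g x = toVec n
      (CliffordAlgebra.involute g * CliffordAlgebra.ι (quadQ n) x * star g) := rfl
  rw [this, ← hy, toVec_ι]

/-! ## Decorated Grassmannians -/

/-- The decorated Grassmannian: a `k`-dimensional subspace `X` of `ℂ^N` with `v ∈ ⋀^k X`. -/
@[ext]
structure DecGr (k N : ℕ) where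
  X : Submodule ℂ (Fin N → ℂ)
  finrank_eq : Module.finrank ℂ X = k
  v : ⋀[ℂ]^k (Fin N → ℂ)
  v_mem : v ∈ LinearMap.range (exteriorPower.map k X.subtype)

/-- The Plücker coordinate `Δ_I(X,v)`, the coefficient of `e_I` in `v`. -/
noncomputable def DecGr.plucker {k N : ℕ} (x : DecGr k N) (I : Set.powersetCard (Fin N) k) : ℂ :=
  ((Pi.basisFun ℂ (Fin N)).exteriorPower k).repr x.v I

/-- All Plücker coordinates are positive real numbers. -/
def DecGr.IsPos {k N : ℕ} (x : DecGr k N) : Prop :=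
  ∀ I : Set.powersetCard (Fin N) k, 0 < x.plucker I

/-- The positive decorated Grassmannian. -/
abbrev DecGrPos (k N : ℕ) : Type := {x : DecGr k N // x.IsPos}

/-- The standard basis vector `e_j` of `ℂ^{2n}`. -/
noncomputable def stdVec (n : ℕ) (j : Fin (n + n)) : Fin (n + n) → ℂ := Pi.single j 1

/-- `span (e_{n+1}, …, e_{2n})`. -/
noncomputable def basePlus (n : ℕ) : Submodule ℂ (Fin (n + n) → ℂ) :=
  Submodule.span ℂ (Set.range fun i : Fin n => stdVec n (Fin.natAdd n i))

/-- `span (e_1, e_{n+2}, …, e_{2n})`. -/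
noncomputable def baseMinus (n : ℕ) [NeZero n] : Submodule ℂ (Fin (n + n) → ℂ) :=
  Submodule.span ℂ (Set.range fun i : Fin n =>
    if i = 0 then stdVec n (Fin.castAdd n 0) else stdVec n (Fin.natAdd n i))

/-- `span (e_1, e_{n+1}, e_{n+2}, …, e_{2n})`. -/
noncomputable def baseX (n : ℕ) [NeZero n] : Submodule ℂ (Fin (n + n) → ℂ) :=
  Submodule.span ℂ (insert (stdVec n (Fin.castAdd n 0))
    (Set.range fun i : Fin n => stdVec n (Fin.natAdd n i)))

/-- The vector `e_1` of `S`. -/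
noncomputable def spinE1 (n : ℕ) [NeZero n] : SpinModule n :=
  ExteriorAlgebra.ι ℂ (Pi.single 0 1)

/-- `Y` belongs to the component `OG_+(n,2n)`, the spin orbit of `span (e_{n+1}, …, e_{2n})`, and
`s` to the line `Ca_+(Y)`, where `Ca_+` is the equivariant map taking that base point to `[1]`. -/
def MemCartanPlus (n : ℕ) (Y : Submodule ℂ (Fin (n + n) → ℂ)) (s : SpinModule n) : Prop :=
  ∃ g ∈ spinGroup (quadQ n), Y = (basePlus n).map (rho n g) ∧ ∃ c : ℂ, s = c • spinRep n g 1

/-- `Y` belongs to the component `OG_-(n,2n)`, the spin orbit of `span (e_1, e_{n+2}, …, e_{2n})`,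
and `s` to the line `Ca_-(Y)`, where `Ca_-` is the equivariant map taking that base point to
`[e_1]`. -/
def MemCartanMinus (n : ℕ) [NeZero n] (Y : Submodule ℂ (Fin (n + n) → ℂ)) (s : SpinModule n) :
    Prop :=
  ∃ g ∈ spinGroup (quadQ n), Y = (baseMinus n).map (rho n g) ∧
    ∃ c : ℂ, s = c • spinRep n g (spinE1 n)

/-- The decorated orthogonal Grassmannian: a coisotropic `(n+1)`-dimensional subspace `X` of
`ℂ^{2n}`, with vectors `s_±` in the lines `Ca_±(X_±)`, where `X_± ∈ OG_±(n,2n)` are the two maximal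
isotropic subspaces contained in `X`. -/
@[ext]
structure DecOG (n : ℕ) [NeZero n] where
  X : Submodule ℂ (Fin (n + n) → ℂ)
  finrank_eq : Module.finrank ℂ X = n + 1
  coisotropic : (bilinQ n).orthogonal X ≤ X
  sPlus : SpinModule n
  sMinus : SpinModule n
  mem_plus : ∃ Y ≤ X, MemCartanPlus n Y sPlus
  mem_minus : ∃ Y ≤ X, MemCartanMinus n Y sMinus

/-- `σ(I)` is `-1` if `#I ≡ 2` modulo `4`, and `1` otherwise. -/
def sgnSigma {n : ℕ} (I : Finset (Fin n)) : ℂ := if I.card % 4 = 2 then -1 else 1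

/-- The Cartan coordinate `Σ_I`, the coefficient of `σ(I) e_I` in `(s_+,s_-)`: it is read off from
`s_+` if `#I` is even, and from `s_-` if `#I` is odd. -/
noncomputable def DecOG.cartan {n : ℕ} [NeZero n] (x : DecOG n) (I : Finset (Fin n)) : ℂ :=
  sgnSigma I * (Pi.basisFun ℂ (Fin n)).ExteriorAlgebra.repr
    (if Even I.card then x.sPlus else x.sMinus) I

/-- All Cartan coordinates are positive real numbers. -/
def DecOG.IsPos {n : ℕ} [NeZero n] (x : DecOG n) : Prop :=
  ∀ I : Finset (Fin n), 0 < x.cartan I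

/-- The decorated positive orthogonal Grassmannian. -/
abbrev DecOGPos (n : ℕ) [NeZero n] : Type := {x : DecOG n // x.IsPos}

/-- The set `{1, n+1, n+2, …, 2n}`. -/
def baseIndex (n : ℕ) [NeZero n] : Finset (Fin (n + n)) :=
  insert (Fin.castAdd n 0) (Finset.univ.map (Fin.natAddEmb n))

theorem baseIndex_card (n : ℕ) [NeZero n] : (baseIndex n).card = n + 1 := by
  rw [baseIndex, Finset.card_insert_of_notMem, Finset.card_map, Finset.card_univ,
    Fintype.card_fin]
  intro h
  obtain ⟨i, -, hi⟩ := Finset.mem_map.mp h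
  have h1 := congrArg Fin.val hi
  have h2 := Nat.pos_of_neZero n
  simp at h1
  omega

/-- `η` is the map from the decorated orthogonal Grassmannian to the decorated Grassmannian over the
identity `X ↦ X`, equivariant under the spin group, homogeneous of degree one in each of `s_+` and
`s_-`, and normalized at the base point by
`(X_0, 1, e_1) ↦ (X_0, e_1 ∧ e_{n+1} ∧ e_{n+2} ∧ … ∧ e_{2n})`. -/
structure IsEta {n : ℕ} [NeZero n] (η : DecOG n → DecGr (n + 1) (n + n)) : Prop where
  X_eq : ∀ x, (η x).X = x.X
  base : ∀ x : DecOG n, x.X = baseX n → x.sPlus = 1 → x.sMinus = spinE1 n →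
    (η x).v = (Pi.basisFun ℂ (Fin (n + n))).exteriorPower (n + 1)
      ⟨baseIndex n, baseIndex_card n⟩
  equivariant : ∀ g ∈ spinGroup (quadQ n), ∀ x y : DecOG n,
    y.X = x.X.map (rho n g) → y.sPlus = spinRep n g x.sPlus → y.sMinus = spinRep n g x.sMinus →
    (η y).v = exteriorPower.map (n + 1) (rho n g) (η x).v
  homogeneous : ∀ (a b : ℂ) (x y : DecOG n),
    y.X = x.X → y.sPlus = a • x.sPlus → y.sMinus = b • x.sMinus → (η y).v = (a * b) • (η x).v

/-- `J = I ∩ [n]`. -/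
def lowPart {n : ℕ} (I : Finset (Fin (n + n))) : Finset (Fin n) :=
  Finset.univ.filter fun i => Fin.castAdd n i ∈ I

/-- `J^∨ = {i - n : i ∈ I ∩ [n+1,2n]}`. -/
def highPart {n : ℕ} (I : Finset (Fin (n + n))) : Finset (Fin n) :=
  Finset.univ.filter fun i => Fin.natAdd n i ∈ I

/-! ## Graphs embedded in the disk

A graph embedded in the closed disk with boundary vertices `b_1, …, b_n` in clockwise order is
given by a combinatorial map: the arcs of the boundary circle between consecutive boundary vertices
are added as edges, and the complement of the disk in the sphere becomes the outer face. -/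

/-- The cyclic successor in `Fin n`. -/
def cyc {n : ℕ} (i : Fin n) : Fin n :=
  ⟨((i : ℕ) + 1) % n, Nat.mod_lt _ (lt_of_le_of_lt (Nat.zero_le _) i.isLt)⟩

/-- A combinatorial map with a marked outer face of degree `n`.  A dart is an oriented edge, `rot x`
is the next dart after `x` in clockwise order around the tail of `x`, and `flip x` is the reversed
dart.  The dart `bdry i` is the arc of the boundary circle from `b_i` to `b_{i+1}`; the outer face
lies on its left. -/
structure DiskMap (n : ℕ) where
  Dart : Type
  finite : Finite Dart
  rot : Equiv.Perm Dart
  flip : Equiv.Perm Dart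
  flip_flip : ∀ x, flip (flip x) = x
  flip_ne : ∀ x, flip x ≠ x
  bdry : Fin n → Dart
  bdry_injective : Function.Injective bdry
  bdry_ne_flip : ∀ i j, bdry i ≠ flip (bdry j)
  rot_flip_bdry : ∀ i, rot (flip (bdry i)) = bdry (cyc i)

namespace DiskMap

variable {n : ℕ} (G : DiskMap n)

/-- The permutation that follows a dart by the next one along the face on its right. -/
def faceRot : Equiv.Perm G.Dart := G.rot⁻¹ * G.flip

/-- `x` belongs to an edge of the graph itself, not to the boundary circle. -/
def Inner (x : G.Dart) : Prop := ∀ i, x ≠ G.bdry i ∧ x ≠ G.flip (G.bdry i)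

/-- The vertices of the graph. -/
abbrev Vertex : Type := Quotient (Equiv.Perm.SameCycle.setoid G.rot)

/-- The faces of the combinatorial map, including the outer face. -/
abbrev AllFace : Type := Quotient (Equiv.Perm.SameCycle.setoid G.faceRot)

/-- The tail of a dart. -/
def tail (x : G.Dart) : G.Vertex := Quotient.mk _ x

/-- The face on the right of a dart. -/
def rightFace (x : G.Dart) : G.AllFace := Quotient.mk _ x

/-- The faces of the graph in the disk, that is, all but the outer face. -/
abbrev Face : Type := {f : G.AllFace // ∀ i, f ≠ G.rightFace (G.flip (G.bdry i))}

/-- The combinatorial map is a connected map on the sphere (Euler characteristic `2`), and the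
boundary vertices are distinct. -/
structure IsPlanar : Prop where
  connected : ∀ x y, Relation.ReflTransGen (fun a b => b = G.rot a ∨ b = G.flip a) x y
  euler : Nat.card G.Vertex + Nat.card G.AllFace =
    Nat.card (Quotient (Equiv.Perm.SameCycle.setoid G.flip)) + 2
  boundary_distinct : ∀ i j, G.tail (G.bdry i) = G.tail (G.bdry j) → i = j

/-! ### The medial graph and its strands

The corner at the dart `d` is the sector between `d` and `rot d` at the tail of `d`; it lies in the
face on the right of `d`.  The edges of the medial graph are the corners not in the outer face: the
edge at `d` joins the midpoints of the edges of `d` and `rot d`, where the midpoint of an arc of the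
boundary circle stands for an endpoint `t_j`.  The pair `(d, true)` is this edge directed from `d`
to `rot d`, with the tail of `d` on its right; `(d, false)` is the opposite direction. -/

/-- The dart at whose midpoint a directed edge of the medial graph ends. -/
def medialHead (a : G.Dart × Bool) : G.Dart := if a.2 then G.rot a.1 else a.1

/-- The next directed edge of the medial graph, going straight through the midpoint reached. -/
def medialNext (a : G.Dart × Bool) : G.Dart × Bool :=
  if a.2 then (G.rot.symm (G.flip (G.rot a.1)), false) else (G.flip a.1, true)

/-- The index of the boundary vertex `b_i` next to `t_j`, where `b_i` lies between `t_{2i-1}` and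
`t_{2i}`. -/
def half (j : Fin (n + n)) : Fin n := ⟨(j : ℕ) / 2, by omega⟩

/-- The corner from which the edge of the medial graph at `t_j` starts.  (With zero-based indices,
`b_i` lies between `t_{2i}` and `t_{2i+1}`.) -/
def medialCorner (j : Fin (n + n)) : G.Dart :=
  if (j : ℕ) % 2 = 1 then G.bdry (half j) else G.rot.symm (G.rot.symm (G.bdry (half j)))

/-- The edge of the medial graph at `t_j`, directed away from `t_j`. -/
def medialStart (j : Fin (n + n)) : G.Dart × Bool :=
  (G.medialCorner j, decide ((j : ℕ) % 2 = 1))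

/-- The edge of the medial graph at `t_j`, directed towards `t_j`. -/
def medialEnd (j : Fin (n + n)) : G.Dart × Bool :=
  (G.medialCorner j, decide ((j : ℕ) % 2 = 0))

/-- The directed edges of the medial strand that starts at `t_j`. -/
inductive MedialStrand (j : Fin (n + n)) : G.Dart × Bool → Prop
  | start : MedialStrand j (G.medialStart j)
  | next (a : G.Dart × Bool) : MedialStrand j a → G.Inner (G.medialHead a) →
      MedialStrand j (G.medialNext a)

/-- The medial strand starting at `t_j` ends at `t_k`. -/
def StrandTo (j k : Fin (n + n)) : Prop := G.MedialStrand j (G.medialEnd k)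

/-- The medial strand starting at `t_j` passes through the midpoint of the edge of `x`. -/
def StrandVisits (j : Fin (n + n)) (x : G.Dart) : Prop :=
  G.Inner x ∧ ∃ a, G.MedialStrand j a ∧ (G.medialHead a = x ∨ G.medialHead a = G.flip x)

/-- The graph is reduced: no medial strand is an internal cycle, none intersects itself, and no two
intersect twice. -/
structure IsReduced : Prop where
  no_cycle : ∀ d, (∀ i, d ≠ G.flip (G.bdry i)) → ∃ j b, G.MedialStrand j (d, b)
  no_self_intersection : ∀ j a a', G.MedialStrand j a → G.MedialStrand j a' →
    G.Inner (G.medialHead a) →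
    (G.medialHead a = G.medialHead a' ∨ G.medialHead a = G.flip (G.medialHead a')) → a = a'
  no_double_intersection : ∀ j k, j ≠ k → ¬ G.StrandTo j k → ∀ x y,
    G.StrandVisits j x → G.StrandVisits k x → G.StrandVisits j y → G.StrandVisits k y →
    x = y ∨ x = G.flip y

/-- The medial pairing `τ_G`. -/
def medialPairing : Set (Sym2 (Fin (n + n))) := {p | ∃ j k, p = s(j, k) ∧ G.StrandTo j k}

/-- The pairing `τ_n = {{1,n+1}, …, {n,2n}}`. -/
def tauN (n : ℕ) : Set (Sym2 (Fin (n + n))) :=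
  Set.range fun i : Fin n => s(Fin.castAdd n i, Fin.natAdd n i)

/-- A well-connected graph in the disk: planar, reduced, with medial pairing `τ_n`. -/
structure IsWellConnected : Prop where
  planar : G.IsPlanar
  reduced : G.IsReduced
  pairing : G.medialPairing = tauN n

/-- The regions cut out by the medial graph are the vertices and the faces of the graph. -/
abbrev Region : Type := G.Vertex ⊕ G.Face

/-- The region `u` lies directly on the left of the directed edge `a` of the medial graph. -/
def OnLeft (a : G.Dart × Bool) : G.Region → Prop
  | Sum.inl v => a.2 = false ∧ v = G.tail a.1
  | Sum.inr f => a.2 = true ∧ f.1 = G.rightFace a.1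

/-- The regions `u` and `w` are separated by an edge of the medial graph that does not belong to the
strand starting at `t_j`. -/
def AdjOff (j : Fin (n + n)) (u w : G.Region) : Prop :=
  ∃ (d : G.Dart) (f : G.Face), f.1 = G.rightFace d ∧ u = Sum.inl (G.tail d) ∧ w = Sum.inr f ∧
    ¬ G.MedialStrand j (d, true) ∧ ¬ G.MedialStrand j (d, false)

/-- The region `u` is on the left of the strand starting at `t_j`: it can be joined to a region
directly on the left of the strand without crossing the strand. -/
def LeftOfStrand (j : Fin (n + n)) (u : G.Region) : Prop :=
  ∃ a w, G.MedialStrand j a ∧ G.OnLeft a w ∧ Relation.EqvGen (G.AdjOff j) w u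

open Classical in
/-- `J(u)` is the set of the `i ∈ [n]` with `u` on the left of the strand `β_i` from `t_{n+i}` to
`t_i`. -/
noncomputable def labelJ (u : G.Region) : Finset (Fin n) :=
  Finset.univ.filter fun i => G.LeftOfStrand (Fin.natAdd n i) u

/-- The space `𝓑_G` of positive functions on vertices and faces. -/
abbrev BSpace : Type := G.Region → {r : ℝ // 0 < r}

/-- `Ψ_G`, sending `(X,s_+,s_-)` to `(Σ_{J(u)}(X,s_+,s_-))_u`. -/
noncomputable def Psi [NeZero n] (x : DecOGPos n) : G.BSpace :=
  fun u => ⟨(x.1.cartan (G.labelJ u)).re, (Complex.pos_iff.mp (x.2 (G.labelJ u))).1⟩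

end DiskMap

/-! ### Bipartite graphs in the disk -/

/-- A bipartite graph in the disk: `black x` says that the tail of the dart `x` is black. -/
structure BipDiskMap (N : ℕ) extends DiskMap N where
  black : Dart → Prop
  black_rot : ∀ x, black (rot x) ↔ black x
  black_flip : ∀ x, toDiskMap.Inner x → (black (flip x) ↔ ¬ black x)

namespace BipDiskMap

variable {N : ℕ} (Γ : BipDiskMap N)

open Classical in
/-- The dart that follows `y` on its strand: turn maximally right at a black vertex and maximally
left at a white vertex. -/
noncomputable def zigNext (y : Γ.Dart) : Γ.Dart :=
  if Γ.black (Γ.flip y) then Γ.rot.symm (Γ.flip y) else Γ.rot (Γ.flip y)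

open Classical in
/-- After `y`, the strand leaves the disk at the boundary vertex `d_i`: the head of `y` is `d_i` and
the maximal turn there is along the boundary circle.  (The dart `rot.symm (bdry i)` is the arc from
`d_i` to `d_{i-1}`.) -/
def ZigEndsAt (i : Fin N) (y : Γ.Dart) : Prop :=
  Γ.zigNext y = if Γ.black (Γ.flip y) then Γ.bdry i else Γ.rot.symm (Γ.bdry i)

/-- The darts of the strand ending at `d_i`. -/
inductive ZigStrand (i : Fin N) : Γ.Dart → Prop
  | last (y : Γ.Dart) : Γ.Inner y → Γ.ZigEndsAt i y → ZigStrand i y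
  | pred (y : Γ.Dart) : Γ.Inner y → ZigStrand i (Γ.zigNext y) → ZigStrand i y

/-- The faces `f` and `g` are separated by an edge that does not belong to the strand ending at
`d_i`. -/
def AdjOff (i : Fin N) (f g : Γ.Face) : Prop :=
  ∃ z, Γ.Inner z ∧ f.1 = Γ.rightFace z ∧ g.1 = Γ.rightFace (Γ.flip z) ∧
    ¬ Γ.ZigStrand i z ∧ ¬ Γ.ZigStrand i (Γ.flip z)

/-- The face `f` is on the left of the strand ending at `d_i`: it can be joined to a face directly on
the left of the strand without crossing the strand. -/
def LeftOfStrand (i : Fin N) (f : Γ.Face) : Prop :=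
  ∃ (y : Γ.Dart) (g : Γ.Face), Γ.ZigStrand i y ∧ g.1 = Γ.rightFace (Γ.flip y) ∧
    Relation.EqvGen (Γ.AdjOff i) g f

open Classical in
/-- The target face label `S(f)`. -/
noncomputable def labelS (f : Γ.Face) : Finset (Fin N) :=
  Finset.univ.filter fun i => Γ.LeftOfStrand i f

/-- The space `𝓐_Γ` of positive functions on faces. -/
abbrev ASpace : Type := Γ.Face → {r : ℝ // 0 < r}

/-- `Φ_Γ`, sending `(X,v)` to `(Δ_{S(f)}(X,v))_f`; the face labels have to be `k`-element sets. -/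
noncomputable def Phi {k : ℕ} (hS : ∀ f, (Γ.labelS f).card = k) (x : DecGrPos k N) : Γ.ASpace :=
  fun f => ⟨(x.1.plucker ⟨Γ.labelS f, hS f⟩).re, (Complex.pos_iff.mp (x.2 ⟨_, hS f⟩)).1⟩

end BipDiskMap

/-! ### The bipartite graph `G_+` -/

namespace DiskMap

variable {n : ℕ} (G : DiskMap n)

/-- The darts of `G_+` together with the boundary circle.  For a dart `x` of an edge `e` of `G`, the
dart `wv x` runs from `w_v` to `b_e`, where `v` is the tail of `x`, and `wf x` runs from `w_f` to
`b_e`, where `f` is the face on the right of `x`; `vw x` and `fw x` are the reversed darts.  If `x`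
is an arc of the boundary circle, then its midpoint is the boundary vertex `w_f` instead of a black
vertex, where `f` is the face of `G` at that arc; the dart `wv x` is then half of the arc, and there
is no dart `wf x`. -/
inductive PlusDart : Type
  | wv (x : G.Dart) : PlusDart
  | vw (x : G.Dart) : PlusDart
  | wf (x : G.Dart) (hx : G.Inner x) : PlusDart
  | fw (x : G.Dart) (hx : G.Inner x) : PlusDart

theorem inner_flip {x : G.Dart} (hx : G.Inner x) : G.Inner (G.flip x) := by
  intro i
  refine ⟨fun h => (hx i).2 ?_, fun h => (hx i).1 (G.flip.injective h)⟩
  rw [← h, G.flip_flip]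

open Classical in
/-- The dart of `G_+` from `w_f` to the midpoint of `x`, where `f` is the face on the right of `x`;
if `x` is an arc `b_i b_{i+1}` of the boundary circle, then `w_f` is its midpoint, and the dart
starting there towards `b_i` is taken. -/
noncomputable def faceDart (x : G.Dart) : G.PlusDart :=
  if h : G.Inner x then PlusDart.wf x h else PlusDart.vw x

open Classical in
/-- The clockwise rotation of the darts of `G_+`.  Around `w_v` it is that of `G`; around `b_e` it
is vertex, face, vertex, face; around `w_f` it follows the boundary of `f`. -/
noncomputable def plusRotFun : G.PlusDart → G.PlusDart
  | PlusDart.wv x => PlusDart.wv (G.rot x)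
  | PlusDart.vw x =>
    if h : G.Inner x then PlusDart.fw (G.flip x) (G.inner_flip h)
    else if ∃ i, x = G.bdry i then PlusDart.vw (G.flip x)
    else G.faceDart (G.faceRot (G.flip x))
  | PlusDart.wf x _ => G.faceDart (G.faceRot x)
  | PlusDart.fw x _ => PlusDart.vw x

/-- The reversal of the darts of `G_+`. -/
def plusFlipFun : G.PlusDart → G.PlusDart
  | PlusDart.wv x => PlusDart.vw x
  | PlusDart.vw x => PlusDart.wv x
  | PlusDart.wf x h => PlusDart.fw x h
  | PlusDart.fw x h => PlusDart.wf x h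

theorem plusFlipFun_involutive : Function.Involutive G.plusFlipFun := by
  rintro (x | x | ⟨x, h⟩ | ⟨x, h⟩) <;> rfl

instance plusDart_finite : Finite G.PlusDart := by
  have := G.finite
  let f : G.PlusDart → G.Dart × Fin 4 := fun y => match y with
    | PlusDart.wv x => (x, 0)
    | PlusDart.vw x => (x, 1)
    | PlusDart.wf x _ => (x, 2)
    | PlusDart.fw x _ => (x, 3)
  refine Finite.of_injective f ?_
  rintro (x | x | ⟨x, h⟩ | ⟨x, h⟩) (y | y | ⟨y, k⟩ | ⟨y, k⟩) hxy <;>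
    simp_all [f]

theorem cyc_surjective : Function.Surjective (cyc : Fin n → Fin n) := by
  apply Finite.injective_iff_surjective.mp
  intro i j h
  have h1 : ((i : ℕ) + 1) % n = ((j : ℕ) + 1) % n := congrArg Fin.val h
  have hi := i.isLt
  have hj := j.isLt
  have key : ∀ m, m < n → (m + 1) % n = if m + 1 = n then 0 else m + 1 := by
    intro m hm
    split_ifs with hmn
    · rw [hmn, Nat.mod_self]
    · exact Nat.mod_eq_of_lt (by omega)
  rw [key _ hi, key _ hj] at h1
  apply Fin.ext
  split_ifs at h1 <;> omega

theorem faceRot_flip_bdry (i : Fin n) :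
    G.faceRot (G.flip (G.bdry (cyc i))) = G.flip (G.bdry i) := by
  change G.rot.symm (G.flip (G.flip (G.bdry (cyc i)))) = _
  rw [G.flip_flip, Equiv.symm_apply_eq, G.rot_flip_bdry]

theorem not_inner {x : G.Dart} (h : ¬ G.Inner x) :
    (∃ i, x = G.bdry i) ∨ ∃ i, x = G.flip (G.bdry i) := by
  simp only [Inner, not_forall, not_and_or, not_not] at h
  obtain ⟨i, h | h⟩ := h
  exacts [Or.inl ⟨i, h⟩, Or.inr ⟨i, h⟩]

theorem faceRot_ne {x : G.Dart} (h : ∀ i, x ≠ G.flip (G.bdry i)) (i : Fin n) :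
    G.faceRot x ≠ G.flip (G.bdry i) := by
  intro hx
  rw [← G.faceRot_flip_bdry i] at hx
  exact h _ (G.faceRot.injective hx)

theorem faceDart_injective : Function.Injective G.faceDart := by
  intro x y h
  unfold faceDart at h
  split_ifs at h <;> simpa using h

theorem plusRotFun_injective : Function.Injective G.plusRotFun := by
  have hvw : ∀ {x y : G.Dart}, (∀ i, x ≠ G.flip (G.bdry i)) →
      G.faceDart (G.faceRot x) = PlusDart.vw y → ∃ i, y = G.bdry i := by
    intro x y hx h
    unfold faceDart at h
    split_ifs at h with h1
    rcases G.not_inner h1 with ⟨i, hi⟩ | ⟨i, hi⟩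
    · exact ⟨i, by rw [← hi]; simpa using h.symm⟩
    · exact absurd hi (G.faceRot_ne hx i)
  have hfw : ∀ (x y : G.Dart) (hy : G.Inner y), G.faceDart x ≠ PlusDart.fw y hy := by
    intro x y hy h
    unfold faceDart at h
    split_ifs at h
  have hwv : ∀ (x y : G.Dart), G.faceDart x ≠ PlusDart.wv y := by
    intro x y h
    unfold faceDart at h
    split_ifs at h
  have hne : ∀ {x : G.Dart}, ¬ G.Inner x → (¬ ∃ i, x = G.bdry i) →
      ∃ i, G.flip x = G.bdry i := by
    intro x h1 h2
    obtain ⟨i, hi⟩ := (G.not_inner h1).resolve_left h2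
    exact ⟨i, by rw [hi, G.flip_flip]⟩
  have hne2 : ∀ {x : G.Dart}, (∃ i, x = G.bdry i) → ∀ j, x ≠ G.flip (G.bdry j) := by
    rintro x ⟨i, rfl⟩ j
    exact G.bdry_ne_flip i j
  have hinn : ∀ {x : G.Dart}, G.Inner x → ¬ ∃ i, x = G.bdry i := by
    rintro x hx ⟨i, hi⟩
    exact (hx i).1 hi
  have hflip : ∀ {x : G.Dart}, (∃ i, x = G.bdry i) → ¬ ∃ i, G.flip x = G.bdry i := by
    rintro x ⟨i, rfl⟩ ⟨j, hj⟩
    exact G.bdry_ne_flip j i hj.symm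
  have hinn2 : ∀ {x : G.Dart}, G.Inner x → ∀ i, x ≠ G.flip (G.bdry i) := fun hx i => (hx i).2
  rintro (x | x | ⟨x, hx⟩ | ⟨x, hx⟩) (y | y | ⟨y, hy⟩ | ⟨y, hy⟩) h <;>
    simp only [plusRotFun] at h
  · simpa using h
  · split_ifs at h
    exact absurd h.symm (hwv _ _)
  · exact absurd h.symm (hwv _ _)
  · cases h
  · split_ifs at h
    exact absurd h (hwv _ _)
  · by_cases hx : G.Inner x
    · rw [dif_pos hx] at h
      by_cases hy : G.Inner y
      · rw [dif_pos hy] at h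
        simpa using h
      · rw [dif_neg hy] at h
        split_ifs at h
        exact absurd h.symm (hfw _ _ _)
    · rw [dif_neg hx] at h
      by_cases hy : G.Inner y
      · rw [dif_pos hy] at h
        split_ifs at h
        exact absurd h (hfw _ _ _)
      · rw [dif_neg hy] at h
        by_cases hx1 : ∃ i, x = G.bdry i
        · rw [if_pos hx1] at h
          by_cases hy1 : ∃ i, y = G.bdry i
          · rw [if_pos hy1] at h
            simpa using h
          · rw [if_neg hy1] at h
            exact absurd (hvw (hne2 (hne hy hy1)) h.symm) (hflip hx1)
        · rw [if_neg hx1] at h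
          by_cases hy1 : ∃ i, y = G.bdry i
          · rw [if_pos hy1] at h
            exact absurd (hvw (hne2 (hne hx hx1)) h) (hflip hy1)
          · rw [if_neg hy1] at h
            rw [G.flip.injective (G.faceRot.injective (G.faceDart_injective h))]
  · split_ifs at h with h1 h2
    · exact absurd h.symm (hfw _ _ _)
    · exact absurd (hvw (hinn2 hy) h.symm) (hflip h2)
    · have := G.faceRot.injective (G.faceDart_injective h)
      exact absurd (this ▸ hne h1 h2) (hinn hy)
  · split_ifs at h with h1 h2
    · simp only [PlusDart.vw.injEq] at h
      exact absurd (h ▸ hy) (fun h3 => h1 (by simpa [G.flip_flip] using G.inner_flip h3))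
    · exact absurd (hvw (hne2 (hne h1 h2)) h) (hinn hy)
  · exact absurd h (hwv _ _)
  · split_ifs at h with h1 h2
    · exact absurd h (hfw _ _ _)
    · exact absurd (hvw (hinn2 hx) h) (hflip h2)
    · have := G.faceRot.injective (G.faceDart_injective h)
      exact absurd (this ▸ hne h1 h2) (hinn hx)
  · have := G.faceRot.injective (G.faceDart_injective h)
    subst this
    rfl
  · exact absurd (hvw (hinn2 hx) h) (hinn hy)
  · cases h
  · split_ifs at h with h1 h2
    · simp only [PlusDart.vw.injEq] at h
      exact absurd (h ▸ hx) (fun h3 => h1 (by simpa [G.flip_flip] using G.inner_flip h3))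
    · exact absurd (hvw (hne2 (hne h1 h2)) h.symm) (hinn hx)
  · exact absurd (hvw (hinn2 hy) h.symm) (hinn hx)
  · simp only [PlusDart.vw.injEq] at h
    subst h
    rfl

/-- The rotation of `G_+`, as a permutation. -/
noncomputable def plusRot : Equiv.Perm G.PlusDart :=
  Equiv.ofBijective G.plusRotFun (Finite.injective_iff_bijective.mp G.plusRotFun_injective)

/-- The arcs of the boundary circle of `G_+`.  Its boundary vertices are `d_{2i-1} = b_i` and
`d_{2i}`, the vertex `w_f` of the face `f` at the arc from `b_i` to `b_{i+1}`.  (With zero-based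
indices, `d_{2i} = b_i`, and `d_{2i+1}` lies on the arc `bdry i`.) -/
def plusBdry (j : Fin (n + n)) : G.PlusDart :=
  if (j : ℕ) % 2 = 0 then PlusDart.wv (G.bdry (half j))
  else PlusDart.vw (G.flip (G.bdry (half j)))

theorem plusBdry_injective : Function.Injective G.plusBdry := by
  intro i j h
  unfold plusBdry at h
  have key : half i = half j → (i : ℕ) % 2 = (j : ℕ) % 2 → i = j := by
    intro h1 h2
    have h3 : (i : ℕ) / 2 = (j : ℕ) / 2 := congrArg Fin.val h1
    exact Fin.ext (by omega)
  split_ifs at h with h1 h2 h2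
  · exact key (G.bdry_injective (by simpa using h)) (by omega)
  · exact key (G.bdry_injective (G.flip.injective (by simpa using h))) (by omega)

theorem not_inner_bdry (i : Fin n) : ¬ G.Inner (G.bdry i) := fun h => (h i).1 rfl

theorem not_inner_flip_bdry (i : Fin n) : ¬ G.Inner (G.flip (G.bdry i)) := fun h => (h i).2 rfl

theorem plusRot_flip_bdry (j : Fin (n + n)) :
    G.plusRotFun (G.plusFlipFun (G.plusBdry j)) = G.plusBdry (cyc j) := by
  have hj := j.isLt
  by_cases h : (j : ℕ) % 2 = 0
  · have hc : ((cyc j : Fin (n + n)) : ℕ) = j + 1 := Nat.mod_eq_of_lt (by omega)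
    have hh : half (cyc j) = half j := Fin.ext (by simp only [half, hc]; omega)
    have h2 : ¬ ((cyc j : Fin (n + n)) : ℕ) % 2 = 0 := by omega
    simp only [plusBdry, h, h2, hh, if_true, if_false, plusFlipFun, plusRotFun]
    rw [dif_neg (G.not_inner_bdry _), if_pos ⟨_, rfl⟩]
  · have hh : half (cyc j) = cyc (half j) ∧ ((cyc j : Fin (n + n)) : ℕ) % 2 = 0 := by
      by_cases hl : (j : ℕ) + 1 = n + n
      · have hc : ((cyc j : Fin (n + n)) : ℕ) = 0 := by simp [cyc, hl]
        have hd : (((half j : Fin n) : ℕ) + 1) = n := by simp only [half]; omega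
        refine ⟨Fin.ext ?_, by omega⟩
        change ((cyc j : Fin (n + n)) : ℕ) / 2 = ((half j : ℕ) + 1) % n
        rw [hc, hd, Nat.mod_self]
      · have hc : ((cyc j : Fin (n + n)) : ℕ) = j + 1 := Nat.mod_eq_of_lt (by omega)
        refine ⟨Fin.ext ?_, by omega⟩
        change ((cyc j : Fin (n + n)) : ℕ) / 2 = ((j : ℕ) / 2 + 1) % n
        rw [hc, Nat.mod_eq_of_lt (by omega)]
        omega
    simp only [plusBdry, h, hh.2, hh.1, if_true, if_false, plusFlipFun, plusRotFun,
      G.rot_flip_bdry]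

/-- A dart of `G_+` starts at a black vertex, that is, at the midpoint of an edge of `G`. -/
def PlusBlack : G.PlusDart → Prop
  | PlusDart.wv _ => False
  | PlusDart.vw x => G.Inner x
  | PlusDart.wf _ _ => False
  | PlusDart.fw _ _ => True

theorem not_plusBlack_faceDart {x : G.Dart} : ¬ G.PlusBlack (G.faceDart x) := by
  unfold faceDart
  split_ifs with h
  · simp [PlusBlack]
  · simpa [PlusBlack] using h

/-- The bipartite graph `G_+` in the disk, with boundary vertices `d_1, …, d_{2n}`, all white. -/
noncomputable def plus : BipDiskMap (n + n) where
  Dart := G.PlusDart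
  finite := G.plusDart_finite
  rot := G.plusRot
  flip := G.plusFlipFun_involutive.toPerm
  flip_flip := G.plusFlipFun_involutive
  flip_ne := by
    rintro (x | x | ⟨x, h⟩ | ⟨x, h⟩) hx <;> cases hx
  bdry := G.plusBdry
  bdry_injective := G.plusBdry_injective
  bdry_ne_flip := by
    intro i j h
    change G.plusBdry i = G.plusFlipFun (G.plusBdry j) at h
    unfold plusBdry at h
    split_ifs at h with h1 h2 h2
    · cases h
    · exact G.bdry_ne_flip _ _ (by simpa [plusFlipFun] using h)
    · exact G.bdry_ne_flip _ _ (by simpa [plusFlipFun] using h.symm)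
    · cases h
  rot_flip_bdry := G.plusRot_flip_bdry
  black := G.PlusBlack
  black_rot := by
    intro y
    change G.PlusBlack (G.plusRotFun y) ↔ G.PlusBlack y
    rcases y with x | x | ⟨x, h⟩ | ⟨x, h⟩
    · exact Iff.rfl
    · by_cases h1 : G.Inner x
      · simp [plusRotFun, PlusBlack, h1]
      · have h2 : ¬ G.Inner (G.flip x) := fun h3 => h1 (by
          simpa [G.flip_flip] using G.inner_flip h3)
        simp only [plusRotFun, dif_neg h1]
        split_ifs with h4
        · simp [PlusBlack, h1, h2]
        · simpa [PlusBlack, h1] using G.not_plusBlack_faceDart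
    · simpa [plusRotFun, PlusBlack] using G.not_plusBlack_faceDart
    · simpa [plusRotFun, PlusBlack] using h
  black_flip := by
    intro y hy
    have aux : ∀ x : G.Dart, (∀ j, PlusDart.wv x ≠ G.plusBdry j) →
        (∀ j, PlusDart.vw x ≠ G.plusBdry j) → G.Inner x := by
      intro x h1 h2
      by_contra hx
      rcases G.not_inner hx with ⟨i, rfl⟩ | ⟨i, rfl⟩
      · refine h1 ⟨2 * i, by omega⟩ ?_
        have : half (⟨2 * i, by omega⟩ : Fin (n + n)) = i := Fin.ext (by simp [half])
        simp [plusBdry, this]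
      · refine h2 ⟨2 * i + 1, by omega⟩ ?_
        have : half (⟨2 * i + 1, by omega⟩ : Fin (n + n)) = i :=
          Fin.ext (by simp only [half]; omega)
        simp [plusBdry, this]
    have hy1 : ∀ j, y ≠ G.plusBdry j := fun j => (hy j).1
    have hy2 : ∀ j, G.plusFlipFun y ≠ G.plusBdry j := by
      intro j h
      refine (hy j).2 ?_
      change y = G.plusFlipFun (G.plusBdry j)
      rw [← h, G.plusFlipFun_involutive]
    change G.PlusBlack (G.plusFlipFun y) ↔ ¬ G.PlusBlack y
    rcases y with x | x | ⟨x, h⟩ | ⟨x, h⟩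
    · simpa [plusFlipFun, PlusBlack] using aux x hy1 hy2
    · simpa [plusFlipFun, PlusBlack] using aux x hy2 hy1
    · simp [plusFlipFun, PlusBlack]
    · simp [plusFlipFun, PlusBlack]

/-- `q` is the white vertex `w_u` of `G_+` placed at the vertex or face `u` of `G`. -/
def IsWhite : G.Region → G.plus.Vertex → Prop
  | Sum.inl v, q => ∃ x, v = G.tail x ∧ q = G.plus.tail (PlusDart.wv x)
  | Sum.inr f, q => ∃ x, f.1 = G.rightFace x ∧ q = G.plus.tail (G.faceDart x)

/-- The face `g` of `G_+` is incident to the white vertex `w_u`. -/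
def Incident (g : G.plus.Face) (u : G.Region) : Prop :=
  ∃ y : G.plus.Dart, G.IsWhite u (G.plus.tail y) ∧ g.1 = G.plus.rightFace y

/-- `i_G^+`, sending `B` to the function `A` with `A_g = B_v B_f`, where `v ∈ V(G)` and `f ∈ F(G)`
are such that `g` is incident to `w_v` and `w_f`. -/
noncomputable def iPlus (B : G.BSpace) : G.plus.ASpace :=
  fun g => (∏ᶠ (v : G.Vertex) (_ : G.Incident g (Sum.inl v)), B (Sum.inl v)) *
    ∏ᶠ (f : G.Face) (_ : G.Incident g (Sum.inr f)), B (Sum.inr f)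

end DiskMap

end ElecOG

/-!
Pure spinors turn the map `η` into a quadratic expression. The exterior algebra `⋀ ℂ^{2n}` carries
two anticommuting Clifford actions, by the operators `x ∧ · ± Q(x, ·) ⌟ ·`, and the product of the
two operators of one vector `x` is, up to the factor `Q(x,x)`, the action of the reflection in `x`.
The bilinear map `spinorProd : S × S → ⋀ ℂ^{2n}` intertwines these two actions with the action on
the two copies of the spin module `S`; since `Spin(Q)` is generated by products of vectors, it is
`Spin(Q)`-equivariant (`map_rho_spinorProd`). It sends `(1, e_1)` to `e_1 ∧ e_{n+1} ∧ ⋯ ∧ e_{2n}`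
plus a multivector of degree `n - 1`, so the Plücker coordinates of a translate of the base point are
coordinates of the spinor product of `s_+` and `s_-`. For `#(J ∩ J^∨) = 1` such a coordinate involves
only one product of a coordinate of `s_+` and one of `s_-`, because all other basis vectors of `S` lie
in the image of a vector of `ℂ^{2n}` whose Clifford operators have no component at `e_I`
(`coord_spinorProd_crossIndex`, `repr_map_rho_baseVec`).

`Spin(Q)` and rescaling of the spinors act transitively on the decorated subspaces
(`exists_isTranslate`). Hence `η` is unique, and it may be defined by translating the base point. It is
well defined: an element that fixes `X_0` multiplies `e_1 ∧ e_{n+1} ∧ ⋯ ∧ e_{2n}` by a scalar, which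
the coordinate formula expresses through the action on the two spinors
(`IsTranslate.smul_map_baseVec_eq`). Positivity of all Plücker coordinates follows by induction on
`#(J ∩ J^∨)` from three-term Plücker relations, in which all terms but one have a smaller
intersection (`exists_plucker_relation`, `eta_isPos`).

For the graph, a *corner* is a dart `d`, standing for the sector at the tail of `d` between `d` and
the next dart; the corners inside the disk are the edges of the medial graph, and they correspond to
the faces of `G_+` (`plusFaceAt`). The face around the corner `d` is incident to the vertex `v` and
the face `f` at `d` (`incident_inl_iff`, `incident_inr_iff`). In a well-connected graph every corner
lies on exactly one strand `β_i`. Two facts determine the labels.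

* The strand `β_i` has no region on both of its sides (`not_leftOfStrand_both`). The Euler
  characteristic shows that the corners met by `β_i`, closed up along the boundary circle, form the
  coboundary of a function on vertices and faces with values in `ZMod 2`
  (`IsPlanar.exists_potential`), and this function separates the two sides.
* A strand of `G_+` ending at `d_j` runs along the medial strand ending at `t_j` (`zigStrand_iff`),
  and every face of `G_+` is on the left of the strand ending at `d_i` or of the one ending at
  `d_{n+i}` (`plusLeftOfSome`), on the left of both when it lies on `β_i`. This follows
  by walking around the vertices and faces of `G`. A walk crosses the boundary circle at most once
  around each vertex and face, the faces at the boundary arcs being distinct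
  (`rightFace_bdry_injective`).

So for the face `g` of `G_+` around a corner `d` on `β_i` and for `k ≠ i`, exactly one of `k` and
`n + k` is in `S(g)`, and it is `k` if and only if `k` is in `J(v)` or, equivalently, in `J(f)`, while
`i` and `n + i` are both in `S(g)` and `i` is in exactly one of `J(v)` and `J(f)`
(`labelS_plusFaceAt`). Hence the Plücker coordinate at `S(g)` is one of those that factor.
-/

/-! ### Contraction, parity and reversal in an exterior algebra -/

namespace ElecOG

section ExteriorBasis

variable {R M ι : Type*} [CommRing R] [AddCommGroup M] [Module R M]

/-- Contraction of an element of the exterior algebra by a linear form. -/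
noncomputable def contr (d : Module.Dual R M) : ExteriorAlgebra R M →ₗ[R] ExteriorAlgebra R M :=
  CliffordAlgebra.contractLeft (Q := (0 : QuadraticForm R M)) d

/-- The parity automorphism of the exterior algebra, `-1` on vectors. -/
noncomputable def parity : ExteriorAlgebra R M →ₐ[R] ExteriorAlgebra R M :=
  CliffordAlgebra.involute (Q := (0 : QuadraticForm R M))

/-- The reversal `x₁ ∧ ⋯ ∧ x_r ↦ x_r ∧ ⋯ ∧ x₁` of the exterior algebra. -/
noncomputable def revert : ExteriorAlgebra R M →ₗ[R] ExteriorAlgebra R M :=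
  CliffordAlgebra.reverse (Q := (0 : QuadraticForm R M))

/-- Induction on elements of the exterior algebra by multiplying with vectors on the left. -/
theorem exterior_left_induction {P : ExteriorAlgebra R M → Prop} (one : P 1)
    (smul : ∀ (r : R) x, P x → P (r • x)) (add : ∀ x y, P x → P y → P (x + y))
    (ι_mul : ∀ x m, P x → P (ExteriorAlgebra.ι R m * x)) (x : ExteriorAlgebra R M) : P x := by
  refine CliffordAlgebra.left_induction (Q := (0 : QuadraticForm R M)) ?_ add
    (fun x m h => ι_mul x m h) x
  intro r
  rw [Algebra.algebraMap_eq_smul_one]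
  exact smul r 1 one

theorem contr_one (d : Module.Dual R M) : contr d (1 : ExteriorAlgebra R M) = 0 :=
  CliffordAlgebra.contractLeft_one (Q := (0 : QuadraticForm R M)) d

theorem contr_ι_mul (d : Module.Dual R M) (m : M) (x : ExteriorAlgebra R M) :
    contr d (ExteriorAlgebra.ι R m * x) = d m • x - ExteriorAlgebra.ι R m * contr d x :=
  CliffordAlgebra.contractLeft_ι_mul (Q := (0 : QuadraticForm R M)) d m x

theorem contr_ι (d : Module.Dual R M) (m : M) :
    contr d (ExteriorAlgebra.ι R m) = d m • (1 : ExteriorAlgebra R M) := by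
  have h := contr_ι_mul d m 1
  rwa [mul_one, contr_one, mul_zero, sub_zero] at h

theorem contr_contr (d : Module.Dual R M) (x : ExteriorAlgebra R M) : contr d (contr d x) = 0 :=
  CliffordAlgebra.contractLeft_contractLeft (Q := (0 : QuadraticForm R M)) d x

theorem contr_comm (d d' : Module.Dual R M) (x : ExteriorAlgebra R M) :
    contr d (contr d' x) = -contr d' (contr d x) :=
  CliffordAlgebra.contractLeft_comm (Q := (0 : QuadraticForm R M)) d d' x

theorem contr_add (d d' : Module.Dual R M) : contr (d + d') = contr d + contr d' :=
  map_add (CliffordAlgebra.contractLeft (Q := (0 : QuadraticForm R M))) d d'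

theorem contr_smul (r : R) (d : Module.Dual R M) : contr (r • d) = r • contr d :=
  map_smul (CliffordAlgebra.contractLeft (Q := (0 : QuadraticForm R M))) r d

theorem contr_zero : contr (0 : Module.Dual R M) = 0 :=
  map_zero (CliffordAlgebra.contractLeft (Q := (0 : QuadraticForm R M)))

theorem ι_ι_mul (m : M) (x : ExteriorAlgebra R M) :
    ExteriorAlgebra.ι R m * (ExteriorAlgebra.ι R m * x) = 0 := by
  rw [← mul_assoc, ExteriorAlgebra.ι_sq_zero, zero_mul]

theorem ι_ι_mul_comm (m m' : M) (x : ExteriorAlgebra R M) :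
    ExteriorAlgebra.ι R m * (ExteriorAlgebra.ι R m' * x) =
      -(ExteriorAlgebra.ι R m' * (ExteriorAlgebra.ι R m * x)) := by
  rw [← mul_assoc, ← mul_assoc, eq_neg_iff_add_eq_zero, ← add_mul,
    ExteriorAlgebra.ι_add_mul_swap, zero_mul]

theorem parity_ι (m : M) :
    parity (ExteriorAlgebra.ι R m) = -ExteriorAlgebra.ι R m :=
  CliffordAlgebra.involute_ι (Q := (0 : QuadraticForm R M)) m

theorem parity_parity (x : ExteriorAlgebra R M) : parity (parity x) = x :=
  CliffordAlgebra.involute_involute (Q := (0 : QuadraticForm R M)) x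

theorem parity_contr (d : Module.Dual R M) (x : ExteriorAlgebra R M) :
    parity (contr d x) = -contr d (parity x) := by
  induction x using exterior_left_induction with
  | one => simp [contr_one]
  | smul r x h => simp [h]
  | add x y h h' => simp [h, h', add_comm]
  | ι_mul x m h =>
    rw [contr_ι_mul, map_sub, map_smul, map_mul, map_mul, h, parity_ι, neg_mul, neg_mul, map_neg,
      contr_ι_mul, mul_neg]
    abel

/-- Moving a vector through an element of the exterior algebra changes the latter by parity. -/
theorem mul_ι_eq_ι_mul_parity (m : M) (x : ExteriorAlgebra R M) :
    x * ExteriorAlgebra.ι R m = ExteriorAlgebra.ι R m * parity x := by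
  induction x using exterior_left_induction with
  | one => simp
  | smul r x h => simp [h]
  | add x y h h' => simp [add_mul, mul_add, h, h']
  | ι_mul x m' h =>
    rw [mul_assoc, h, map_mul, parity_ι, neg_mul, mul_neg, ι_ι_mul_comm]

theorem revert_one : revert (1 : ExteriorAlgebra R M) = 1 :=
  CliffordAlgebra.reverse.map_one (Q := (0 : QuadraticForm R M))

theorem revert_ι (m : M) : revert (ExteriorAlgebra.ι R m) = ExteriorAlgebra.ι R m :=
  CliffordAlgebra.reverse_ι (Q := (0 : QuadraticForm R M)) m

theorem revert_mul (x y : ExteriorAlgebra R M) : revert (x * y) = revert y * revert x :=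
  CliffordAlgebra.reverse.map_mul (Q := (0 : QuadraticForm R M)) x y

theorem parity_revert (x : ExteriorAlgebra R M) : parity (revert x) = revert (parity x) :=
  (CliffordAlgebra.reverse_involute (Q := (0 : QuadraticForm R M)) x).symm

theorem revert_ι_mul_parity (m : M) (x : ExteriorAlgebra R M) :
    revert (ExteriorAlgebra.ι R m * parity x) = ExteriorAlgebra.ι R m * revert x := by
  rw [revert_mul, revert_ι, mul_ι_eq_ι_mul_parity, parity_revert, parity_parity]

theorem revert_contr_parity (d : Module.Dual R M) (x : ExteriorAlgebra R M) :
    revert (contr d (parity x)) = -contr d (revert x) := by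
  induction x using exterior_left_induction with
  | one => simp [contr_one, revert_one]
  | smul r x h => simp [h]
  | add x y h h' => simp [h, h', add_comm]
  | ι_mul x m h =>
    rw [map_mul, parity_ι, neg_mul, map_neg, map_neg, contr_ι_mul, map_sub, map_smul, revert_mul,
      revert_ι, h, revert_mul, revert_ι, mul_ι_eq_ι_mul_parity,
      mul_ι_eq_ι_mul_parity, contr_ι_mul, map_neg, parity_contr, parity_revert]
    simp

variable [LinearOrder ι] (b : Module.Basis ι R M)

theorem basisExterior_eq_prod_sort (S : Finset ι) :
    b.ExteriorAlgebra S = ((S.sort (· ≤ ·)).map fun i => ExteriorAlgebra.ι R (b i)).prod := by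
  rw [ExteriorAlgebra.basis_apply_ofCard b (rfl : S.card = S.card),
    ExteriorAlgebra.ιMulti_family, ExteriorAlgebra.ιMulti_apply]
  congr 1
  refine List.ext_getElem (by simp) fun i h1 h2 => ?_
  simp only [List.getElem_ofFn, List.getElem_map, Function.comp_apply]
  rfl

theorem basisExterior_empty : b.ExteriorAlgebra (∅ : Finset ι) = 1 := by
  rw [basisExterior_eq_prod_sort]
  simp

theorem basisExterior_insert_lt {a : ι} {S : Finset ι} (h : ∀ j ∈ S, a < j) :
    b.ExteriorAlgebra (insert a S) = ExteriorAlgebra.ι R (b a) * b.ExteriorAlgebra S := by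
  rw [basisExterior_eq_prod_sort, basisExterior_eq_prod_sort,
    Finset.sort_insert (· ≤ ·) (fun j hj => (h j hj).le) (fun ha => (h a ha).false)]
  simp

theorem ι_mul_basisExterior_mem {k : ι} {S : Finset ι} (hk : k ∈ S) :
    ExteriorAlgebra.ι R (b k) * b.ExteriorAlgebra S = 0 := by
  induction S using Finset.induction_on_min with
  | empty => simp at hk
  | insert a S ha hS =>
    rw [basisExterior_insert_lt b ha]
    rcases Finset.mem_insert.mp hk with rfl | hk
    · exact ι_ι_mul _ _
    · rw [ι_ι_mul_comm, hS hk, mul_zero, neg_zero]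

theorem ι_mul_basisExterior {k : ι} {S : Finset ι} (hk : k ∉ S) :
    ExteriorAlgebra.ι R (b k) * b.ExteriorAlgebra S =
      (-1 : R) ^ (S.filter (· < k)).card • b.ExteriorAlgebra (insert k S) := by
  induction S using Finset.induction_on_min with
  | empty => simpa using (basisExterior_insert_lt b (a := k) (S := ∅) (by simp)).symm
  | insert a S ha hS =>
    have haS : a ∉ S := fun h => (ha a h).false
    simp only [Finset.mem_insert, not_or] at hk
    rcases lt_or_gt_of_ne hk.1 with hlt | hlt
    · have h1 : ∀ j ∈ insert a S, k < j := by
        intro j hj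
        rcases Finset.mem_insert.mp hj with rfl | hj
        exacts [hlt, hlt.trans (ha j hj)]
      rw [basisExterior_insert_lt b h1, Finset.filter_false_of_mem fun j hj => (h1 j hj).not_gt]
      simp
    · have h1 : ∀ j ∈ insert k S, a < j := by
        intro j hj
        rcases Finset.mem_insert.mp hj with rfl | hj
        exacts [hlt, ha j hj]
      rw [basisExterior_insert_lt b ha, ι_ι_mul_comm, hS hk.2, Finset.insert_comm,
        basisExterior_insert_lt b h1, Finset.filter_insert, if_pos hlt,
        Finset.card_insert_of_notMem (by simp [haS]), pow_succ]
      simp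

theorem contr_basisExterior_notMem {k : ι} {S : Finset ι} (hk : k ∉ S) :
    contr (b.coord k) (b.ExteriorAlgebra S) = 0 := by
  induction S using Finset.induction_on_min with
  | empty => rw [basisExterior_empty, contr_one]
  | insert a S ha hS =>
    simp only [Finset.mem_insert, not_or] at hk
    rw [basisExterior_insert_lt b ha, contr_ι_mul, hS hk.2]
    simp [Ne.symm hk.1]

theorem contr_basisExterior {k : ι} {S : Finset ι} (hk : k ∉ S) :
    contr (b.coord k) (b.ExteriorAlgebra (insert k S)) =
      (-1 : R) ^ (S.filter (· < k)).card • b.ExteriorAlgebra S := by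
  have h := ι_mul_basisExterior b hk
  have h2 := congrArg (contr (b.coord k)) h
  rw [contr_ι_mul, contr_basisExterior_notMem b hk, map_smul] at h2
  simp only [Module.Basis.coord_apply, Module.Basis.repr_self, Finsupp.single_eq_same, one_smul,
    mul_zero, sub_zero] at h2
  conv_rhs => rw [h2]
  rw [smul_smul, ← mul_pow]
  simp

theorem parity_basisExterior (S : Finset ι) :
    parity (b.ExteriorAlgebra S) = (-1 : R) ^ S.card • b.ExteriorAlgebra S := by
  induction S using Finset.induction_on_min with
  | empty => simp [basisExterior_empty]
  | insert a S ha hS =>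
    have haS : a ∉ S := fun h => (ha a h).false
    rw [basisExterior_insert_lt b ha, map_mul, hS, parity_ι, Finset.card_insert_of_notMem haS,
      pow_succ]
    simp

theorem revert_basisExterior (S : Finset ι) :
    revert (b.ExteriorAlgebra S) = (-1 : R) ^ (S.card.choose 2) • b.ExteriorAlgebra S := by
  induction S using Finset.induction_on_min with
  | empty => simp [basisExterior_empty, revert_one]
  | insert a S ha hS =>
    have haS : a ∉ S := fun h => (ha a h).false
    rw [basisExterior_insert_lt b ha, revert_mul, hS, revert_ι, mul_ι_eq_ι_mul_parity,
      Finset.card_insert_of_notMem haS, Nat.choose_succ_succ' S.card 1, map_smul,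
      parity_basisExterior, smul_smul, ← pow_add]
    simp [add_comm]

theorem coord_ι_mul_eq_zero {k : ι} {I : Finset ι} (hk : k ∉ I) (x : ExteriorAlgebra R M) :
    b.ExteriorAlgebra.coord I (ExteriorAlgebra.ι R (b k) * x) = 0 := by
  suffices h : b.ExteriorAlgebra.coord I ∘ₗ LinearMap.mulLeft R (ExteriorAlgebra.ι R (b k)) = 0 from
    LinearMap.congr_fun h x
  refine b.ExteriorAlgebra.ext fun S => ?_
  by_cases hS : k ∈ S
  · simp [ι_mul_basisExterior_mem b hS]
  · have : insert k S ≠ I := fun h => hk (h ▸ Finset.mem_insert_self k S)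
    simp [ι_mul_basisExterior b hS, this]

theorem coord_contr_eq_zero {k : ι} {I : Finset ι} (hk : k ∈ I) (x : ExteriorAlgebra R M) :
    b.ExteriorAlgebra.coord I (contr (b.coord k) x) = 0 := by
  suffices h : b.ExteriorAlgebra.coord I ∘ₗ contr (b.coord k) = 0 from LinearMap.congr_fun h x
  refine b.ExteriorAlgebra.ext fun S => ?_
  by_cases hS : k ∈ S
  · have h : S.erase k ≠ I := fun h => Finset.notMem_erase k S (h ▸ hk)
    rw [← Finset.insert_erase hS]
    simp [contr_basisExterior b (Finset.notMem_erase k S), h]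
  · simp [contr_basisExterior_notMem b hS]

/-- The coordinate at `I ∪ {k}` of `b k ∧ (b_l^* ⌟ x)` is up to sign that of `x` at `I ∪ {l}`. -/
theorem coord_ι_mul_contr {k l : ι} {I : Finset ι} (hk : k ∉ I) (hl : l ∉ I)
    (x : ExteriorAlgebra R M) :
    b.ExteriorAlgebra.coord (insert k I) (ExteriorAlgebra.ι R (b k) * contr (b.coord l) x) =
      (-1) ^ ((I.filter (· < k)).card + (I.filter (· < l)).card) *
        b.ExteriorAlgebra.coord (insert l I) x := by
  suffices h : b.ExteriorAlgebra.coord (insert k I) ∘ₗ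
      LinearMap.mulLeft R (ExteriorAlgebra.ι R (b k)) ∘ₗ contr (b.coord l) =
      ((-1 : R) ^ ((I.filter (· < k)).card + (I.filter (· < l)).card)) •
        b.ExteriorAlgebra.coord (insert l I) from LinearMap.congr_fun h x
  refine b.ExteriorAlgebra.ext fun S => ?_
  simp only [LinearMap.comp_apply, LinearMap.smul_apply, LinearMap.mulLeft_apply, smul_eq_mul]
  by_cases hS : l ∈ S
  · obtain ⟨T, hT, rfl⟩ : ∃ T, l ∉ T ∧ insert l T = S :=
      ⟨S.erase l, Finset.notMem_erase l S, Finset.insert_erase hS⟩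
    rw [contr_basisExterior b hT]
    by_cases hkT : k ∈ T
    · have : insert l T ≠ insert l I := by
        intro h
        have h2 : T = I := by
          rw [← Finset.erase_insert hT, h, Finset.erase_insert hl]
        exact hk (h2 ▸ hkT)
      simp [ι_mul_basisExterior_mem b hkT, this]
    · by_cases hTI : T = I
      · subst hTI
        simp [ι_mul_basisExterior b hkT, pow_add, mul_comm]
      · have h1 : insert l T ≠ insert l I := fun h => hTI <| by
          rw [← Finset.erase_insert hT, h, Finset.erase_insert hl]
        have h2 : insert k T ≠ insert k I := fun h => hTI <| by
          rw [← Finset.erase_insert hkT, h, Finset.erase_insert hk]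
        simp [ι_mul_basisExterior b hkT, h1, h2]
  · have h1 : S ≠ insert l I := fun h => hS (h ▸ Finset.mem_insert_self l I)
    simp [contr_basisExterior_notMem b hS, h1]

theorem coord_coe_exteriorPower {m : ℕ} (w : ⋀[R]^m M) (I : Finset ι) :
    b.ExteriorAlgebra.coord I (w : ExteriorAlgebra R M) =
      if h : I.card = m then (b.exteriorPower m).repr w ⟨I, h⟩ else 0 := by
  suffices h : b.ExteriorAlgebra.coord I ∘ₗ (⋀[R]^m M).subtype =
      if h : I.card = m then (b.exteriorPower m).coord ⟨I, h⟩ else 0 by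
    have := LinearMap.congr_fun h w
    split_ifs with h1 <;> simpa [h1] using this
  refine (b.exteriorPower m).ext fun S => ?_
  rw [LinearMap.comp_apply, Submodule.subtype_apply, ← ExteriorAlgebra.basis_eq_coe_basis]
  split_ifs with h1
  · have : (S.1 = I) ↔ S = (⟨I, h1⟩ : Set.powersetCard ι m) :=
      ⟨fun h => Subtype.ext h, fun h => congrArg Subtype.val h⟩
    simp only [Module.Basis.coord_apply, Module.Basis.repr_self, Finsupp.single_apply, this]
  · have : S.1 ≠ I := fun h => h1 (h ▸ S.2)
    simp [this]

theorem coe_exteriorPower_map {N : Type*} [AddCommGroup N] [Module R N] {m : ℕ} (f : M →ₗ[R] N)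
    (w : ⋀[R]^m M) :
    ((exteriorPower.map m f w : ⋀[R]^m N) : ExteriorAlgebra R N) =
      ExteriorAlgebra.map f (w : ExteriorAlgebra R M) := by
  suffices h : (⋀[R]^m N).subtype ∘ₗ exteriorPower.map m f =
      (ExteriorAlgebra.map f).toLinearMap ∘ₗ (⋀[R]^m M).subtype from LinearMap.congr_fun h w
  refine exteriorPower.linearMap_ext ?_
  ext v
  simp [exteriorPower.map_apply_ιMulti, ExteriorAlgebra.map_apply_ιMulti]

end ExteriorBasis

end ElecOG

/-! ### The two commuting Clifford actions on `⋀ ℂ^{2n}` -/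

namespace ElecOG

variable {n : ℕ}

theorem bilinQ_apply (x y : Fin (n + n) → ℂ) :
    bilinQ n x y = ∑ i : Fin n, (1 / 2 : ℂ) * (-1) ^ (i : ℕ) *
      (x (Fin.castAdd n i) * y (Fin.natAdd n i) + x (Fin.natAdd n i) * y (Fin.castAdd n i)) := by
  simp only [bilinQ, LinearMap.sum_apply, LinearMap.smul_apply, LinearMap.add_apply,
    LinearMap.BilinForm.linMulLin_apply, LinearMap.proj_apply, smul_eq_mul]

theorem bilinQ_comm (x y : Fin (n + n) → ℂ) : bilinQ n x y = bilinQ n y x := by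
  rw [bilinQ_apply, bilinQ_apply]
  exact Finset.sum_congr rfl fun i _ => by ring

theorem bilinQ_self (x : Fin (n + n) → ℂ) : bilinQ n x x = quadQ n x := rfl

/-- The inclusion of `W = span (e_1, …, e_n)` in `ℂ^{2n}`. -/
def lowIncl (n : ℕ) : (Fin n → ℂ) →ₗ[ℂ] (Fin (n + n) → ℂ) where
  toFun w := Fin.append w 0
  map_add' w w' := by ext j; refine Fin.addCases (fun i => ?_) (fun i => ?_) j <;> simp [-Fin.natAdd_eq_addNat]
  map_smul' c w := by ext j; refine Fin.addCases (fun i => ?_) (fun i => ?_) j <;> simp [-Fin.natAdd_eq_addNat]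

/-- The inclusion of `span (e_{n+1}, …, e_{2n})` in `ℂ^{2n}`. -/
def highIncl (n : ℕ) : (Fin n → ℂ) →ₗ[ℂ] (Fin (n + n) → ℂ) where
  toFun w := Fin.append 0 w
  map_add' w w' := by ext j; refine Fin.addCases (fun i => ?_) (fun i => ?_) j <;> simp [-Fin.natAdd_eq_addNat]
  map_smul' c w := by ext j; refine Fin.addCases (fun i => ?_) (fun i => ?_) j <;> simp [-Fin.natAdd_eq_addNat]

/-- The coordinates of a vector at `e_{n+1}, …, e_{2n}`. -/
def highPartVec (x : Fin (n + n) → ℂ) : Fin n → ℂ := fun i => x (Fin.natAdd n i)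

@[simp] theorem lowIncl_castAdd (w : Fin n → ℂ) (i : Fin n) :
    lowIncl n w (Fin.castAdd n i) = w i := Fin.append_left _ _ _

@[simp] theorem lowIncl_natAdd (w : Fin n → ℂ) (i : Fin n) :
    lowIncl n w (Fin.natAdd n i) = 0 := Fin.append_right _ _ _

@[simp] theorem highIncl_castAdd (w : Fin n → ℂ) (i : Fin n) :
    highIncl n w (Fin.castAdd n i) = 0 := Fin.append_left _ _ _

@[simp] theorem highIncl_natAdd (w : Fin n → ℂ) (i : Fin n) :
    highIncl n w (Fin.natAdd n i) = w i := Fin.append_right _ _ _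

theorem lowIncl_add_highIncl (x : Fin (n + n) → ℂ) :
    lowIncl n (wPart n x) + highIncl n (highPartVec x) = x := by
  ext j
  refine Fin.addCases (fun i => ?_) (fun i => ?_) j <;>
    simp [wPart, highPartVec, LinearMap.funLeft_apply, -Fin.natAdd_eq_addNat]

theorem dualPart_apply (x : Fin (n + n) → ℂ) (w : Fin n → ℂ) :
    dualPart n x w = ∑ i : Fin n, (-1) ^ (i : ℕ) * x (Fin.natAdd n i) * w i := by
  simp [dualPart, LinearMap.sum_apply]

@[simp] theorem wPart_lowIncl (w : Fin n → ℂ) : wPart n (lowIncl n w) = w := by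
  ext i; simp [wPart, LinearMap.funLeft_apply]

@[simp] theorem wPart_highIncl (w : Fin n → ℂ) : wPart n (highIncl n w) = 0 := by
  ext i; simp [wPart, LinearMap.funLeft_apply]

@[simp] theorem dualPart_lowIncl (w : Fin n → ℂ) : dualPart n (lowIncl n w) = 0 := by
  ext i; simp [dualPart_apply, -Fin.natAdd_eq_addNat]

theorem dualPart_highIncl_highPartVec (x : Fin (n + n) → ℂ) :
    dualPart n (highIncl n (highPartVec x)) = dualPart n x := by
  ext i; simp [dualPart_apply, highPartVec, -Fin.natAdd_eq_addNat]

theorem bilinQ_lowIncl_lowIncl (w w' : Fin n → ℂ) : bilinQ n (lowIncl n w) (lowIncl n w') = 0 := by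
  simp [bilinQ_apply, -Fin.natAdd_eq_addNat]

theorem bilinQ_highIncl_lowIncl (u w : Fin n → ℂ) :
    2 * bilinQ n (highIncl n u) (lowIncl n w) = dualPart n (highIncl n u) w := by
  simp only [bilinQ_apply, dualPart_apply, Finset.mul_sum]
  refine Finset.sum_congr rfl fun i _ => ?_
  simp only [highIncl_castAdd, lowIncl_natAdd, highIncl_natAdd, lowIncl_castAdd]
  ring

theorem vecAct_eq (x : Fin (n + n) → ℂ) (s : SpinModule n) :
    vecAct n x s = ExteriorAlgebra.ι ℂ (wPart n x) * s + contr (dualPart n x) s := rfl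

/-- The operator `ω ↦ x ∧ ω + a Q(x, ·) ⌟ ω` on `⋀ ℂ^{2n}`.  For `a = 1` and `a = -1` these are two
anticommuting Clifford actions. -/
noncomputable def cliffOp (n : ℕ) (a : ℂ) :
    (Fin (n + n) → ℂ) →ₗ[ℂ] Module.End ℂ (ExteriorAlgebra ℂ (Fin (n + n) → ℂ)) :=
  (LinearMap.mul ℂ (ExteriorAlgebra ℂ (Fin (n + n) → ℂ))) ∘ₗ (ExteriorAlgebra.ι ℂ) +
    a • (CliffordAlgebra.contractLeft (Q := (0 : QuadraticForm ℂ (Fin (n + n) → ℂ)))) ∘ₗ bilinQ n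

theorem cliffOp_apply (a : ℂ) (x : Fin (n + n) → ℂ) (ω : ExteriorAlgebra ℂ (Fin (n + n) → ℂ)) :
    cliffOp n a x ω = ExteriorAlgebra.ι ℂ x * ω + a • contr (bilinQ n x) ω := rfl

theorem cliffOp_anticomm (a b : ℂ) (x y : Fin (n + n) → ℂ)
    (ω : ExteriorAlgebra ℂ (Fin (n + n) → ℂ)) :
    cliffOp n a x (cliffOp n b y ω) =
      ((a + b) * bilinQ n x y) • ω - cliffOp n b y (cliffOp n a x ω) := by
  simp only [cliffOp_apply, map_add, map_smul, contr_ι_mul, smul_sub, smul_add, add_smul,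
    add_mul, mul_smul]
  rw [ι_ι_mul_comm x y, contr_comm (bilinQ n x), bilinQ_comm y x, smul_neg, smul_neg,
    smul_comm a b (contr _ _)]
  abel

theorem cliffOp_sq (a : ℂ) (x : Fin (n + n) → ℂ) (ω : ExteriorAlgebra ℂ (Fin (n + n) → ℂ)) :
    cliffOp n a x (cliffOp n a x ω) = (a * quadQ n x) • ω := by
  simp only [cliffOp_apply, map_add, map_smul, contr_ι_mul, smul_sub, smul_add,
    mul_smul, ι_ι_mul, contr_contr, bilinQ_self, smul_zero]
  abel

theorem cliffOp_ι_mul (a : ℂ) (x y : Fin (n + n) → ℂ)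
    (ω : ExteriorAlgebra ℂ (Fin (n + n) → ℂ)) :
    cliffOp n a x (ExteriorAlgebra.ι ℂ y * ω) =
      (a * bilinQ n x y) • ω - ExteriorAlgebra.ι ℂ y * cliffOp n a x ω := by
  simp only [cliffOp_apply, mul_add, contr_ι_mul, smul_sub, mul_smul_comm, mul_smul]
  rw [ι_ι_mul_comm x y]
  abel

/-- The reflection in the hyperplane orthogonal to `x`. -/
noncomputable def reflectionQ (x : Fin (n + n) → ℂ) :
    (Fin (n + n) → ℂ) →ₗ[ℂ] (Fin (n + n) → ℂ) :=
  LinearMap.id - ((2 / quadQ n x) • bilinQ n x).smulRight x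

theorem reflectionQ_apply (x y : Fin (n + n) → ℂ) :
    reflectionQ x y = y - (2 / quadQ n x * bilinQ n x y) • x := rfl

/-- The product of the two Clifford actions of a vector is, up to its norm, the reflection. -/
theorem smul_map_reflectionQ {x : Fin (n + n) → ℂ} (hx : quadQ n x ≠ 0)
    (ω : ExteriorAlgebra ℂ (Fin (n + n) → ℂ)) :
    quadQ n x • ExteriorAlgebra.map (reflectionQ x) ω = cliffOp n 1 x (cliffOp n (-1) x ω) := by
  induction ω using exterior_left_induction with
  | one =>
    simp [cliffOp_apply, contr_one, contr_ι, bilinQ_self, Algebra.algebraMap_eq_smul_one]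
  | smul r ω h => simp only [map_smul, ← h, smul_comm r]
  | add ω ω' h h' => simp only [map_add, smul_add, h, h']
  | ι_mul ω y h =>
    have h1 : ExteriorAlgebra.ι ℂ x * cliffOp n 1 x (cliffOp n (-1) x ω) =
        quadQ n x • (ExteriorAlgebra.ι ℂ x * ω) := by
      simp [cliffOp_apply, mul_add, contr_ι_mul, mul_sub, ι_ι_mul, bilinQ_self, contr_contr]
    have h2 : cliffOp n 1 x ω + cliffOp n (-1) x ω = (2 : ℂ) • (ExteriorAlgebra.ι ℂ x * ω) := by
      rw [cliffOp_apply, cliffOp_apply, two_smul, one_smul, neg_one_smul]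
      abel
    rw [map_mul, ExteriorAlgebra.map_apply_ι, ← mul_smul_comm, h, reflectionQ_apply, map_sub,
      map_smul, sub_mul, smul_mul_assoc, h1, cliffOp_ι_mul, map_sub, map_smul, cliffOp_ι_mul,
      smul_smul]
    have h3 : 2 / quadQ n x * bilinQ n x y * quadQ n x = bilinQ n x y * 2 := by
      field_simp
    rw [h3, mul_smul, ← h2, neg_one_mul, neg_smul, one_mul, smul_add]
    abel

/-- The action of `⋀ W` on `⋀ ℂ^{2n}` extending `cliffOp n a` on `W`. -/
noncomputable def liftOp (n : ℕ) (a : ℂ) :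
    SpinModule n →ₐ[ℂ] Module.End ℂ (ExteriorAlgebra ℂ (Fin (n + n) → ℂ)) :=
  ExteriorAlgebra.lift ℂ ⟨cliffOp n a ∘ₗ lowIncl n, fun w => by
    refine LinearMap.ext fun ω => ?_
    change cliffOp n a (lowIncl n w) (cliffOp n a (lowIncl n w) ω) = 0
    rw [cliffOp_sq, ← bilinQ_self, bilinQ_lowIncl_lowIncl, mul_zero, zero_smul]⟩

theorem liftOp_ι_mul (a : ℂ) (w : Fin n → ℂ) (s : SpinModule n)
    (ω : ExteriorAlgebra ℂ (Fin (n + n) → ℂ)) :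
    liftOp n a (ExteriorAlgebra.ι ℂ w * s) ω = cliffOp n a (lowIncl n w) (liftOp n a s ω) := by
  rw [map_mul, Module.End.mul_apply, liftOp, ExteriorAlgebra.lift_ι_apply]
  rfl

theorem cliffOp_liftOp_neg (a : ℂ) (x : Fin (n + n) → ℂ) (s : SpinModule n)
    (ω : ExteriorAlgebra ℂ (Fin (n + n) → ℂ)) :
    cliffOp n (-a) x (liftOp n a s ω) = liftOp n a (parity s) (cliffOp n (-a) x ω) := by
  induction s using exterior_left_induction with
  | one => simp
  | smul r s h => simp only [map_smul, LinearMap.smul_apply, h]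
  | add s s' h h' => simp only [map_add, LinearMap.add_apply, h, h']
  | ι_mul s w h =>
    rw [liftOp_ι_mul, cliffOp_anticomm, neg_add_cancel, zero_mul, zero_smul, h, map_mul, parity_ι,
      neg_mul, map_neg, LinearMap.neg_apply, liftOp_ι_mul, zero_sub]

theorem cliffOp_highIncl_liftOp (a : ℂ) (u : Fin n → ℂ) (s : SpinModule n)
    (ω : ExteriorAlgebra ℂ (Fin (n + n) → ℂ)) :
    cliffOp n a (highIncl n u) (liftOp n a s ω) =
      a • liftOp n a (contr (dualPart n (highIncl n u)) s) ω +
        liftOp n a (parity s) (cliffOp n a (highIncl n u) ω) := by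
  induction s using exterior_left_induction with
  | one => simp [contr_one]
  | smul r s h => simp only [map_smul, LinearMap.smul_apply, h, smul_add, smul_comm r]
  | add s s' h h' =>
    simp only [map_add, LinearMap.add_apply, h, h', smul_add]
    abel
  | ι_mul s w h =>
    rw [liftOp_ι_mul, cliffOp_anticomm, h, map_add, map_smul, ← liftOp_ι_mul, ← liftOp_ι_mul,
      contr_ι_mul, map_sub, map_smul, LinearMap.sub_apply, LinearMap.smul_apply,
      map_mul (parity (R := ℂ) (M := Fin n → ℂ)), parity_ι, neg_mul, map_neg, LinearMap.neg_apply, ← bilinQ_highIncl_lowIncl, smul_sub, smul_smul]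
    rw [show (a + a) * bilinQ n (highIncl n u) (lowIncl n w) =
      a * (2 * bilinQ n (highIncl n u) (lowIncl n w)) by ring]
    abel

/-- The basis `(e_I)` of `⋀ ℂ^{2n}`. -/
noncomputable abbrev extBasis (n : ℕ) :
    Module.Basis (Finset (Fin (n + n))) ℂ (ExteriorAlgebra ℂ (Fin (n + n) → ℂ)) :=
  (Pi.basisFun ℂ (Fin (n + n))).ExteriorAlgebra

/-- The index set `{n+1, …, 2n}`. -/
def highIndex (n : ℕ) : Finset (Fin (n + n)) := Finset.univ.map (Fin.natAddEmb n)

theorem castAdd_ne_natAdd (i j : Fin n) : Fin.castAdd n i ≠ Fin.natAdd n j := by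
  intro h
  have := congrArg Fin.val h
  simp at this
  omega

theorem natAdd_mem_highIndex (i : Fin n) : Fin.natAdd n i ∈ highIndex n :=
  Finset.mem_map.mpr ⟨i, Finset.mem_univ _, rfl⟩

theorem castAdd_notMem_highIndex (i : Fin n) : Fin.castAdd n i ∉ highIndex n := by
  intro h
  obtain ⟨j, -, hj⟩ := Finset.mem_map.mp h
  exact castAdd_ne_natAdd i j hj.symm

theorem bilinQ_stdVec_castAdd (i : Fin n) :
    bilinQ n (stdVec n (Fin.castAdd n i)) =
      ((1 / 2 : ℂ) * (-1) ^ (i : ℕ)) • (Pi.basisFun ℂ (Fin (n + n))).coord (Fin.natAdd n i) := by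
  refine LinearMap.ext fun y => ?_
  rw [bilinQ_apply, Finset.sum_eq_single i]
  · simp [stdVec, Ne.symm (castAdd_ne_natAdd _ _),
      -Fin.natAdd_eq_addNat]
  · intro k _ hk
    simp [stdVec, hk, Ne.symm (castAdd_ne_natAdd _ _),
      -Fin.natAdd_eq_addNat]
  · simp

theorem bilinQ_stdVec_natAdd (i : Fin n) :
    bilinQ n (stdVec n (Fin.natAdd n i)) =
      ((1 / 2 : ℂ) * (-1) ^ (i : ℕ)) • (Pi.basisFun ℂ (Fin (n + n))).coord (Fin.castAdd n i) := by
  refine LinearMap.ext fun y => ?_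
  rw [bilinQ_apply, Finset.sum_eq_single i]
  · simp [stdVec, castAdd_ne_natAdd, -Fin.natAdd_eq_addNat]
  · intro k _ hk
    simp [stdVec, hk, castAdd_ne_natAdd, -Fin.natAdd_eq_addNat]
  · simp

theorem highIncl_eq_sum (u : Fin n → ℂ) :
    highIncl n u = ∑ i, u i • stdVec n (Fin.natAdd n i) := by
  ext j
  refine Fin.addCases (fun k => ?_) (fun k => ?_) j
  · simp [stdVec, castAdd_ne_natAdd, -Fin.natAdd_eq_addNat]
  · simp [stdVec, Pi.single_apply, -Fin.natAdd_eq_addNat]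

theorem ι_stdVec (j : Fin (n + n)) :
    ExteriorAlgebra.ι ℂ (stdVec n j) = ExteriorAlgebra.ι ℂ (Pi.basisFun ℂ (Fin (n + n)) j) := by
  rw [Pi.basisFun_apply, stdVec]

/-- The vector `e_{n+1} ∧ ⋯ ∧ e_{2n}` is killed by `span (e_{n+1}, …, e_{2n})` under both Clifford
actions. -/
theorem cliffOp_highIncl_top (a : ℂ) (u : Fin n → ℂ) :
    cliffOp n a (highIncl n u) (extBasis n (highIndex n)) = 0 := by
  rw [highIncl_eq_sum, map_sum, LinearMap.sum_apply]
  refine Finset.sum_eq_zero fun i _ => ?_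
  rw [map_smul, LinearMap.smul_apply, cliffOp_apply, bilinQ_stdVec_natAdd, contr_smul, ι_stdVec,
    ι_mul_basisExterior_mem _ (natAdd_mem_highIndex i), LinearMap.smul_apply,
    contr_basisExterior_notMem _ (castAdd_notMem_highIndex i)]
  simp

/-- The bilinear map `S × S → ⋀ ℂ^{2n}` intertwining the Clifford actions on the two copies of `S`
with `cliffOp n 1` and `cliffOp n (-1)`; it sends `(1, 1)` to `e_{n+1} ∧ ⋯ ∧ e_{2n}`. -/
noncomputable def spinorProd (s t : SpinModule n) : ExteriorAlgebra ℂ (Fin (n + n) → ℂ) :=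
  liftOp n 1 s (liftOp n (-1) (revert t) (extBasis n (highIndex n)))

theorem cliffOp_one_spinorProd (x : Fin (n + n) → ℂ) (s t : SpinModule n) :
    cliffOp n 1 x (spinorProd s t) = spinorProd (vecAct n x s) t := by
  have h1 : cliffOp n 1 (highIncl n (highPartVec x))
      (liftOp n (-1) (revert t) (extBasis n (highIndex n))) = 0 := by
    have := cliffOp_liftOp_neg (-1) (highIncl n (highPartVec x)) (revert t)
      (extBasis n (highIndex n))
    rw [neg_neg] at this
    rw [this, cliffOp_highIncl_top, map_zero]
  conv_lhs => rw [← lowIncl_add_highIncl x]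
  rw [map_add, LinearMap.add_apply, spinorProd, cliffOp_highIncl_liftOp, h1, map_zero, add_zero,
    one_smul, dualPart_highIncl_highPartVec, ← liftOp_ι_mul, ← LinearMap.add_apply, ← map_add,
    ← vecAct_eq]
  rfl

theorem cliffOp_neg_one_spinorProd (x : Fin (n + n) → ℂ) (s t : SpinModule n) :
    cliffOp n (-1) x (spinorProd s t) = spinorProd (parity s) (vecAct n x (parity t)) := by
  have h1 : cliffOp n (-1) x (liftOp n (-1) (revert t) (extBasis n (highIndex n))) =
      liftOp n (-1) (revert (vecAct n x (parity t))) (extBasis n (highIndex n)) := by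
    conv_lhs => rw [← lowIncl_add_highIncl x]
    rw [map_add, LinearMap.add_apply, cliffOp_highIncl_liftOp, cliffOp_highIncl_top, map_zero,
      add_zero, dualPart_highIncl_highPartVec, ← liftOp_ι_mul, vecAct_eq, map_add, map_add,
      LinearMap.add_apply, revert_ι_mul_parity, revert_contr_parity, map_neg, LinearMap.neg_apply,
      neg_smul, one_smul]
  rw [spinorProd, cliffOp_liftOp_neg, h1]
  rfl

theorem parity_vecAct (x : Fin (n + n) → ℂ) (s : SpinModule n) :
    parity (vecAct n x s) = -vecAct n x (parity s) := by
  rw [vecAct_eq, map_add, map_mul, parity_ι, parity_contr, vecAct_eq]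
  simp [add_comm]

theorem smul_map_reflectionQ_spinorProd {x : Fin (n + n) → ℂ} (hx : quadQ n x ≠ 0)
    (s t : SpinModule n) :
    quadQ n x • ExteriorAlgebra.map (reflectionQ x) (spinorProd s t) =
      spinorProd (vecAct n x (parity s)) (vecAct n x (parity t)) := by
  rw [smul_map_reflectionQ hx, cliffOp_neg_one_spinorProd, cliffOp_one_spinorProd]

end ElecOG

/-! ### Coordinates of the spinor product -/

namespace ElecOG

variable {n : ℕ}

/-- The basis `(e_I)` of `S = ⋀ W`. -/
noncomputable abbrev spinBasis (n : ℕ) :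
    Module.Basis (Finset (Fin n)) ℂ (SpinModule n) :=
  (Pi.basisFun ℂ (Fin n)).ExteriorAlgebra

/-- The subset `A ∪ {n + b : b ∈ B}` of `[2n]`. -/
def pairIndex (A B : Finset (Fin n)) : Finset (Fin (n + n)) :=
  A.map (Fin.castAddEmb n) ∪ B.map (Fin.natAddEmb n)

@[simp] theorem castAdd_mem_pairIndex {A B : Finset (Fin n)} {k : Fin n} :
    Fin.castAdd n k ∈ pairIndex A B ↔ k ∈ A := by
  simp only [pairIndex, Finset.mem_union, Finset.mem_map, Fin.castAddEmb_apply,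
    Fin.natAddEmb_apply]
  constructor
  · rintro (⟨j, hj, h⟩ | ⟨j, -, h⟩)
    · rwa [← Fin.castAdd_injective n n h]
    · exact absurd h.symm (castAdd_ne_natAdd k j)
  · exact fun h => Or.inl ⟨k, h, rfl⟩

@[simp] theorem natAdd_mem_pairIndex {A B : Finset (Fin n)} {k : Fin n} :
    Fin.natAdd n k ∈ pairIndex A B ↔ k ∈ B := by
  simp only [pairIndex, Finset.mem_union, Finset.mem_map, Fin.castAddEmb_apply,
    Fin.natAddEmb_apply]
  constructor
  · rintro (⟨j, -, h⟩ | ⟨j, hj, h⟩)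
    · exact absurd h (castAdd_ne_natAdd j k)
    · rwa [← Fin.natAdd_injective n n h]
  · exact fun h => Or.inr ⟨k, h, rfl⟩

theorem pairIndex_lowPart_highPart (I : Finset (Fin (n + n))) :
    pairIndex (lowPart I) (highPart I) = I := by
  ext j
  refine Fin.addCases (fun k => ?_) (fun k => ?_) j
  · rw [castAdd_mem_pairIndex]; simp [lowPart]
  · rw [natAdd_mem_pairIndex]; simp only [highPart, Finset.mem_filter, Finset.mem_univ, true_and]

theorem pairIndex_insert_left (k : Fin n) (A B : Finset (Fin n)) :
    pairIndex (insert k A) B = insert (Fin.castAdd n k) (pairIndex A B) := by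
  simp [pairIndex, Finset.map_insert]

theorem pairIndex_insert_right (k : Fin n) (A B : Finset (Fin n)) :
    pairIndex A (insert k B) = insert (Fin.natAdd n k) (pairIndex A B) := by
  simp [pairIndex, Finset.map_insert, Finset.union_insert]

theorem disjoint_map_castAdd_map_natAdd (A B : Finset (Fin n)) :
    Disjoint (A.map (Fin.castAddEmb n)) (B.map (Fin.natAddEmb n)) := by
  rw [Finset.disjoint_left]
  simp only [Finset.mem_map, Fin.castAddEmb_apply, Fin.natAddEmb_apply]
  rintro _ ⟨a, -, rfl⟩ ⟨b, -, h⟩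
  exact castAdd_ne_natAdd a b h.symm

theorem card_pairIndex (A B : Finset (Fin n)) : (pairIndex A B).card = A.card + B.card := by
  rw [pairIndex, Finset.card_union_of_disjoint (disjoint_map_castAdd_map_natAdd A B),
    Finset.card_map, Finset.card_map]

theorem card_lowPart_add_card_highPart (I : Finset (Fin (n + n))) :
    (lowPart I).card + (highPart I).card = I.card := by
  rw [← card_pairIndex, pairIndex_lowPart_highPart]

theorem card_filter_lt_castAdd (A B : Finset (Fin n)) (k : Fin n) :
    ((pairIndex A B).filter (· < Fin.castAdd n k)).card = (A.filter (· < k)).card := by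
  have h : (pairIndex A B).filter (· < Fin.castAdd n k) = pairIndex (A.filter (· < k)) ∅ := by
    ext j
    refine Fin.addCases (fun i => ?_) (fun i => ?_) j
    · simp only [Finset.mem_filter, castAdd_mem_pairIndex, Fin.lt_def, Fin.val_castAdd]
    · simp only [Finset.mem_filter, natAdd_mem_pairIndex, Finset.notMem_empty, iff_false,
        Fin.lt_def, Fin.val_natAdd, Fin.val_castAdd]
      omega
  rw [h, card_pairIndex, Finset.card_empty, add_zero]

theorem card_filter_lt_natAdd (A B : Finset (Fin n)) (k : Fin n) :
    ((pairIndex A B).filter (· < Fin.natAdd n k)).card = A.card + (B.filter (· < k)).card := by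
  have h : (pairIndex A B).filter (· < Fin.natAdd n k) = pairIndex A (B.filter (· < k)) := by
    ext j
    refine Fin.addCases (fun i => ?_) (fun i => ?_) j
    · simp only [Finset.mem_filter, castAdd_mem_pairIndex, and_iff_left_iff_imp, Fin.lt_def,
        Fin.val_natAdd, Fin.val_castAdd]
      omega
    · simp only [Finset.mem_filter, natAdd_mem_pairIndex, Fin.lt_def, Fin.val_natAdd]
      simp
  rw [h, card_pairIndex]

theorem quadQ_stdVec_castAdd (k : Fin n) : quadQ n (stdVec n (Fin.castAdd n k)) = 0 := by
  rw [← bilinQ_self, bilinQ_stdVec_castAdd]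
  simp [stdVec, Ne.symm (castAdd_ne_natAdd _ _), -Fin.natAdd_eq_addNat]

theorem lowIncl_single (k : Fin n) :
    lowIncl n (Pi.basisFun ℂ (Fin n) k) = stdVec n (Fin.castAdd n k) := by
  ext j
  refine Fin.addCases (fun i => ?_) (fun i => ?_) j
  · simp [stdVec, Pi.single_apply]
  · simp [stdVec, Ne.symm (castAdd_ne_natAdd _ _), -Fin.natAdd_eq_addNat]

theorem vecAct_stdVec_castAdd (k : Fin n) (s : SpinModule n) :
    vecAct n (stdVec n (Fin.castAdd n k)) s =
      ExteriorAlgebra.ι ℂ (Pi.basisFun ℂ (Fin n) k) * s := by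
  rw [← lowIncl_single, vecAct_eq, dualPart_lowIncl, contr_zero, wPart_lowIncl]
  simp

theorem vecAct_stdVec_natAdd (k : Fin n) (s : SpinModule n) :
    vecAct n (stdVec n (Fin.natAdd n k)) s =
      (-1 : ℂ) ^ (k : ℕ) • contr ((Pi.basisFun ℂ (Fin n)).coord k) s := by
  have h1 : wPart n (stdVec n (Fin.natAdd n k)) = 0 := by
    ext i
    simp [wPart, LinearMap.funLeft_apply, stdVec, castAdd_ne_natAdd, -Fin.natAdd_eq_addNat]
  have h2 : dualPart n (stdVec n (Fin.natAdd n k)) =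
      (-1 : ℂ) ^ (k : ℕ) • (Pi.basisFun ℂ (Fin n)).coord k := by
    refine LinearMap.ext fun w => ?_
    rw [dualPart_apply, Finset.sum_eq_single k]
    · simp [stdVec]
    · intro i _ hi
      simp [stdVec, hi, -Fin.natAdd_eq_addNat]
    · simp
  rw [vecAct_eq, h1, h2, contr_smul]
  simp

/-- The coordinate at `I` vanishes on the image of `x` under both Clifford actions.  This holds for
`x = e_k` if `I` contains `n + k` but not `k`, and for `x = e_{n+k}` if it contains `k` but not
`n + k`. -/
def Kills (x : Fin (n + n) → ℂ) (I : Finset (Fin (n + n))) : Prop :=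
  ∀ a ω, (extBasis n).coord I (cliffOp n a x ω) = 0

theorem kills_stdVec_natAdd {k : Fin n} {I : Finset (Fin (n + n))} (h : Fin.castAdd n k ∈ I)
    (h' : Fin.natAdd n k ∉ I) : Kills (stdVec n (Fin.natAdd n k)) I := by
  intro a ω
  rw [cliffOp_apply, bilinQ_stdVec_natAdd, contr_smul, ι_stdVec, map_add, coord_ι_mul_eq_zero _ h',
    map_smul, LinearMap.smul_apply, map_smul, coord_contr_eq_zero _ h]
  simp

theorem kills_stdVec_castAdd {k : Fin n} {I : Finset (Fin (n + n))} (h : Fin.castAdd n k ∉ I)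
    (h' : Fin.natAdd n k ∈ I) : Kills (stdVec n (Fin.castAdd n k)) I := by
  intro a ω
  rw [cliffOp_apply, bilinQ_stdVec_castAdd, contr_smul, ι_stdVec, map_add, coord_ι_mul_eq_zero _ h,
    map_smul, LinearMap.smul_apply, map_smul, coord_contr_eq_zero _ h']
  simp

theorem Kills.left {x : Fin (n + n) → ℂ} {I : Finset (Fin (n + n))} (h : Kills x I)
    (s t : SpinModule n) : (extBasis n).coord I (spinorProd (vecAct n x s) t) = 0 := by
  rw [← cliffOp_one_spinorProd]
  exact h _ _

theorem Kills.right {x : Fin (n + n) → ℂ} {I : Finset (Fin (n + n))} (h : Kills x I)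
    (s t : SpinModule n) : (extBasis n).coord I (spinorProd s (vecAct n x t)) = 0 := by
  rw [← parity_parity s, ← parity_parity t, ← cliffOp_neg_one_spinorProd]
  exact h _ _

theorem basis_mem_range_vecAct_natAdd {k : Fin n} {A : Finset (Fin n)} (hk : k ∉ A) :
    ∃ s, spinBasis n A = vecAct n (stdVec n (Fin.natAdd n k)) s := by
  refine ⟨(-1 : ℂ) ^ (k : ℕ) • (ExteriorAlgebra.ι ℂ (Pi.basisFun ℂ (Fin n) k) * spinBasis n A), ?_⟩
  rw [vecAct_stdVec_natAdd, map_smul, smul_smul, ← mul_pow, contr_ι_mul,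
    contr_basisExterior_notMem _ hk]
  simp

theorem basis_mem_range_vecAct_castAdd {k : Fin n} {A : Finset (Fin n)} (hk : k ∈ A) :
    ∃ s, spinBasis n A = vecAct n (stdVec n (Fin.castAdd n k)) s := by
  refine ⟨(-1 : ℂ) ^ ((A.erase k).filter (· < k)).card • spinBasis n (A.erase k), ?_⟩
  rw [vecAct_stdVec_castAdd, mul_smul_comm, ι_mul_basisExterior _ (Finset.notMem_erase k A),
    smul_smul, ← mul_pow, Finset.insert_erase hk]
  simp

/-- The index sets `I` with `#(J ∩ J^∨) = 1` are `J ∪ {n + j : j ∉ K}` with `J = K ∪ {i}`. -/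
def crossIndex (K : Finset (Fin n)) (i : Fin n) : Finset (Fin (n + n)) :=
  pairIndex (insert i K) (Finset.univ \ K)

/-- A basis vector `e_A` of `S` other than `e_K` and `e_{K ∪ {i}}` is in the image of a vector that kills
the coordinate at `K ∪ {i} ∪ {n + j : j ∉ K}`. -/
theorem exists_kills {K : Finset (Fin n)} {i : Fin n} {A : Finset (Fin n)} (h1 : A ≠ K)
    (h2 : A ≠ insert i K) :
    ∃ x s, Kills x (crossIndex K i) ∧ spinBasis n A = vecAct n x s := by
  by_cases hKA : K ⊆ A
  · obtain ⟨k, hk, hk'⟩ : ∃ k ∈ A, k ∉ insert i K := by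
      by_contra! hc
      by_cases hi : i ∈ A
      · exact h2 (Finset.Subset.antisymm hc (Finset.insert_subset hi hKA))
      · refine h1 (Finset.Subset.antisymm (fun j hj => ?_) hKA)
        rcases Finset.mem_insert.mp (hc j hj) with rfl | h
        exacts [absurd hj hi, h]
    obtain ⟨s, hs⟩ := basis_mem_range_vecAct_castAdd hk
    refine ⟨_, s, kills_stdVec_castAdd ?_ ?_, hs⟩
    · rwa [crossIndex, castAdd_mem_pairIndex]
    · rw [crossIndex, natAdd_mem_pairIndex]
      simp only [Finset.mem_sdiff, Finset.mem_univ, true_and]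
      exact fun h => hk' (Finset.mem_insert_of_mem h)
  · obtain ⟨k, hk, hk'⟩ := Finset.not_subset.mp hKA
    obtain ⟨s, hs⟩ := basis_mem_range_vecAct_natAdd hk'
    refine ⟨_, s, kills_stdVec_natAdd ?_ ?_, hs⟩
    · rw [crossIndex, castAdd_mem_pairIndex]
      exact Finset.mem_insert_of_mem hk
    · rw [crossIndex, natAdd_mem_pairIndex]
      simpa using hk

theorem cliffOp_cliffOp_neg_stdVec (a : ℂ) (k : Fin n)
    (ω : ExteriorAlgebra ℂ (Fin (n + n) → ℂ)) :
    cliffOp n a (stdVec n (Fin.castAdd n k)) (cliffOp n (-a) (stdVec n (Fin.castAdd n k)) ω) =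
      (-(a * (-1) ^ (k : ℕ))) • (ExteriorAlgebra.ι ℂ (Pi.basisFun ℂ (Fin (n + n)) (Fin.castAdd n k)) *
        contr ((Pi.basisFun ℂ (Fin (n + n))).coord (Fin.natAdd n k)) ω) := by
  have h := quadQ_stdVec_castAdd k
  simp only [cliffOp_apply, map_add, map_smul, contr_ι_mul, ι_ι_mul, contr_contr,
    bilinQ_self, h]
  rw [bilinQ_stdVec_castAdd, contr_smul, ι_stdVec, LinearMap.smul_apply, mul_smul_comm]
  simp only [smul_smul, zero_smul, zero_sub, smul_zero, zero_add, add_zero, ← neg_smul,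
    ← add_smul]
  congr 1
  ring

/-- The coordinate of the spinor product of `e_{K ∪ {i}}` and `e_K`, by induction on the largest element
`k` of `K`: the two Clifford actions of `e_k` together replace `e_{n+k}` by `e_k`. -/
theorem coord_liftOp_crossIndex (a : ℂ) (K : Finset (Fin n)) :
    ∀ i ∉ K, (extBasis n).coord (crossIndex K i)
      (liftOp n a (spinBasis n (insert i K)) (liftOp n (-a) (spinBasis n K)
        (extBasis n (highIndex n)))) = (-a) ^ K.card := by
  have hu : highIndex n = pairIndex ∅ Finset.univ := by simp [highIndex, pairIndex]
  induction K using Finset.induction_on_max with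
  | empty =>
    intro i _
    have h1 : spinBasis n (insert i ∅) = ExteriorAlgebra.ι ℂ (Pi.basisFun ℂ (Fin n) i) * 1 := by
      rw [spinBasis, basisExterior_insert_lt _ (by simp), basisExterior_empty]
    have h2 : crossIndex ∅ i = insert (Fin.castAdd n i) (highIndex n) := by
      rw [crossIndex, pairIndex_insert_left, Finset.sdiff_empty, hu]
    rw [h1, liftOp_ι_mul, basisExterior_empty, map_one, map_one, Module.End.one_apply,
      Module.End.one_apply, lowIncl_single, cliffOp_apply, bilinQ_stdVec_castAdd, contr_smul,
      ι_stdVec, ι_mul_basisExterior _ (castAdd_notMem_highIndex i), hu, card_filter_lt_castAdd,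
      ← hu, map_add, LinearMap.smul_apply, map_smul, map_smul, map_smul, coord_contr_eq_zero, h2]
    · simp
    · rw [h2]
      exact Finset.mem_insert_of_mem (natAdd_mem_highIndex i)
  | insert k K hk ih =>
    intro i hi
    have hkK : k ∉ K := fun h => (hk k h).false
    simp only [Finset.mem_insert, not_or] at hi
    have hkJ : k ∉ insert i K := by simp [hkK, Ne.symm hi.1]
    have hf : K.filter (· < k) = K := Finset.filter_true_of_mem hk
    set d := ((insert i K).filter (· < k)).card with hd
    have h1 : spinBasis n (insert k K) =
        (-1 : ℂ) ^ K.card • (ExteriorAlgebra.ι ℂ (Pi.basisFun ℂ (Fin n) k) * spinBasis n K) := by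
      rw [ι_mul_basisExterior _ hkK, hf, smul_smul, ← mul_pow]
      simp
    have h2 : spinBasis n (insert i (insert k K)) = (-1 : ℂ) ^ d •
        (ExteriorAlgebra.ι ℂ (Pi.basisFun ℂ (Fin n) k) * spinBasis n (insert i K)) := by
      rw [ι_mul_basisExterior _ hkJ, smul_smul, ← mul_pow, Finset.insert_comm]
      simp
    have h3 : ∀ ω, liftOp n a (spinBasis n (insert i K))
        (cliffOp n (-a) (stdVec n (Fin.castAdd n k)) ω) = (-1 : ℂ) ^ (K.card + 1) •
        cliffOp n (-a) (stdVec n (Fin.castAdd n k)) (liftOp n a (spinBasis n (insert i K)) ω) := by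
      intro ω
      rw [cliffOp_liftOp_neg, parity_basisExterior, map_smul, LinearMap.smul_apply, smul_smul,
        Finset.card_insert_of_notMem hi.2, ← mul_pow]
      simp
    have h4 : crossIndex (insert k K) i = insert (Fin.castAdd n k)
        (pairIndex (insert i K) (Finset.univ \ insert k K)) := by
      rw [crossIndex, Finset.insert_comm, pairIndex_insert_left]
    have h5 : insert (Fin.natAdd n k) (pairIndex (insert i K) (Finset.univ \ insert k K)) =
        crossIndex K i := by
      rw [crossIndex, ← pairIndex_insert_right]
      congr 1
      ext j
      by_cases hj : j = k <;> simp [hj, hkK]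
    have h6 : ((Finset.univ \ insert k K).filter (· < k)).card + K.card = k := by
      have : (Finset.univ \ insert k K).filter (· < k) = Finset.Iio k \ K := by
        ext j
        simp only [Finset.mem_filter, Finset.mem_sdiff, Finset.mem_univ, true_and,
          Finset.mem_insert, not_or, Finset.mem_Iio]
        exact ⟨fun h => ⟨h.2, h.1.2⟩, fun h => ⟨⟨h.1.ne, h.2⟩, h.1⟩⟩
      rw [this, Finset.card_sdiff_add_card_eq_card (fun j hj => Finset.mem_Iio.mpr (hk j hj)),
        Fin.card_Iio]
    rw [h1, h2, map_smul, map_smul, LinearMap.smul_apply, LinearMap.smul_apply, liftOp_ι_mul,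
      liftOp_ι_mul, lowIncl_single, map_smul, map_smul, h3, map_smul, map_smul, map_smul,
      cliffOp_cliffOp_neg_stdVec, h4]
    simp only [map_smul]
    rw [coord_ι_mul_contr, card_filter_lt_castAdd, card_filter_lt_natAdd, h5, ih i hi.2, ← hd,
      Finset.card_insert_of_notMem hi.2, Finset.card_insert_of_notMem hkK]
    · set c := ((Finset.univ \ insert k K).filter (· < k)).card
      have e : ∀ m : ℕ, ((-1 : ℂ) ^ m) * (-1) ^ m = 1 := fun m => by rw [← mul_pow]; simp
      rw [← h6]
      calc _ = ((-1 : ℂ) ^ d * (-1) ^ d) * ((-1) ^ K.card * (-1) ^ K.card) *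
            ((-1) ^ K.card * (-1) ^ K.card) * ((-1) ^ c * (-1) ^ c) * ((-a) ^ K.card * (-a)) := by
            simp only [smul_eq_mul]; ring
        _ = _ := by simp only [e, one_mul, pow_succ]
    · rwa [castAdd_mem_pairIndex]
    · rw [natAdd_mem_pairIndex]
      simp

theorem liftOp_basis_comm (a : ℂ) (A B : Finset (Fin n))
    (ω : ExteriorAlgebra ℂ (Fin (n + n) → ℂ)) :
    liftOp n (-a) (spinBasis n B) (liftOp n a (spinBasis n A) ω) =
      (-1 : ℂ) ^ (A.card * B.card) •
        liftOp n a (spinBasis n A) (liftOp n (-a) (spinBasis n B) ω) := by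
  induction B using Finset.induction_on_min with
  | empty => simp [basisExterior_empty]
  | insert b B hb ih =>
    have hbB : b ∉ B := fun h => (hb b h).false
    rw [spinBasis, basisExterior_insert_lt _ hb, liftOp_ι_mul, liftOp_ι_mul, ih, map_smul,
      cliffOp_liftOp_neg, parity_basisExterior, map_smul, LinearMap.smul_apply, smul_smul,
      ← pow_add, Finset.card_insert_of_notMem hbB, mul_add, mul_one]

theorem coord_parity (s : SpinModule n) (A : Finset (Fin n)) :
    (spinBasis n).coord A (parity s) = (-1) ^ A.card * (spinBasis n).coord A s := by
  suffices h : (spinBasis n).coord A ∘ₗ parity.toLinearMap =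
      ((-1 : ℂ) ^ A.card) • (spinBasis n).coord A from LinearMap.congr_fun h s
  refine (spinBasis n).ext fun B => ?_
  rw [LinearMap.comp_apply, AlgHom.toLinearMap_apply, parity_basisExterior, map_smul]
  by_cases h : B = A
  · simp [h]
  · simp [h]

theorem spinorProd_eq_zero_of_notMem {K : Finset (Fin n)} {i : Fin n} {A : Finset (Fin n)}
    (h1 : A ≠ K) (h2 : A ≠ insert i K) (t : SpinModule n) :
    (extBasis n).coord (crossIndex K i) (spinorProd (spinBasis n A) t) = 0 ∧
      (extBasis n).coord (crossIndex K i) (spinorProd t (spinBasis n A)) = 0 := by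
  obtain ⟨x, s, hx, hs⟩ := exists_kills h1 h2
  rw [hs]
  exact ⟨hx.left s t, hx.right t s⟩

theorem linearMap_apply_eq_single (f : SpinModule n →ₗ[ℂ] ℂ) (s : SpinModule n)
    (A : Finset (Fin n)) (h : ∀ B ≠ A, (spinBasis n).coord B s = 0 ∨ f (spinBasis n B) = 0) :
    f s = (spinBasis n).coord A s * f (spinBasis n A) := by
  conv_lhs => rw [← (spinBasis n).sum_repr s]
  rw [map_sum, Finset.sum_eq_single A]
  · simp
  · intro B _ hB
    rcases h B hB with h | h
    · rw [Module.Basis.coord_apply] at h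
      rw [h, zero_smul, map_zero]
    · rw [map_smul, h, smul_zero]
  · simp

/-- `spinorProd` as a linear map of its first argument. -/
noncomputable def spinorProdLeft (t : SpinModule n) :
    SpinModule n →ₗ[ℂ] ExteriorAlgebra ℂ (Fin (n + n) → ℂ) where
  toFun s := spinorProd s t
  map_add' s s' := by simp [spinorProd]
  map_smul' c s := by simp [spinorProd]

/-- `spinorProd` as a linear map of its second argument. -/
noncomputable def spinorProdRight (s : SpinModule n) :
    SpinModule n →ₗ[ℂ] ExteriorAlgebra ℂ (Fin (n + n) → ℂ) where
  toFun t := spinorProd s t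
  map_add' s s' := by simp [spinorProd]
  map_smul' c s := by simp [spinorProd]

theorem coord_spinorProd_basis_even {K : Finset (Fin n)} {i : Fin n} (hi : i ∉ K)
    (hK : Even K.card) :
    (extBasis n).coord (crossIndex K i) (spinorProd (spinBasis n K) (spinBasis n (insert i K))) =
      (-1) ^ ((K.card + 1).choose 2) := by
  have h := coord_liftOp_crossIndex (-1) K i hi
  rw [neg_neg, one_pow] at h
  have h1 := liftOp_basis_comm 1 K (insert i K) (extBasis n (highIndex n))
  rw [Finset.card_insert_of_notMem hi, Even.neg_one_pow (hK.mul_right _), one_smul] at h1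
  rw [spinorProd, revert_basisExterior, map_smul, LinearMap.smul_apply, map_smul, ← h1, map_smul, h,
    Finset.card_insert_of_notMem hi]
  simp

theorem coord_spinorProd_basis_odd {K : Finset (Fin n)} {i : Fin n} (hi : i ∉ K) :
    (extBasis n).coord (crossIndex K i) (spinorProd (spinBasis n (insert i K)) (spinBasis n K)) =
      (-1) ^ ((K.card + 1).choose 2) := by
  rw [spinorProd, revert_basisExterior, map_smul, LinearMap.smul_apply, map_smul, map_smul,
    coord_liftOp_crossIndex 1 K i hi, Nat.choose_succ_succ' K.card 1, Nat.choose_one_right, pow_add,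
    smul_eq_mul, mul_comm]

theorem coord_spinorProd_crossIndex {K : Finset (Fin n)} {i : Fin n} (hi : i ∉ K)
    {s t : SpinModule n} (hs : parity s = s) (ht : parity t = -t) :
    (extBasis n).coord (crossIndex K i) (spinorProd s t) =
      (-1) ^ ((K.card + 1).choose 2) *
        if Even K.card then (spinBasis n).coord K s * (spinBasis n).coord (insert i K) t
        else (spinBasis n).coord (insert i K) s * (spinBasis n).coord K t := by
  have hs' : ∀ A : Finset (Fin n), ¬ Even A.card → (spinBasis n).coord A s = 0 := by
    intro A hA
    have h := coord_parity s A
    rw [hs, (Nat.not_even_iff_odd.mp hA).neg_one_pow, neg_one_mul] at h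
    exact self_eq_neg.mp h
  have ht' : ∀ A : Finset (Fin n), Even A.card → (spinBasis n).coord A t = 0 := by
    intro A hA
    have h := coord_parity t A
    rw [ht, hA.neg_one_pow, one_mul, map_neg] at h
    exact neg_eq_self.mp h
  have key : ∀ A B : Finset (Fin n), (∀ C : Finset (Fin n), C ≠ A → (C ≠ K ∧ C ≠ insert i K) ∨ ¬ Even C.card) →
      (∀ C : Finset (Fin n), C ≠ B → (C ≠ K ∧ C ≠ insert i K) ∨ Even C.card) →
      (extBasis n).coord (crossIndex K i) (spinorProd s t) =
        (spinBasis n).coord A s * ((spinBasis n).coord B t *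
          (extBasis n).coord (crossIndex K i) (spinorProd (spinBasis n A) (spinBasis n B))) := by
    intro A B hA hB
    have h1 := linearMap_apply_eq_single ((extBasis n).coord (crossIndex K i) ∘ₗ spinorProdLeft t) s A
      (fun C hC => by
        rcases hA C hC with h | h
        · exact Or.inr (spinorProd_eq_zero_of_notMem h.1 h.2 t).1
        · exact Or.inl (hs' C h))
    have h2 := linearMap_apply_eq_single
      ((extBasis n).coord (crossIndex K i) ∘ₗ spinorProdRight (spinBasis n A)) t B
      (fun C hC => by
        rcases hB C hC with h | h
        · exact Or.inr (spinorProd_eq_zero_of_notMem h.1 h.2 _).2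
        · exact Or.inl (ht' C h))
    exact h1.trans (congrArg _ h2)
  have hc : (insert i K).card = K.card + 1 := Finset.card_insert_of_notMem hi
  by_cases hK : Even K.card
  · have hJ : ¬ Even (insert i K).card := by rw [hc]; simpa [Nat.even_add_one] using hK
    rw [if_pos hK, key K (insert i K), coord_spinorProd_basis_even hi hK]
    · ring
    · intro C hC
      by_cases h : C = insert i K
      · exact Or.inr (h ▸ hJ)
      · exact Or.inl ⟨hC, h⟩
    · intro C hC
      by_cases h : C = K
      · exact Or.inr (h ▸ hK)
      · exact Or.inl ⟨h, hC⟩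
  · have hJ : Even (insert i K).card := by rw [hc]; simpa [Nat.even_add_one] using hK
    rw [if_neg hK, key (insert i K) K, coord_spinorProd_basis_odd hi]
    · ring
    · intro C hC
      by_cases h : C = K
      · exact Or.inr (h ▸ hK)
      · exact Or.inl ⟨h, hC⟩
    · intro C hC
      by_cases h : C = insert i K
      · exact Or.inr (h ▸ hJ)
      · exact Or.inl ⟨hC, h⟩

/-- The signs `σ` turn the coordinate of the spinor product into a product of Cartan coordinates. -/
theorem neg_one_pow_choose_eq_sgnSigma {K : Finset (Fin n)} {i : Fin n} (hi : i ∉ K) :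
    (-1 : ℂ) ^ ((K.card + 1).choose 2) = sgnSigma (insert i K) * sgnSigma K := by
  rw [sgnSigma, sgnSigma, Finset.card_insert_of_notMem hi, Nat.choose_two_right, Nat.add_sub_cancel]
  generalize K.card = r
  obtain ⟨q, c, hc, rfl⟩ : ∃ q c, c < 4 ∧ r = 4 * q + c :=
    ⟨r / 4, r % 4, Nat.mod_lt _ (by norm_num), by omega⟩
  have h : (4 * q + c + 1) * (4 * q + c) / 2 =
      2 * (4 * q * q + 2 * q * c + q) + (c + 1) * c / 2 := by
    rw [show (4 * q + c + 1) * (4 * q + c) =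
      2 * (2 * (4 * q * q + 2 * q * c + q)) + (c + 1) * c by ring, Nat.mul_add_div (by norm_num)]
  rw [h, pow_add, pow_mul, neg_one_sq, one_pow, one_mul, add_assoc, Nat.mul_add_mod,
    Nat.mul_add_mod]
  interval_cases c <;> norm_num

end ElecOG

/-! ### Equivariance of the spinor product under the spin group -/

namespace ElecOG

variable {n : ℕ}

theorem spinRep_ι (x : Fin (n + n) → ℂ) (s : SpinModule n) :
    spinRep n (CliffordAlgebra.ι (quadQ n) x) s = vecAct n x s := by
  rw [spinRep, CliffordAlgebra.lift_ι_apply]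

theorem spinRep_mul (g h : Cl n) (s : SpinModule n) :
    spinRep n (g * h) s = spinRep n g (spinRep n h s) := by
  rw [map_mul, Module.End.mul_apply]

theorem parity_spinRep (g : Cl n) (s : SpinModule n) :
    parity (spinRep n g s) = spinRep n (CliffordAlgebra.involute g) (parity s) := by
  induction g using CliffordAlgebra.left_induction with
  | algebraMap r => simp
  | add g h hg hh => simp only [map_add, LinearMap.add_apply, hg, hh]
  | ι_mul g x hg =>
    rw [spinRep_mul, spinRep_ι, parity_vecAct, hg, map_mul, CliffordAlgebra.involute_ι,
      neg_mul, map_neg, LinearMap.neg_apply, spinRep_mul, spinRep_ι]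

theorem polar_quadQ (x y : Fin (n + n) → ℂ) :
    QuadraticMap.polar (quadQ n) x y = 2 * bilinQ n x y := by
  rw [QuadraticMap.polar, ← bilinQ_self, ← bilinQ_self, ← bilinQ_self]
  simp only [map_add, LinearMap.add_apply]
  rw [bilinQ_comm y x]
  ring

theorem ι_mul_self_quadQ (x : Fin (n + n) → ℂ) :
    CliffordAlgebra.ι (quadQ n) x * CliffordAlgebra.ι (quadQ n) x = quadQ n x • 1 := by
  rw [CliffordAlgebra.ι_sq_scalar, Algebra.algebraMap_eq_smul_one]

theorem quadQ_ne_zero_of_unit {u : (Cl n)ˣ} {x : Fin (n + n) → ℂ}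
    (hu : CliffordAlgebra.ι (quadQ n) x = u) : quadQ n x ≠ 0 := by
  let _ : Invertible (2 : ℂ) := invertibleOfNonzero two_ne_zero
  have h : IsUnit (CliffordAlgebra.ι (quadQ n) x) := hu ▸ u.isUnit
  exact (CliffordAlgebra.isUnit_of_isUnit_ι _ h).ne_zero

/-- An element of the Lipschitz group of parity `d` acts on `ℂ^{2n}` by a linear map `f` whose
extension to `⋀ ℂ^{2n}` corresponds, up to the norm `c`, to the action on both copies of `S`. -/
def ActsOnSpinorProd (u : (Cl n)ˣ) : Prop :=
  ∃ (d : ℕ) (c : ℂ) (f : (Fin (n + n) → ℂ) →ₗ[ℂ] (Fin (n + n) → ℂ)),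
    (∀ x, CliffordAlgebra.ι (quadQ n) (f x) = CliffordAlgebra.involute (u : Cl n) *
      CliffordAlgebra.ι (quadQ n) x * (u⁻¹ : (Cl n)ˣ)) ∧
    CliffordAlgebra.involute (u : Cl n) = (-1 : ℂ) ^ d • (u : Cl n) ∧
    star (u : Cl n) * u = ((-1 : ℂ) ^ d * c) • (1 : Cl n) ∧
    ∀ (a b : ℂ) (s t : SpinModule n), parity s = a • s → parity t = b • t →
      c • ExteriorAlgebra.map f (spinorProd s t) =
        (a * b) ^ d • spinorProd (spinRep n u s) (spinRep n u t)

theorem inv_eq_smul_ι {u : (Cl n)ˣ} {x : Fin (n + n) → ℂ}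
    (hu : CliffordAlgebra.ι (quadQ n) x = u) :
    ((u⁻¹ : (Cl n)ˣ) : Cl n) = (quadQ n x)⁻¹ • CliffordAlgebra.ι (quadQ n) x := by
  have h : (u : Cl n) * ((quadQ n x)⁻¹ • CliffordAlgebra.ι (quadQ n) x) = 1 := by
    rw [mul_smul_comm, ← hu, ι_mul_self_quadQ, smul_smul,
      inv_mul_cancel₀ (quadQ_ne_zero_of_unit hu), one_smul]
  exact Units.inv_eq_of_mul_eq_one_right h

theorem ActsOnSpinorProd.of_vector {u : (Cl n)ˣ} {x : Fin (n + n) → ℂ}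
    (hu : CliffordAlgebra.ι (quadQ n) x = u) : ActsOnSpinorProd u := by
  have hx := quadQ_ne_zero_of_unit hu
  refine ⟨1, quadQ n x, reflectionQ x, fun y => ?_, ?_, ?_, fun a b s t hs ht => ?_⟩
  · have h1 := CliffordAlgebra.ι_mul_ι_add_swap (Q := quadQ n) x y
    rw [polar_quadQ, Algebra.algebraMap_eq_smul_one] at h1
    rw [inv_eq_smul_ι hu, ← hu, CliffordAlgebra.involute_ι, reflectionQ_apply, map_sub, map_smul,
      neg_mul, eq_sub_of_add_eq h1, neg_sub, sub_mul, mul_smul_comm, mul_assoc,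
      ι_mul_self_quadQ, smul_mul_assoc, one_mul, mul_smul_comm, mul_one, smul_smul, smul_smul,
      inv_mul_cancel₀ hx, one_smul]
    congr 2
    ring
  · rw [← hu, CliffordAlgebra.involute_ι, pow_one, neg_one_smul]
  · rw [← hu, CliffordAlgebra.star_ι, neg_mul, ι_mul_self_quadQ, pow_one, neg_one_mul, neg_smul]
  · rw [smul_map_reflectionQ_spinorProd hx, hs, ht, ← hu, spinRep_ι, spinRep_ι, map_smul, map_smul,
      pow_one, mul_smul]
    exact ((spinorProdLeft _).map_smul a _).trans (congrArg _ ((spinorProdRight _).map_smul b _))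

theorem ActsOnSpinorProd.one : ActsOnSpinorProd (1 : (Cl n)ˣ) :=
  ⟨0, 1, LinearMap.id, by simp, by simp, by simp, fun a b s t _ _ => by
    simp [ExteriorAlgebra.map_id]⟩

theorem ActsOnSpinorProd.mul {u v : (Cl n)ˣ} (hu : ActsOnSpinorProd u) (hv : ActsOnSpinorProd v) :
    ActsOnSpinorProd (u * v) := by
  obtain ⟨d, c, f, h1, h2, h3, h4⟩ := hu
  obtain ⟨d', c', f', h1', h2', h3', h4'⟩ := hv
  refine ⟨d + d', c * c', f ∘ₗ f', fun x => ?_, ?_, ?_, fun a b s t hs ht => ?_⟩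
  · rw [LinearMap.comp_apply, h1, h1', Units.val_mul, map_mul, mul_inv_rev, Units.val_mul]
    simp only [mul_assoc]
  · rw [Units.val_mul, map_mul, h2, h2', smul_mul_smul_comm, pow_add]
  · rw [Units.val_mul, star_mul, mul_assoc, ← mul_assoc (star (u : Cl n)), h3, smul_mul_assoc,
      one_mul, mul_smul_comm, h3', smul_smul]
    congr 1
    ring
  · have hp : ∀ (a : ℂ) (s : SpinModule n), parity s = a • s →
        parity (spinRep n (v : Cl n) s) = ((-1) ^ d' * a) • spinRep n (v : Cl n) s := by
      intro a s hs
      rw [parity_spinRep, h2', hs, map_smul, map_smul, LinearMap.smul_apply, smul_smul, mul_comm]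
    rw [← ExteriorAlgebra.map_comp_map, AlgHom.comp_apply, mul_smul, ← map_smul, h4' a b s t hs ht,
      map_smul, smul_comm, h4 _ _ _ _ (hp a s hs) (hp b t ht), smul_smul, Units.val_mul,
      spinRep_mul, spinRep_mul]
    congr 1
    rw [mul_mul_mul_comm, ← mul_pow, neg_one_mul, neg_neg, one_pow, one_mul, pow_add, mul_comm]

theorem actsOnSpinorProd_of_mem {u : (Cl n)ˣ} (hu : u ∈ lipschitzGroup (quadQ n)) :
    ActsOnSpinorProd u := by
  unfold lipschitzGroup at hu
  induction hu using Subgroup.closure_induction'' with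
  | mem x hx =>
    obtain ⟨a, ha⟩ := hx
    exact ActsOnSpinorProd.of_vector ha
  | inv_mem x hx =>
    obtain ⟨a, ha⟩ := hx
    refine ActsOnSpinorProd.of_vector (x := (quadQ n a)⁻¹ • a) ?_
    rw [map_smul, inv_eq_smul_ι ha]
  | one => exact ActsOnSpinorProd.one
  | mul y z _ _ hy hz => exact hy.mul hz

theorem rho_eq_of_ι {g : Cl n} {f : (Fin (n + n) → ℂ) →ₗ[ℂ] (Fin (n + n) → ℂ)}
    (h : ∀ x, CliffordAlgebra.ι (quadQ n) (f x) =
      CliffordAlgebra.involute g * CliffordAlgebra.ι (quadQ n) x * star g) : rho n g = f := by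
  refine LinearMap.ext fun x => ?_
  rw [← toVec_ι n (f x), h]
  rfl

/-- The spinor product is equivariant under the spin group. -/
theorem map_rho_spinorProd {g : Cl n} (hg : g ∈ spinGroup (quadQ n)) {s t : SpinModule n}
    (hs : parity s = s) (ht : parity t = -t) :
    ExteriorAlgebra.map (rho n g) (spinorProd s t) =
      spinorProd (spinRep n g s) (spinRep n g t) := by
  let u : (Cl n)ˣ := spinGroup.toUnits (⟨g, hg⟩ : spinGroup (quadQ n))
  have hu : (u : Cl n) = g := rfl
  have hui : ((u⁻¹ : (Cl n)ˣ) : Cl n) = star g := rfl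
  obtain ⟨d, c, f, h1, h2, h3, h4⟩ :=
    actsOnSpinorProd_of_mem (spinGroup.units_mem_lipschitzGroup (x := u) hg)
  have hne : (u : Cl n) ≠ 0 := u.ne_zero
  have hd : (-1 : ℂ) ^ d = 1 := by
    rw [hu, spinGroup.involute_eq hg, ← hu] at h2
    have h : ((-1 : ℂ) ^ d - 1) • (u : Cl n) = 0 := by rw [sub_smul, ← h2, one_smul, sub_self]
    exact sub_eq_zero.mp ((smul_eq_zero.mp h).resolve_right hne)
  have hc : c = 1 := by
    rw [hd, one_mul, hu, spinGroup.star_mul_self_of_mem hg] at h3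
    have h : (c - 1) • (1 : Cl n) = 0 := by rw [sub_smul, ← h3, one_smul, sub_self]
    exact sub_eq_zero.mp ((smul_eq_zero.mp h).resolve_right one_ne_zero)
  have h := h4 1 (-1) s t (by rw [hs, one_smul]) (by rw [ht, neg_one_smul])
  rw [hc, one_smul, one_mul, hd, one_smul, hu] at h
  rw [rho_eq_of_ι (f := f) (by intro x; rw [h1, hui, hu]), h]

/-- The multivector `e_1 ∧ e_{n+1} ∧ ⋯ ∧ e_{2n}`. -/
noncomputable def baseVec (n : ℕ) [NeZero n] : ⋀[ℂ]^(n + 1) (Fin (n + n) → ℂ) :=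
  (Pi.basisFun ℂ (Fin (n + n))).exteriorPower (n + 1) ⟨baseIndex n, baseIndex_card n⟩

theorem baseIndex_eq_crossIndex (n : ℕ) [NeZero n] : baseIndex n = crossIndex ∅ 0 := by
  rw [crossIndex, pairIndex_insert_left, Finset.sdiff_empty]
  simp [baseIndex, pairIndex]

theorem card_highIndex (n : ℕ) : (highIndex n).card = n := by
  simp [highIndex]

/-- The component of degree `n + 1` of the spinor product of `1` and `e_1` is
`e_1 ∧ e_{n+1} ∧ ⋯ ∧ e_{2n}`; its only other component has degree `n - 1`. -/
theorem spinorProd_one_spinE1 (n : ℕ) [NeZero n] :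
    ∃ c : ℂ, spinorProd (1 : SpinModule n) (spinE1 n) =
      (baseVec n : ExteriorAlgebra ℂ (Fin (n + n) → ℂ)) +
        c • extBasis n ((highIndex n).erase (Fin.natAdd n 0)) := by
  have h0 : spinE1 n = ExteriorAlgebra.ι ℂ (Pi.basisFun ℂ (Fin n) 0) * 1 := by
    rw [mul_one, Pi.basisFun_apply, spinE1]
  have h1 : (baseVec n : ExteriorAlgebra ℂ (Fin (n + n) → ℂ)) =
      ExteriorAlgebra.ι ℂ (stdVec n (Fin.castAdd n 0)) * extBasis n (highIndex n) := by
    rw [ι_stdVec, ι_mul_basisExterior _ (castAdd_notMem_highIndex 0), baseVec,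
      ← ExteriorAlgebra.basis_eq_coe_basis, Finset.filter_false_of_mem]
    · simp [baseIndex, highIndex]
    · intro j _
      simp [Fin.lt_def]
  have h2 := contr_basisExterior (Pi.basisFun ℂ (Fin (n + n)))
    (Finset.notMem_erase (Fin.natAdd n 0) (highIndex n))
  rw [Finset.insert_erase (natAdd_mem_highIndex 0)] at h2
  refine ⟨(-1 : ℂ) * ((1 / 2 : ℂ) * (-1) ^ ((0 : Fin n) : ℕ)) * (-1) ^
    (((highIndex n).erase (Fin.natAdd n 0)).filter (· < Fin.natAdd n 0)).card, ?_⟩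
  rw [spinorProd, map_one, Module.End.one_apply, h0, mul_one, revert_ι, ← mul_one
    (ExteriorAlgebra.ι ℂ _), liftOp_ι_mul, map_one, Module.End.one_apply, lowIncl_single,
    cliffOp_apply, ← h1, bilinQ_stdVec_castAdd, contr_smul, LinearMap.smul_apply, h2, smul_smul,
    smul_smul]

theorem coord_map_basis_eq_zero (f : (Fin (n + n) → ℂ) →ₗ[ℂ] (Fin (n + n) → ℂ))
    {S I : Finset (Fin (n + n))} (h : I.card ≠ S.card) :
    (extBasis n).coord I (ExteriorAlgebra.map f (extBasis n S)) = 0 := by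
  rw [ExteriorAlgebra.basis_eq_coe_basis (Pi.basisFun ℂ (Fin (n + n)))
    (⟨S, rfl⟩ : Set.powersetCard (Fin (n + n)) S.card), ← coe_exteriorPower_map,
    coord_coe_exteriorPower, dif_neg h]

theorem parity_one : parity (1 : SpinModule n) = 1 := map_one _

theorem parity_spinE1 [NeZero n] : parity (spinE1 n) = -spinE1 n := parity_ι _

/-- The Plücker coordinates of `g (e_1 ∧ e_{n+1} ∧ ⋯ ∧ e_{2n})` at the sets `I` with
`#(J ∩ J^∨) = 1` are products of coordinates of the spinors `g 1` and `g e_1`. -/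
theorem repr_map_rho_baseVec [NeZero n] {g : Cl n} (hg : g ∈ spinGroup (quadQ n))
    {K : Finset (Fin n)} {i : Fin n} (hi : i ∉ K) (hI : (crossIndex K i).card = n + 1) :
    ((Pi.basisFun ℂ (Fin (n + n))).exteriorPower (n + 1)).repr
        (exteriorPower.map (n + 1) (rho n g) (baseVec n)) ⟨crossIndex K i, hI⟩ =
      sgnSigma (insert i K) * sgnSigma K *
        if Even K.card then (spinBasis n).coord K (spinRep n g 1) *
          (spinBasis n).coord (insert i K) (spinRep n g (spinE1 n))
        else (spinBasis n).coord (insert i K) (spinRep n g 1) *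
          (spinBasis n).coord K (spinRep n g (spinE1 n)) := by
  have hinv := spinGroup.involute_eq hg
  have hs : parity (spinRep n g 1) = spinRep n g 1 := by rw [parity_spinRep, hinv, parity_one]
  have ht : parity (spinRep n g (spinE1 n)) = -spinRep n g (spinE1 n) := by
    rw [parity_spinRep, hinv, parity_spinE1, map_neg]
  obtain ⟨c, hc⟩ := spinorProd_one_spinE1 n
  have h1 := coord_coe_exteriorPower (Pi.basisFun ℂ (Fin (n + n)))
    (exteriorPower.map (n + 1) (rho n g) (baseVec n)) (crossIndex K i)
  rw [dif_pos hI, coe_exteriorPower_map, eq_sub_of_add_eq hc.symm, map_sub, map_sub, map_smul,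
    map_smul, coord_map_basis_eq_zero, smul_zero, sub_zero,
    map_rho_spinorProd hg parity_one parity_spinE1, coord_spinorProd_crossIndex hi hs ht,
    neg_one_pow_choose_eq_sgnSigma hi] at h1
  · exact h1.symm
  · rw [hI, Finset.card_erase_of_mem (natAdd_mem_highIndex 0), card_highIndex]
    have := Nat.pos_of_neZero n
    omega

end ElecOG

/-! ### The spin group acting on vectors and spinors -/

namespace ElecOG

variable {n : ℕ}

theorem rho_one : rho n 1 = LinearMap.id :=
  rho_eq_of_ι fun x => by simp

theorem spinRep_one (s : SpinModule n) : spinRep n 1 s = s := by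
  rw [map_one, Module.End.one_apply]

theorem rho_mul {g h : Cl n} (hg : g ∈ spinGroup (quadQ n)) (hh : h ∈ spinGroup (quadQ n)) :
    rho n (g * h) = rho n g ∘ₗ rho n h :=
  rho_eq_of_ι fun x => by
    rw [LinearMap.comp_apply, ι_rho n hg, ι_rho n hh, map_mul, star_mul]
    simp only [mul_assoc]

theorem rho_star_rho {g : Cl n} (hg : g ∈ spinGroup (quadQ n)) (x : Fin (n + n) → ℂ) :
    rho n (star g) (rho n g x) = x := by
  rw [← LinearMap.comp_apply, ← rho_mul (spinGroup.star_mem hg) hg,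
    spinGroup.star_mul_self_of_mem hg, rho_one, LinearMap.id_apply]

theorem rho_rho_star {g : Cl n} (hg : g ∈ spinGroup (quadQ n)) (x : Fin (n + n) → ℂ) :
    rho n g (rho n (star g) x) = x := by
  rw [← LinearMap.comp_apply, ← rho_mul hg (spinGroup.star_mem hg),
    spinGroup.mul_star_self_of_mem hg, rho_one, LinearMap.id_apply]

theorem rho_injective {g : Cl n} (hg : g ∈ spinGroup (quadQ n)) :
    Function.Injective (rho n g) :=
  Function.LeftInverse.injective (rho_star_rho hg)

theorem spinRep_star_spinRep {g : Cl n} (hg : g ∈ spinGroup (quadQ n)) (s : SpinModule n) :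
    spinRep n (star g) (spinRep n g s) = s := by
  rw [← spinRep_mul, spinGroup.star_mul_self_of_mem hg, spinRep_one]

theorem map_rho_mul {g h : Cl n} (hg : g ∈ spinGroup (quadQ n)) (hh : h ∈ spinGroup (quadQ n))
    (X : Submodule ℂ (Fin (n + n) → ℂ)) :
    X.map (rho n (g * h)) = (X.map (rho n h)).map (rho n g) := by
  rw [rho_mul hg hh, Submodule.map_comp]

theorem map_rho_one (X : Submodule ℂ (Fin (n + n) → ℂ)) : X.map (rho n 1) = X := by
  rw [rho_one, Submodule.map_id]

theorem finrank_map_rho {g : Cl n} (hg : g ∈ spinGroup (quadQ n))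
    (X : Submodule ℂ (Fin (n + n) → ℂ)) :
    Module.finrank ℂ (X.map (rho n g)) = Module.finrank ℂ X :=
  (Submodule.equivMapOfInjective _ (rho_injective hg) X).finrank_eq.symm

theorem spinRep_vecAct {g : Cl n} (hg : g ∈ spinGroup (quadQ n)) (x : Fin (n + n) → ℂ)
    (s : SpinModule n) :
    spinRep n g (vecAct n x s) = vecAct n (rho n g x) (spinRep n g s) := by
  rw [← spinRep_ι, ← spinRep_ι, ← spinRep_mul, ← spinRep_mul, ι_rho n hg,
    spinGroup.involute_eq hg, mul_assoc, spinGroup.star_mul_self_of_mem hg, mul_one]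

theorem quadQ_rho {g : Cl n} (hg : g ∈ spinGroup (quadQ n)) (x : Fin (n + n) → ℂ) :
    quadQ n (rho n g x) = quadQ n x := by
  have h := ι_mul_self_quadQ (rho n g x)
  rw [ι_rho n hg, spinGroup.involute_eq hg, mul_assoc, mul_assoc, ← mul_assoc (star g),
    ← mul_assoc (star g), spinGroup.star_mul_self_of_mem hg, one_mul, ← mul_assoc (_ : Cl n) _
    (star g), ι_mul_self_quadQ, smul_mul_assoc, one_mul, mul_smul_comm,
    spinGroup.mul_star_self_of_mem hg] at h
  exact (smul_left_injective ℂ (one_ne_zero (α := Cl n)) h).symm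

theorem bilinQ_rho {g : Cl n} (hg : g ∈ spinGroup (quadQ n)) (x y : Fin (n + n) → ℂ) :
    bilinQ n (rho n g x) (rho n g y) = bilinQ n x y := by
  have h := polar_quadQ (rho n g x) (rho n g y)
  rw [QuadraticMap.polar, ← map_add, quadQ_rho hg, quadQ_rho hg, quadQ_rho hg] at h
  exact mul_left_cancel₀ two_ne_zero (h.symm.trans (polar_quadQ x y))

theorem mem_lipschitzGroup_of_ι {u : (Cl n)ˣ} {x : Fin (n + n) → ℂ}
    (h : CliffordAlgebra.ι (quadQ n) x = u) : u ∈ lipschitzGroup (quadQ n) :=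
  Subgroup.subset_closure ⟨x, h⟩

theorem ι_mul_ι_mem_spinGroup {x y : Fin (n + n) → ℂ} (hx : quadQ n x = 1) (hy : quadQ n y = 1) :
    CliffordAlgebra.ι (quadQ n) x * CliffordAlgebra.ι (quadQ n) y ∈ spinGroup (quadQ n) := by
  have h1 : CliffordAlgebra.ι (quadQ n) x * CliffordAlgebra.ι (quadQ n) x = 1 := by
    rw [ι_mul_self_quadQ, hx, one_smul]
  have h2 : CliffordAlgebra.ι (quadQ n) y * CliffordAlgebra.ι (quadQ n) y = 1 := by
    rw [ι_mul_self_quadQ, hy, one_smul]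
  let u : (Cl n)ˣ := ⟨_, _, h1, h1⟩
  let v : (Cl n)ˣ := ⟨_, _, h2, h2⟩
  have hs : star (CliffordAlgebra.ι (quadQ n) x * CliffordAlgebra.ι (quadQ n) y) =
      CliffordAlgebra.ι (quadQ n) y * CliffordAlgebra.ι (quadQ n) x := by
    rw [star_mul, CliffordAlgebra.star_ι, CliffordAlgebra.star_ι, neg_mul_neg]
  rw [spinGroup.mem_iff, pinGroup.mem_iff]
  refine ⟨⟨⟨u * v, mul_mem (mem_lipschitzGroup_of_ι (x := x) rfl)
    (mem_lipschitzGroup_of_ι (x := y) rfl), rfl⟩, ?_⟩, ?_⟩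
  · rw [Unitary.mem_iff, hs]
    constructor
    · rw [mul_assoc, ← mul_assoc _ _ (CliffordAlgebra.ι (quadQ n) y), h1, one_mul, h2]
    · rw [mul_assoc, ← mul_assoc _ _ (CliffordAlgebra.ι (quadQ n) x), h2, one_mul, h1]
  · exact CliffordAlgebra.ι_mul_ι_mem_evenOdd_zero (quadQ n) x y

/-! ### Isotropic subspaces and pure spinors -/

theorem exists_dualPart_highIncl (φ : Module.Dual ℂ (Fin n → ℂ)) :
    ∃ u, dualPart n (highIncl n u) = φ := by
  refine ⟨fun i => (-1) ^ (i : ℕ) * φ (Pi.single i 1), ?_⟩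
  refine (Pi.basisFun ℂ (Fin n)).ext fun i => ?_
  rw [dualPart_apply, Finset.sum_eq_single i]
  · simp [← mul_assoc, ← mul_pow, -Fin.natAdd_eq_addNat]
  · intro j _ hj
    simp [hj, -Fin.natAdd_eq_addNat]
  · simp

theorem mem_basePlus {x : Fin (n + n) → ℂ} : x ∈ basePlus n ↔ wPart n x = 0 := by
  constructor
  · intro hx
    have : basePlus n ≤ LinearMap.ker (wPart n) := by
      rw [basePlus, Submodule.span_le]
      rintro _ ⟨i, rfl⟩
      refine LinearMap.mem_ker.mpr ?_
      ext j
      simp [wPart, LinearMap.funLeft_apply, stdVec, castAdd_ne_natAdd, -Fin.natAdd_eq_addNat]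
    exact this hx
  · intro hx
    rw [← lowIncl_add_highIncl x, hx, map_zero, zero_add, highIncl_eq_sum]
    exact Submodule.sum_mem _ fun i _ =>
      Submodule.smul_mem _ _ (Submodule.subset_span ⟨i, rfl⟩)

theorem finrank_basePlus (n : ℕ) : Module.finrank ℂ (basePlus n) = n := by
  have h := LinearMap.finrank_range_add_finrank_ker (wPart n)
  have hs : LinearMap.range (wPart n) = ⊤ :=
    LinearMap.range_eq_top.mpr fun w => ⟨lowIncl n w, wPart_lowIncl w⟩
  have hk : LinearMap.ker (wPart n) = basePlus n := by
    ext x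
    rw [mem_basePlus, LinearMap.mem_ker]
  rw [hs, hk, finrank_top, Module.finrank_fin_fun, Module.finrank_fin_fun] at h
  omega

theorem lowIncl_single_one [NeZero n] :
    lowIncl n (Pi.single 0 1) = stdVec n (Fin.castAdd n 0) := by
  have := lowIncl_single (n := n) 0
  simpa using this

theorem mem_baseX [NeZero n] {x : Fin (n + n) → ℂ} :
    x ∈ baseX n ↔ ∃ c : ℂ, wPart n x = c • Pi.single 0 1 := by
  rw [baseX, Submodule.span_insert, Submodule.mem_sup]
  change (∃ y ∈ _, ∃ z ∈ basePlus n, y + z = x) ↔ _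
  constructor
  · rintro ⟨y, hy, z, hz, rfl⟩
    obtain ⟨c, rfl⟩ := Submodule.mem_span_singleton.mp hy
    exact ⟨c, by rw [map_add, mem_basePlus.mp hz, map_smul, ← lowIncl_single_one, wPart_lowIncl,
      add_zero]⟩
  · rintro ⟨c, hc⟩
    refine ⟨_, Submodule.mem_span_singleton.mpr ⟨c, rfl⟩, x - c • stdVec n (Fin.castAdd n 0),
      mem_basePlus.mpr ?_, by abel⟩
    rw [map_sub, map_smul, hc, ← lowIncl_single_one, wPart_lowIncl, sub_self]

/-- A vector orthogonal to `span (e_1, e_{n+2}, …, e_{2n})` annihilates the spinor `e_1`. -/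
theorem vecAct_spinE1_of_orthogonal [NeZero n] {x : Fin (n + n) → ℂ}
    (hx : ∀ y ∈ baseMinus n, bilinQ n y x = 0) : vecAct n x (spinE1 n) = 0 := by
  have h0 : x (Fin.natAdd n 0) = 0 := by
    have := hx (stdVec n (Fin.castAdd n 0)) (Submodule.subset_span ⟨0, by simp⟩)
    rw [bilinQ_stdVec_castAdd] at this
    simpa [-Fin.natAdd_eq_addNat] using this
  have h1 : ∀ i : Fin n, i ≠ 0 → x (Fin.castAdd n i) = 0 := by
    intro i hi
    have := hx (stdVec n (Fin.natAdd n i)) (Submodule.subset_span ⟨i, by simp [hi]⟩)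
    rw [bilinQ_stdVec_natAdd] at this
    simpa [-Fin.natAdd_eq_addNat] using this
  have hw : wPart n x = x (Fin.castAdd n 0) • Pi.single 0 1 := by
    ext i
    by_cases hi : i = 0
    · subst hi; simp [wPart, LinearMap.funLeft_apply]
    · simp [wPart, LinearMap.funLeft_apply, h1 i hi, hi]
  have hd : dualPart n x (Pi.single 0 1) = 0 := by
    rw [dualPart_apply]
    refine Finset.sum_eq_zero fun i _ => ?_
    by_cases hi : i = 0
    · rw [hi, h0]; simp
    · simp [hi]
  rw [vecAct_eq, spinE1, contr_ι, hd, zero_smul, add_zero, hw, map_smul, smul_mul_assoc,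
    ExteriorAlgebra.ι_sq_zero, smul_zero]

theorem eq_smul_one_of_contr_eq_zero {s : SpinModule n}
    (h : ∀ φ : Module.Dual ℂ (Fin n → ℂ), contr φ s = 0) :
    s = (spinBasis n).coord ∅ s • 1 := by
  refine (spinBasis n).ext_elem fun I => ?_
  rcases I.eq_empty_or_nonempty with rfl | ⟨k, hk⟩
  · rw [← basisExterior_empty (Pi.basisFun ℂ (Fin n))]
    simp
  · have h1 := coord_ι_mul_contr (Pi.basisFun ℂ (Fin n)) (Finset.notMem_erase k I)
      (Finset.notMem_erase k I) s
    rw [h, mul_zero, map_zero, ← two_mul, pow_mul, neg_one_sq, one_pow, one_mul,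
      Finset.insert_erase hk] at h1
    have h2 : (∅ : Finset (Fin n)) ≠ I := by rintro rfl; simp at hk
    rw [← basisExterior_empty (Pi.basisFun ℂ (Fin n))]
    change (spinBasis n).coord I s = _
    rw [← h1]
    simp [h2]

/-- An odd spinor annihilated by all contractions that annihilate `w` is a multiple of `w`. -/
theorem eq_smul_ι_of_contr_eq_zero {s : SpinModule n} (hs : parity s = -s) {w : Fin n → ℂ}
    (hw : w ≠ 0) (h : ∀ φ : Module.Dual ℂ (Fin n → ℂ), φ w = 0 → contr φ s = 0) :
    ∃ c : ℂ, s = c • ExteriorAlgebra.ι ℂ w := by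
  obtain ⟨ψ, hψ⟩ : ∃ ψ : Module.Dual ℂ (Fin n → ℂ), ψ w = 1 := by
    obtain ⟨j, hj⟩ := Function.ne_iff.mp hw
    exact ⟨(w j)⁻¹ • LinearMap.proj j, by simpa using inv_mul_cancel₀ hj⟩
  have h1 : ∀ φ, contr φ s = φ w • contr ψ s := by
    intro φ
    have := h (φ - φ w • ψ) (by simp [hψ])
    rwa [sub_eq_add_neg, ← neg_smul, contr_add, contr_smul, LinearMap.add_apply,
      LinearMap.smul_apply, neg_smul, ← sub_eq_add_neg, sub_eq_zero] at this
  have h2 : ∀ φ, contr φ (contr ψ s) = 0 := by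
    intro φ
    rw [contr_comm, h1 φ, map_smul, contr_contr, smul_zero, neg_zero]
  have h3 := eq_smul_one_of_contr_eq_zero (s := s - ExteriorAlgebra.ι ℂ w * contr ψ s) fun φ => by
    rw [map_sub, contr_ι_mul, h2, mul_zero, sub_zero, h1, sub_self]
  set ν := (spinBasis n).coord ∅ (s - ExteriorAlgebra.ι ℂ w * contr ψ s)
  have h4 := eq_smul_one_of_contr_eq_zero h2
  set μ := (spinBasis n).coord ∅ (contr ψ s)
  rw [h4, mul_smul_comm, mul_one] at h3
  have h5 := congrArg parity h3
  rw [map_sub, hs, map_smul, map_smul, parity_ι, map_one, ← h3, smul_neg, ← neg_sub'] at h5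
  have h6 : (2 : ℂ) • (s - μ • ExteriorAlgebra.ι ℂ w) = 0 := by
    rw [two_smul]
    nth_rewrite 1 [← h5]
    abel
  replace h5 := (smul_eq_zero.mp h6).resolve_left two_ne_zero
  exact ⟨μ, sub_eq_zero.mp h5⟩

end ElecOG

/-! ### The spin group acts transitively on decorated subspaces -/

namespace ElecOG

variable {n : ℕ}

/-- For `w ≠ 0` some element `k` of the spin group fixes the line of the spinor `1`, maps `e_1` to
a multiple of `w`, and hence maps `X_0` to `span (w, e_{n+1}, …, e_{2n})`. -/
theorem exists_spin_map_baseX [NeZero n] {w : Fin n → ℂ} (hw : w ≠ 0) :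
    ∃ k ∈ spinGroup (quadQ n), ∃ a b : ℂ, a ≠ 0 ∧ b ≠ 0 ∧ spinRep n k 1 = a • 1 ∧
      spinRep n k (spinE1 n) = b • ExteriorAlgebra.ι ℂ w ∧
      ∀ y, y ∈ (baseX n).map (rho n k) ↔ ∃ c : ℂ, wPart n y = c • w := by
  obtain ⟨e, he⟩ : ∃ e : Fin n → ℂ, e = Pi.single 0 1 := ⟨_, rfl⟩
  obtain ⟨φ, hφe, hφw⟩ : ∃ φ : Module.Dual ℂ (Fin n → ℂ), φ e = 1 ∧ φ w ≠ 0 := by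
    by_cases h0 : w 0 = 0
    · obtain ⟨j, hj⟩ := Function.ne_iff.mp hw
      have hj0 : j ≠ 0 := by rintro rfl; exact hj h0
      refine ⟨(LinearMap.proj 0 : (Fin n → ℂ) →ₗ[ℂ] ℂ) + LinearMap.proj j, ?_, ?_⟩
      · change e 0 + e j = 1
        simp [he, hj0]
      · change w 0 + w j ≠ 0
        rwa [h0, zero_add]
    · exact ⟨LinearMap.proj 0, by simp [he], by simpa using h0⟩
  obtain ⟨p, hp⟩ := exists_dualPart_highIncl φ
  obtain ⟨l, hl⟩ := IsAlgClosed.exists_eq_mul_self (1 / 2 : ℂ)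
  have hl0 : l ≠ 0 := by rintro rfl; norm_num at hl
  -- `u + φ` and `l (u + 2 φ)` are unit vectors whose product maps `e_1` to a multiple of `w`
  obtain ⟨ν, hν⟩ : ∃ ν : ℂ, ν = 2 / φ w := ⟨_, rfl⟩
  have hν0 : ν ≠ 0 := by rw [hν]; exact div_ne_zero two_ne_zero hφw
  have hνφ : ν * φ w = 2 := by rw [hν, div_mul_cancel₀ _ hφw]
  obtain ⟨u, hu⟩ : ∃ u : Fin n → ℂ, u = ν • w - e := ⟨_, rfl⟩
  have hφu : φ u = 1 := by
    rw [hu, map_sub, map_smul, smul_eq_mul, hνφ, hφe]; norm_num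
  have hw1 : ∀ c : ℂ, wPart n (lowIncl n u + c • highIncl n p) = u := fun c => by
    rw [map_add, map_smul, wPart_lowIncl, wPart_highIncl, smul_zero, add_zero]
  have hd1 : ∀ c : ℂ, dualPart n (lowIncl n u + c • highIncl n p) = c • φ := fun c => by
    rw [map_add, map_smul, dualPart_lowIncl, hp, zero_add]
  have hQ : ∀ c : ℂ, quadQ n (lowIncl n u + c • highIncl n p) = c := fun c => by
    rw [← dualPart_wPart, hw1, hd1, LinearMap.smul_apply, hφu, smul_eq_mul, mul_one]
  obtain ⟨x, hx⟩ : ∃ x, x = lowIncl n u + (1 : ℂ) • highIncl n p := ⟨_, rfl⟩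
  obtain ⟨y, hy⟩ : ∃ y, y = l • (lowIncl n u + (2 : ℂ) • highIncl n p) := ⟨_, rfl⟩
  have hQx : quadQ n x = 1 := by rw [hx, hQ]
  have hQy : quadQ n y = 1 := by rw [hy, QuadraticMap.map_smul, hQ, ← hl]; norm_num
  have hk := ι_mul_ι_mem_spinGroup hQx hQy
  set k := CliffordAlgebra.ι (quadQ n) x * CliffordAlgebra.ι (quadQ n) y
  have hact : ∀ s, spinRep n k s = l • (ExteriorAlgebra.ι ℂ u * (2 : ℂ) • contr φ s +
      contr φ (ExteriorAlgebra.ι ℂ u * s)) := fun s => by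
    rw [spinRep_mul, spinRep_ι, spinRep_ι, hy, map_smul, LinearMap.smul_apply, map_smul,
      vecAct_eq _ s, hw1, hd1, contr_smul, vecAct_eq, hx, hw1, hd1, one_smul, mul_add, ι_ι_mul,
      zero_add, LinearMap.smul_apply, map_add, map_smul, contr_contr, smul_zero, add_zero]
  have hone : spinRep n k 1 = l • 1 := by
    rw [hact, contr_one, smul_zero, mul_zero, zero_add, mul_one, contr_ι, hφu, one_smul]
  have hι : ∀ v, spinRep n k (ExteriorAlgebra.ι ℂ v) =
      l • ExteriorAlgebra.ι ℂ (v + φ v • u) := fun v => by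
    rw [hact, contr_ι_mul, contr_ι, hφu, one_smul, mul_smul_comm, mul_smul_comm, mul_one,
      two_smul, map_add, map_smul]
    congr 1
    abel
  have hιinj : Function.Injective (ExteriorAlgebra.ι ℂ : (Fin n → ℂ) → _) :=
    ExteriorAlgebra.ι_leftInverse.injective
  -- comparing the actions of a vector and of its image on the spinor `1`
  have key : ∀ z, wPart n (rho n k z) = wPart n z + φ (wPart n z) • u := by
    intro z
    have h1 := spinRep_vecAct hk z 1
    have h2 : ∀ z, vecAct n z 1 = ExteriorAlgebra.ι ℂ (wPart n z) := fun z => by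
      rw [vecAct_eq, mul_one, contr_one, add_zero]
    rw [hone, map_smul, h2, h2, hι] at h1
    exact (hιinj (smul_right_injective _ hl0 h1)).symm
  refine ⟨k, hk, l, l * ν, hl0, mul_ne_zero hl0 hν0, hone, ?_, fun z => ⟨?_, ?_⟩⟩
  · rw [spinE1, ← he, hι, hφe, one_smul, hu, add_sub_cancel, map_smul, smul_smul]
  · rintro ⟨z, hz, rfl⟩
    obtain ⟨c, hc⟩ := mem_baseX.mp hz
    refine ⟨c * ν, ?_⟩
    rw [key, hc, ← he, map_smul, hφe, hu, smul_eq_mul, mul_one, smul_sub, add_sub_cancel,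
      smul_smul]
  · rintro ⟨c, hc⟩
    refine ⟨rho n (star k) z, mem_baseX.mpr ⟨c / ν, ?_⟩, rho_rho_star hk z⟩
    have h1 := key (rho n (star k) z)
    rw [rho_rho_star hk, hc] at h1
    set v := wPart n (rho n (star k) z)
    have h2 := congrArg φ h1
    rw [map_smul, map_add, map_smul, hφu, smul_eq_mul, smul_eq_mul, mul_one, ← two_mul] at h2
    have h3 : φ v = c / ν := by
      rw [eq_div_iff hν0]
      linear_combination (-ν / 2) * h2 + (c / 2) * hνφ
    have h4 : v = c • w - φ v • u := by rw [h1, add_sub_cancel_right]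
    rw [h4, h3, hu, smul_sub, smul_smul, div_mul_cancel₀ _ hν0, sub_sub_cancel, he]

/-- The decorated subspace `x` is the image of the base point `(X_0, 1, e_1)` under `g`, with the
spinors scaled by `a` and `b`. -/
structure IsTranslate [NeZero n] (x : DecOG n) (g : Cl n) (a b : ℂ) : Prop where
  mem : g ∈ spinGroup (quadQ n)
  X_eq : x.X = (baseX n).map (rho n g)
  sPlus_eq : x.sPlus = a • spinRep n g 1
  sMinus_eq : x.sMinus = b • spinRep n g (spinE1 n)

/-- A subspace of dimension `n + 1` that contains `span (e_{n+1}, …, e_{2n})` is the sum of it and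
a line in `W`. -/
theorem exists_mem_iff_wPart {X : Submodule ℂ (Fin (n + n) → ℂ)}
    (hX : Module.finrank ℂ X = n + 1) (h : basePlus n ≤ X) :
    ∃ w : Fin n → ℂ, w ≠ 0 ∧ ∀ y, y ∈ X ↔ ∃ c : ℂ, wPart n y = c • w := by
  have h1 := LinearMap.finrank_range_add_finrank_ker ((wPart n).domRestrict X)
  have hk : LinearMap.ker ((wPart n).domRestrict X) = (basePlus n).comap X.subtype := by
    ext y
    rw [LinearMap.mem_ker, Submodule.mem_comap, mem_basePlus]
    rfl
  rw [hk, (Submodule.comapSubtypeEquivOfLe h).finrank_eq, finrank_basePlus, hX] at h1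
  replace h1 := finrank_eq_one_iff'.mp (Nat.add_right_cancel (h1.trans (add_comm n 1)))
  obtain ⟨⟨w, y0, rfl⟩, hw, hall⟩ := h1
  refine ⟨_, fun h0 => hw (Subtype.ext h0), fun y => ⟨fun hy => ?_, ?_⟩⟩
  · obtain ⟨c, hc⟩ := hall ⟨wPart n y, ⟨y, hy⟩, rfl⟩
    exact ⟨c, (congrArg Subtype.val hc).symm⟩
  · rintro ⟨c, hc⟩
    have h2 : y - c • (y0 : Fin (n + n) → ℂ) ∈ X := h (mem_basePlus.mpr (by
      rw [map_sub, map_smul, hc, sub_eq_zero]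
      rfl))
    simpa using X.add_mem h2 (X.smul_mem c y0.2)

/-- Every decorated subspace is, up to scaling the spinors, a translate of the base point.  After
moving `X_+` to `span (e_{n+1}, …, e_{2n})` one has `X = X_+ + ℂ w` with `w ∈ W`, and the spinor of
`X_-` is a multiple of `w`, being annihilated by `X_-`. -/
theorem exists_isTranslate [NeZero n] (x : DecOG n) : ∃ g a b, IsTranslate x g a b := by
  obtain ⟨Y, hY, g, hg, rfl, c, hc⟩ := x.mem_plus
  obtain ⟨Y', hY', g', hg', rfl, c', hc'⟩ := x.mem_minus
  have hgs := spinGroup.star_mem hg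
  have hX : ∀ y, y ∈ x.X.map (rho n (star g)) ↔ rho n g y ∈ x.X := fun y =>
    ⟨fun ⟨z, hz, hy⟩ => by rwa [← hy, rho_rho_star hg], fun h => ⟨_, h, rho_star_rho hg y⟩⟩
  obtain ⟨w, hw0, hw⟩ := exists_mem_iff_wPart (X := x.X.map (rho n (star g)))
    (by rw [finrank_map_rho hgs, x.finrank_eq]) fun y hy => (hX y).mpr (hY ⟨y, hy, rfl⟩)
  have hh := mul_mem hgs hg'
  set h := star g * g' with hdef
  -- the spinor of the second isotropic subspace is annihilated by its orthogonal complement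
  have hkill : ∀ φ : Module.Dual ℂ (Fin n → ℂ), φ w = 0 →
      contr φ (spinRep n h (spinE1 n)) = 0 := by
    intro φ hφ
    obtain ⟨p, hp⟩ := exists_dualPart_highIncl φ
    have h1 : vecAct n (rho n (star h) (highIncl n p)) (spinE1 n) = 0 := by
      refine vecAct_spinE1_of_orthogonal fun y hy => ?_
      rw [← bilinQ_rho hh, rho_rho_star hh]
      have h2 : rho n h y ∈ x.X.map (rho n (star g)) := by
        rw [hX, hdef, rho_mul hgs hg', LinearMap.comp_apply, rho_rho_star hg]
        exact hY' ⟨y, hy, rfl⟩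
      obtain ⟨d, hd⟩ := (hw _).mp h2
      have h3 : bilinQ n (highIncl n p) (highIncl n (highPartVec (rho n h y))) = 0 := by
        simp [bilinQ_apply, -Fin.natAdd_eq_addNat]
      have h4 := bilinQ_highIncl_lowIncl p (wPart n (rho n h y))
      rw [hp, hd, map_smul φ, hφ, smul_zero, ← hd] at h4
      rw [bilinQ_comm, ← lowIncl_add_highIncl (rho n h y), map_add, h3, add_zero]
      exact (mul_eq_zero.mp h4).resolve_left two_ne_zero
    have h2 := spinRep_vecAct hh (rho n (star h) (highIncl n p)) (spinE1 n)
    rw [h1, map_zero, rho_rho_star hh, vecAct_eq, wPart_highIncl, map_zero, zero_mul, zero_add,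
      hp] at h2
    exact h2.symm
  have hodd : parity (spinRep n h (spinE1 n)) = -spinRep n h (spinE1 n) := by
    rw [parity_spinRep, spinGroup.involute_eq hh, parity_spinE1, map_neg]
  obtain ⟨μ, hμ⟩ := eq_smul_ι_of_contr_eq_zero hodd hw0 hkill
  obtain ⟨k, hk, a, b, ha, hb, hk1, hke, hkX⟩ := exists_spin_map_baseX hw0
  refine ⟨g * k, c * a⁻¹, c' * (μ * b⁻¹), mul_mem hg hk, ?_, ?_, ?_⟩
  · ext y
    rw [map_rho_mul hg hk]
    constructor
    · intro hy
      exact ⟨rho n (star g) y, (hkX _).mpr ((hw _).mp ((hX _).mpr (by rwa [rho_rho_star hg]))),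
        rho_rho_star hg y⟩
    · rintro ⟨z, hz, rfl⟩
      exact (hX z).mp ((hw z).mpr ((hkX z).mp hz))
  · rw [hc, spinRep_mul, hk1, map_smul, smul_smul, mul_assoc, inv_mul_cancel₀ ha, mul_one]
  · rw [hc', spinRep_mul, hke, map_smul, smul_smul, mul_assoc, mul_assoc, inv_mul_cancel₀ hb,
      mul_one, mul_smul, ← map_smul (spinRep n g), ← hμ, ← spinRep_mul, hdef, ← mul_assoc,
      spinGroup.mul_star_self_of_mem hg, one_mul]

end ElecOG

/-! ### The map `η` -/

namespace ElecOG

variable {n : ℕ}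

/-- The top exterior power of a subspace is a line. -/
theorem eq_smul_of_mem_range_map_subtype {V : Type*} [AddCommGroup V] [Module ℂ V] {k : ℕ}
    {X : Submodule ℂ V} [FiniteDimensional ℂ X] (hX : Module.finrank ℂ X = k) {v w : ⋀[ℂ]^k V}
    (hv : v ∈ LinearMap.range (exteriorPower.map k X.subtype)) (hv0 : v ≠ 0)
    (hw : w ∈ LinearMap.range (exteriorPower.map k X.subtype)) : ∃ c : ℂ, w = c • v := by
  obtain ⟨v, rfl⟩ := hv
  obtain ⟨w, rfl⟩ := hw
  have h1 : Module.finrank ℂ (⋀[ℂ]^k X) = 1 := by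
    rw [exteriorPower.finrank_eq, hX, Nat.choose_self]
  obtain ⟨c, hc⟩ := (finrank_eq_one_iff_of_nonzero' v (by rintro rfl; exact hv0 (map_zero _))).mp
    h1 w
  exact ⟨c, by rw [← hc, map_smul]⟩

theorem map_mem_range_map_subtype {V : Type*} [AddCommGroup V] [Module ℂ V] {k : ℕ}
    {X : Submodule ℂ V} (f : V →ₗ[ℂ] V) {v : ⋀[ℂ]^k V}
    (hv : v ∈ LinearMap.range (exteriorPower.map k X.subtype)) :
    exteriorPower.map k f v ∈ LinearMap.range (exteriorPower.map k (X.map f).subtype) := by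
  obtain ⟨v, rfl⟩ := hv
  refine ⟨exteriorPower.map k (f.submoduleMap X) v, ?_⟩
  rw [← LinearMap.comp_apply, ← LinearMap.comp_apply, ← exteriorPower.map_comp,
    ← exteriorPower.map_comp]
  rfl

theorem baseVec_ne_zero (n : ℕ) [NeZero n] : baseVec n ≠ 0 := Module.Basis.ne_zero _ _

theorem baseVec_mem_range (n : ℕ) [NeZero n] :
    baseVec n ∈ LinearMap.range (exteriorPower.map (n + 1) (baseX n).subtype) := by
  have h : ∀ j ∈ baseIndex n, Pi.basisFun ℂ (Fin (n + n)) j ∈ baseX n := by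
    intro j hj
    rw [Pi.basisFun_apply]
    refine Submodule.subset_span ?_
    rcases Finset.mem_insert.mp hj with rfl | hj
    · exact Or.inl rfl
    · obtain ⟨i, -, rfl⟩ := Finset.mem_map.mp hj
      exact Or.inr ⟨i, rfl⟩
  rw [baseVec, exteriorPower.basis_apply]
  refine ⟨exteriorPower.ιMulti ℂ (n + 1) fun i =>
    ⟨_, h (Set.powersetCard.ofFinEmbEquiv.symm ⟨baseIndex n, baseIndex_card n⟩ i) ?_⟩, ?_⟩
  · exact (Set.powersetCard.mem_range_ofFinEmbEquiv_symm_iff_mem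
      (⟨baseIndex n, baseIndex_card n⟩ : Set.powersetCard (Fin (n + n)) (n + 1)) _).mp ⟨i, rfl⟩
  · rw [exteriorPower.map_apply_ιMulti]
    rfl

/-- The vector attached to a decorated subspace does not depend on its presentation as a
translate of the base point. -/
theorem IsTranslate.smul_map_baseVec_eq [NeZero n] {x : DecOG n} {g g' : Cl n} {a b a' b' : ℂ}
    (h : IsTranslate x g a b) (h' : IsTranslate x g' a' b') :
    (a * b) • exteriorPower.map (n + 1) (rho n g) (baseVec n) =
      (a' * b') • exteriorPower.map (n + 1) (rho n g') (baseVec n) := by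
  have hs := spinGroup.star_mem h'.mem
  have hk := mul_mem hs h.mem
  set k := star g' * g with hkdef
  have hg : g = g' * k := by
    rw [hkdef, ← mul_assoc, spinGroup.mul_star_self_of_mem h'.mem, one_mul]
  have hX : (baseX n).map (rho n k) = baseX n := by
    rw [hkdef, map_rho_mul hs h.mem, ← h.X_eq, h'.X_eq, ← map_rho_mul hs h'.mem,
      spinGroup.star_mul_self_of_mem h'.mem, map_rho_one]
  have hfin : Module.finrank ℂ (baseX n) = n + 1 := by
    rw [← finrank_map_rho h.mem, ← h.X_eq, x.finrank_eq]
  have h1 : a • spinRep n k 1 = a' • 1 := by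
    rw [hkdef, spinRep_mul, ← map_smul, ← h.sPlus_eq, h'.sPlus_eq, map_smul,
      spinRep_star_spinRep h'.mem]
  have h2 : b • spinRep n k (spinE1 n) = b' • spinE1 n := by
    rw [hkdef, spinRep_mul, ← map_smul, ← h.sMinus_eq, h'.sMinus_eq, map_smul,
      spinRep_star_spinRep h'.mem]
  have hmem := map_mem_range_map_subtype (rho n k) (baseVec_mem_range n)
  rw [hX] at hmem
  obtain ⟨c, hc⟩ := eq_smul_of_mem_range_map_subtype hfin (baseVec_mem_range n)
    (baseVec_ne_zero n) hmem
  -- the factor `c` is read off from the coordinate at the base index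
  have h3 := repr_map_rho_baseVec hk (Finset.notMem_empty (0 : Fin n))
    (by rw [← baseIndex_eq_crossIndex, baseIndex_card])
  have h4 : ((Pi.basisFun ℂ (Fin (n + n))).exteriorPower (n + 1)).repr (baseVec n)
      ⟨crossIndex ∅ 0, (congrArg _ (baseIndex_eq_crossIndex n)).symm.trans (baseIndex_card n)⟩ =
      1 := by
    simp_rw [← baseIndex_eq_crossIndex]
    rw [baseVec, Module.Basis.repr_self, Finsupp.single_eq_same]
  rw [hc, map_smul, Finsupp.smul_apply, h4] at h3
  have h5 := congrArg ((spinBasis n).coord ∅) h1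
  have h6 := congrArg ((spinBasis n).coord {0}) h2
  have h7 : (spinBasis n).coord ∅ 1 = 1 := by
    rw [← basisExterior_empty (Pi.basisFun ℂ (Fin n))]; simp
  have h8 : (spinBasis n).coord {0} (spinE1 n) = 1 := by
    have h9 := basisExterior_insert_lt (Pi.basisFun ℂ (Fin n)) (a := 0) (S := ∅) (by simp)
    rw [basisExterior_empty, mul_one, Pi.basisFun_apply] at h9
    rw [spinE1, ← h9]; simp
  simp only [map_smul, h7, h8, smul_eq_mul, mul_one] at h5 h6
  simp only [sgnSigma, Finset.card_empty, insert_empty_eq, Finset.card_singleton, Even.zero,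
    Module.Basis.coord_apply] at h3
  norm_num at h3
  rw [Module.Basis.coord_apply] at h5 h6
  rw [hg, rho_mul h'.mem hk, exteriorPower.map_comp, LinearMap.comp_apply, hc, map_smul, smul_smul,
    h3, ← h5, ← h6]
  congr 1
  ring

theorem IsTranslate.mem_range [NeZero n] {x : DecOG n} {g : Cl n} {a b : ℂ}
    (h : IsTranslate x g a b) : (a * b) • exteriorPower.map (n + 1) (rho n g) (baseVec n) ∈
      LinearMap.range (exteriorPower.map (n + 1) x.X.subtype) := by
  rw [h.X_eq]
  exact Submodule.smul_mem _ _ (map_mem_range_map_subtype _ (baseVec_mem_range n))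

theorem isTranslate_one_of_eq [NeZero n] {x : DecOG n} (hX : x.X = baseX n) (hp : x.sPlus = 1)
    (hm : x.sMinus = spinE1 n) : IsTranslate x 1 1 1 where
  mem := one_mem _
  X_eq := by rw [map_rho_one, hX]
  sPlus_eq := by rw [hp, spinRep_one, one_smul]
  sMinus_eq := by rw [hm, spinRep_one, one_smul]

theorem IsTranslate.map [NeZero n] {x y : DecOG n} {g h : Cl n} {a b : ℂ}
    (hx : IsTranslate x g a b) (hh : h ∈ spinGroup (quadQ n)) (hX : y.X = x.X.map (rho n h))
    (hp : y.sPlus = spinRep n h x.sPlus) (hm : y.sMinus = spinRep n h x.sMinus) :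
    IsTranslate y (h * g) a b where
  mem := mul_mem hh hx.mem
  X_eq := by rw [map_rho_mul hh hx.mem, hX, hx.X_eq]
  sPlus_eq := by rw [hp, hx.sPlus_eq, map_smul, spinRep_mul]
  sMinus_eq := by rw [hm, hx.sMinus_eq, map_smul, spinRep_mul]

theorem IsTranslate.smul [NeZero n] {x y : DecOG n} {g : Cl n} {a b c d : ℂ}
    (hx : IsTranslate x g a b) (hX : y.X = x.X) (hp : y.sPlus = c • x.sPlus)
    (hm : y.sMinus = d • x.sMinus) : IsTranslate y g (c * a) (d * b) where
  mem := hx.mem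
  X_eq := by rw [hX, hx.X_eq]
  sPlus_eq := by rw [hp, hx.sPlus_eq, smul_smul]
  sMinus_eq := by rw [hm, hx.sMinus_eq, smul_smul]

/-- The map `η`: if `(X, s_+, s_-)` is the image of `(X_0, 1, e_1)` under `g`, with the spinors
scaled by `a` and `b`, then its value is `(X, ab • g (e_1 ∧ e_{n+1} ∧ ⋯ ∧ e_{2n}))`. -/
noncomputable def eta (n : ℕ) [NeZero n] (x : DecOG n) : DecGr (n + 1) (n + n) where
  X := x.X
  finrank_eq := x.finrank_eq
  v := ((exists_isTranslate x).choose_spec.choose *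
      (exists_isTranslate x).choose_spec.choose_spec.choose) •
    exteriorPower.map (n + 1) (rho n (exists_isTranslate x).choose) (baseVec n)
  v_mem := (exists_isTranslate x).choose_spec.choose_spec.choose_spec.mem_range

theorem IsTranslate.eta_v [NeZero n] {x : DecOG n} {g : Cl n} {a b : ℂ}
    (h : IsTranslate x g a b) :
    (eta n x).v = (a * b) • exteriorPower.map (n + 1) (rho n g) (baseVec n) :=
  (exists_isTranslate x).choose_spec.choose_spec.choose_spec.smul_map_baseVec_eq h

theorem isEta_eta (n : ℕ) [NeZero n] : IsEta (eta n) where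
  X_eq _ := rfl
  base x hX hp hm := by
    rw [(isTranslate_one_of_eq hX hp hm).eta_v, rho_one, exteriorPower.map_id]
    simp [baseVec]
  equivariant h hh x y hX hp hm := by
    obtain ⟨g, a, b, hx⟩ := exists_isTranslate x
    rw [hx.eta_v, (hx.map hh hX hp hm).eta_v, rho_mul hh hx.mem, exteriorPower.map_comp,
      LinearMap.comp_apply, map_smul]
  homogeneous c d x y hX hp hm := by
    obtain ⟨g, a, b, hx⟩ := exists_isTranslate x
    rw [hx.eta_v, (hx.smul hX hp hm).eta_v, smul_smul]
    congr 1
    ring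

theorem basePlus_le_baseX (n : ℕ) [NeZero n] : basePlus n ≤ baseX n := fun x hx =>
  mem_baseX.mpr ⟨0, by rw [mem_basePlus.mp hx, zero_smul]⟩

theorem baseMinus_le_baseX (n : ℕ) [NeZero n] : baseMinus n ≤ baseX n := by
  rw [baseMinus, Submodule.span_le]
  rintro _ ⟨i, rfl⟩
  refine Submodule.subset_span ?_
  by_cases hi : i = 0
  · simp [hi]
  · exact Or.inr ⟨i, by simp [hi]⟩

theorem orthogonal_le_of_basePlus_le [NeZero n] {X : Submodule ℂ (Fin (n + n) → ℂ)}
    (h : basePlus n ≤ X) : (bilinQ n).orthogonal X ≤ X := by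
  intro x hx
  refine h (mem_basePlus.mpr ?_)
  ext i
  have h1 := hx (stdVec n (Fin.natAdd n i)) (h (Submodule.subset_span ⟨i, rfl⟩))
  rw [bilinQ_stdVec_natAdd] at h1
  simpa [wPart, LinearMap.funLeft_apply, -Fin.natAdd_eq_addNat] using h1

/-- The image of the base point `(X_0, 1, e_1)` under an element of the spin group. -/
noncomputable def translateBase [NeZero n] (hX : Module.finrank ℂ (baseX n) = n + 1) (g : Cl n)
    (hg : g ∈ spinGroup (quadQ n)) : DecOG n where
  X := (baseX n).map (rho n g)
  finrank_eq := by rw [finrank_map_rho hg, hX]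
  coisotropic := by
    intro x hx
    refine ⟨rho n (star g) x, orthogonal_le_of_basePlus_le (basePlus_le_baseX n) fun y hy => ?_,
      rho_rho_star hg x⟩
    have h1 := hx _ ⟨y, hy, rfl⟩
    rwa [← bilinQ_rho hg, rho_rho_star hg]
  sPlus := spinRep n g 1
  sMinus := spinRep n g (spinE1 n)
  mem_plus := ⟨_, Submodule.map_mono (basePlus_le_baseX n), g, hg, rfl, 1, (one_smul _ _).symm⟩
  mem_minus := ⟨_, Submodule.map_mono (baseMinus_le_baseX n), g, hg, rfl, 1, (one_smul _ _).symm⟩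

/-- Uniqueness of `η`: its values are determined by the one at the base point. -/
theorem IsEta.eq_eta [NeZero n] {η : DecOG n → DecGr (n + 1) (n + n)} (hη : IsEta η) :
    η = eta n := by
  funext x
  obtain ⟨g, a, b, hx⟩ := exists_isTranslate x
  have hX : Module.finrank ℂ (baseX n) = n + 1 := by
    rw [← finrank_map_rho hx.mem, ← hx.X_eq, x.finrank_eq]
  refine DecGr.ext (hη.X_eq x) ?_
  rw [hx.eta_v, hη.homogeneous a b (translateBase hX g hx.mem) x hx.X_eq hx.sPlus_eq
    hx.sMinus_eq]
  have h1 := hη.base (translateBase hX 1 (one_mem _)) (map_rho_one _)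
    (spinRep_one 1)
    (spinRep_one _)
  rw [hη.equivariant g hx.mem (translateBase hX 1 (one_mem _)) (translateBase hX g hx.mem), h1]
  · rfl
  · change _ = ((baseX n).map (rho n 1)).map (rho n g)
    rw [map_rho_one]
    rfl
  · change _ = spinRep n g (spinRep n 1 1)
    rw [spinRep_one]
    rfl
  · change _ = spinRep n g (spinRep n 1 _)
    rw [spinRep_one]
    rfl

/-- A set `I` of `n + 1` indices with `#(J ∩ J^∨) = 1` has the form `J = K ∪ {i}`,
`J^∨ = [n] \ K`. -/
theorem eq_crossIndex {I : Finset (Fin (n + n))} (hI : I.card = n + 1)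
    (h : (lowPart I ∩ highPart I).card = 1) :
    ∃ i ∉ Finset.univ \ highPart I, lowPart I = insert i (Finset.univ \ highPart I) ∧
      I = crossIndex (Finset.univ \ highPart I) i := by
  obtain ⟨i, hi⟩ := Finset.card_eq_one.mp h
  have hi' : i ∈ lowPart I ∩ highPart I := hi ▸ Finset.mem_singleton_self i
  rw [Finset.mem_inter] at hi'
  have h1 : lowPart I ⊆ insert i (Finset.univ \ highPart I) := by
    intro j hj
    by_cases hj' : j ∈ highPart I
    · have : j ∈ lowPart I ∩ highPart I := Finset.mem_inter.mpr ⟨hj, hj'⟩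
      rw [hi] at this
      exact Finset.mem_insert.mpr (Or.inl (Finset.mem_singleton.mp this))
    · simp [hj']
  have hni : i ∉ Finset.univ \ highPart I := by simp [hi'.2]
  have h2 : (lowPart I).card + (highPart I).card = n + 1 := by
    rw [card_lowPart_add_card_highPart, hI]
  have h3 : (Finset.univ \ highPart I).card + (highPart I).card = n := by
    rw [Finset.card_sdiff_add_card_eq_card (Finset.subset_univ _), Finset.card_univ,
      Fintype.card_fin]
  have h4 : lowPart I = insert i (Finset.univ \ highPart I) :=
    Finset.eq_of_subset_of_card_le h1 (by rw [Finset.card_insert_of_notMem hni]; omega)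
  refine ⟨i, hni, h4, ?_⟩
  conv_lhs => rw [← pairIndex_lowPart_highPart I]
  rw [crossIndex, ← h4]
  congr 1
  ext j
  simp

/-- The Plücker coordinates of `η` that are products of two Cartan coordinates. -/
theorem plucker_eta [NeZero n] (x : DecOG n) (I : Set.powersetCard (Fin (n + n)) (n + 1))
    (h : (lowPart I.1 ∩ highPart I.1).card = 1) :
    (eta n x).plucker I =
      x.cartan (lowPart I.1) * x.cartan (Finset.univ \ highPart I.1) := by
  obtain ⟨I, hI⟩ := I
  obtain ⟨i, hi, hlow, hIeq⟩ := eq_crossIndex hI h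
  obtain ⟨g, a, b, hx⟩ := exists_isTranslate x
  change _ = x.cartan (lowPart I) * x.cartan (Finset.univ \ highPart I)
  rw [hlow]
  generalize Finset.univ \ highPart I = K at hi hIeq
  subst hIeq
  have h1 := repr_map_rho_baseVec hx.mem hi hI
  have h2 : Even (insert i K).card ↔ ¬ Even K.card := by
    rw [Finset.card_insert_of_notMem hi, Nat.even_add_one]
  rw [DecGr.plucker, hx.eta_v, map_smul, Finsupp.smul_apply, h1, DecOG.cartan, DecOG.cartan]
  simp only [h2, Module.Basis.coord_apply, smul_eq_mul, hx.sPlus_eq, hx.sMinus_eq]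
  by_cases hK : Even K.card
  · simp only [hK, if_true, not_true, if_false, map_smul, Finsupp.smul_apply, smul_eq_mul]
    ring
  · simp only [hK, if_true, not_false_eq_true, if_false, map_smul, Finsupp.smul_apply, smul_eq_mul]
    ring

end ElecOG

/-! ### Plücker relations -/

namespace ElecOG

section

variable {R M ι : Type*} [CommRing R] [AddCommGroup M] [Module R M] [LinearOrder ι]
  (b : Module.Basis ι R M)

theorem coord_contr {k : ι} {I : Finset ι} (hk : k ∉ I) (x : ExteriorAlgebra R M) :
    b.ExteriorAlgebra.coord I (contr (b.coord k) x) =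
      (-1) ^ (I.filter (· < k)).card * b.ExteriorAlgebra.coord (insert k I) x := by
  suffices h : b.ExteriorAlgebra.coord I ∘ₗ contr (b.coord k) =
      ((-1 : R) ^ (I.filter (· < k)).card) • b.ExteriorAlgebra.coord (insert k I) from
    LinearMap.congr_fun h x
  refine b.ExteriorAlgebra.ext fun S => ?_
  by_cases hS : k ∈ S
  · obtain ⟨S, hkS, rfl⟩ : ∃ S', k ∉ S' ∧ S = insert k S' :=
      ⟨S.erase k, Finset.notMem_erase k S, (Finset.insert_erase hS).symm⟩
    by_cases h : S = I
    · subst h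
      simp [contr_basisExterior b hkS]
    · have h2 : insert k S ≠ insert k I := fun h3 => h (by
        rw [← Finset.erase_insert hkS, h3, Finset.erase_insert hk])
      simp [contr_basisExterior b hkS, h, h2]
  · have h2 : S ≠ insert k I := fun h => hS (h ▸ Finset.mem_insert_self k I)
    simp [contr_basisExterior_notMem b hS, h2]

theorem coord_insert_ι_mul {k : ι} {I : Finset ι} (hk : k ∉ I) (x : ExteriorAlgebra R M) :
    b.ExteriorAlgebra.coord (insert k I) (ExteriorAlgebra.ι R (b k) * x) =
      (-1) ^ (I.filter (· < k)).card * b.ExteriorAlgebra.coord I x := by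
  suffices h : b.ExteriorAlgebra.coord (insert k I) ∘ₗ
      LinearMap.mulLeft R (ExteriorAlgebra.ι R (b k)) =
      ((-1 : R) ^ (I.filter (· < k)).card) • b.ExteriorAlgebra.coord I from
    LinearMap.congr_fun h x
  refine b.ExteriorAlgebra.ext fun S => ?_
  by_cases hS : k ∈ S
  · have h : S ≠ I := by rintro rfl; exact hk hS
    simp [ι_mul_basisExterior_mem b hS, h]
  · by_cases h : S = I
    · subst h
      simp [ι_mul_basisExterior b hS]
    · have h2 : insert k S ≠ insert k I := fun h3 => h (by
        rw [← Finset.erase_insert hS, h3, Finset.erase_insert hk])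
      simp [ι_mul_basisExterior b hS, h, h2]

theorem contr_map {N : Type*} [AddCommGroup N] [Module R N] (f : M →ₗ[R] N) (φ : Module.Dual R N)
    (x : ExteriorAlgebra R M) :
    contr φ (ExteriorAlgebra.map f x) = ExteriorAlgebra.map f (contr (φ ∘ₗ f) x) := by
  induction x using exterior_left_induction with
  | one => rw [map_one, contr_one, contr_one, map_zero]
  | smul r x h => simp only [map_smul, h]
  | add x y h h' => simp only [map_add, h, h']
  | ι_mul x m h =>
    rw [map_mul, ExteriorAlgebra.map_apply_ι, contr_ι_mul, contr_ι_mul, h, map_sub, map_smul,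
      map_mul, ExteriorAlgebra.map_apply_ι, LinearMap.comp_apply]

end

section

variable {V ι : Type*} [AddCommGroup V] [Module ℂ V] [LinearOrder ι] [Fintype ι]
  (b : Module.Basis ι ℂ V) {k : ℕ} {X : Submodule ℂ V} {v : ⋀[ℂ]^k V}

theorem ι_mul_eq_zero_of_mem [FiniteDimensional ℂ X] (hX : Module.finrank ℂ X = k)
    (hv : v ∈ LinearMap.range (exteriorPower.map k X.subtype)) {y : V} (hy : y ∈ X) :
    ExteriorAlgebra.ι ℂ y * (v : ExteriorAlgebra ℂ V) = 0 := by
  obtain ⟨v, rfl⟩ := hv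
  have h1 : Module.finrank ℂ (⋀[ℂ]^(k + 1) X) = 0 := by
    rw [exteriorPower.finrank_eq, hX, Nat.choose_succ_self]
  have h2 : ExteriorAlgebra.ι ℂ (⟨y, hy⟩ : X) * (v : ExteriorAlgebra ℂ X) ∈ ⋀[ℂ]^(k + 1) X := by
    rw [ExteriorAlgebra.exteriorPower, pow_succ']
    exact Submodule.mul_mem_mul ⟨_, rfl⟩ v.2
  have h3 : (⟨_, h2⟩ : ⋀[ℂ]^(k + 1) X) = 0 :=
    (Module.finrank_zero_iff.mp h1).elim _ _
  rw [coe_exteriorPower_map, show y = X.subtype ⟨y, hy⟩ from rfl, ← ExteriorAlgebra.map_apply_ι,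
    ← map_mul]
  exact (congrArg _ (congrArg Subtype.val h3)).trans (map_zero _)

theorem contr_eq_zero_of_le_ker (hv : v ∈ LinearMap.range (exteriorPower.map k X.subtype))
    {φ : Module.Dual ℂ V} (hφ : ∀ y ∈ X, φ y = 0) : contr φ (v : ExteriorAlgebra ℂ V) = 0 := by
  obtain ⟨v, rfl⟩ := hv
  have h : φ ∘ₗ X.subtype = 0 := LinearMap.ext fun y => hφ y y.2
  rw [coe_exteriorPower_map, contr_map, h, contr_zero, LinearMap.zero_apply, map_zero]

/-- The Plücker relations: the vector with coordinates `± Δ_{T ∪ e}` belongs to `X`, since it is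
annihilated by every functional that vanishes on `X`. -/
theorem sum_coord_contr_mul_coord [FiniteDimensional ℂ X] (hX : Module.finrank ℂ X = k)
    (hv : v ∈ LinearMap.range (exteriorPower.map k X.subtype)) (T U : Finset ι) :
    ∑ e, b.ExteriorAlgebra.coord T (contr (b.coord e) v) *
      b.ExteriorAlgebra.coord U (ExteriorAlgebra.ι ℂ (b e) * v) = 0 := by
  have hy : ∑ e, b.ExteriorAlgebra.coord T (contr (b.coord e) v) • b e ∈ X := by
    by_contra hy
    obtain ⟨φ, hφ, hX⟩ := Submodule.exists_le_ker_of_notMem hy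
    refine hφ ?_
    have h1 := contr_eq_zero_of_le_ker hv (φ := φ) fun y hy => hX hy
    rw [← b.sum_dual_apply_smul_coord φ] at h1
    have h2 : contr (∑ e, φ (b e) • b.coord e) = ∑ e, φ (b e) • contr (b.coord e) := by
      change CliffordAlgebra.contractLeft _ = _
      rw [map_sum]
      exact Finset.sum_congr rfl fun e _ => contr_smul _ _
    have h3 := congrArg (b.ExteriorAlgebra.coord T) (h2 ▸ h1)
    rw [LinearMap.sum_apply, map_sum, map_zero] at h3
    rw [map_sum, ← h3]
    refine Finset.sum_congr rfl fun e _ => ?_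
    rw [map_smul, LinearMap.smul_apply, map_smul, smul_eq_mul, smul_eq_mul, mul_comm]
  have h := congrArg (b.ExteriorAlgebra.coord U) (ι_mul_eq_zero_of_mem hX hv hy)
  rw [map_sum, Finset.sum_mul, map_sum, map_zero] at h
  rw [← h]
  refine Finset.sum_congr rfl fun e _ => ?_
  rw [map_smul, smul_mul_assoc, map_smul, smul_eq_mul]

/-- The three-term Plücker relation. -/
theorem plucker_three_term [FiniteDimensional ℂ X] (hX : Module.finrank ℂ X = k)
    (hv : v ∈ LinearMap.range (exteriorPower.map k X.subtype)) {S : Finset ι} {p q r s : ι}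
    (hpq : p < q) (hqr : q < r) (hrs : r < s) (hp : p ∉ S) (hq : q ∉ S) (hr : r ∉ S) (hs : s ∉ S) :
    b.ExteriorAlgebra.coord (insert p (insert r S)) v *
        b.ExteriorAlgebra.coord (insert q (insert s S)) v =
      b.ExteriorAlgebra.coord (insert p (insert q S)) v *
          b.ExteriorAlgebra.coord (insert r (insert s S)) v +
        b.ExteriorAlgebra.coord (insert p (insert s S)) v *
          b.ExteriorAlgebra.coord (insert q (insert r S)) v := by
  have hpr := hpq.trans hqr
  have hqs := hqr.trans hrs
  have hps := hpr.trans hrs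
  set U := insert q (insert r (insert s S)) with hUdef
  have hterm : ∀ e f g : ι, U = insert e (insert f (insert g S)) → p < e → e ≠ f → e ≠ g → f ≠ g →
      e ∉ S → f ∉ S → g ∉ S →
      b.ExteriorAlgebra.coord (insert p S) (contr (b.coord e) v) *
        b.ExteriorAlgebra.coord U (ExteriorAlgebra.ι ℂ (b e) * v) =
      -((if f < e then -1 else 1) * (if g < e then -1 else 1)) *
        (b.ExteriorAlgebra.coord (insert p (insert e S)) v *
          b.ExteriorAlgebra.coord (insert f (insert g S)) v) := by
    intro e f g hU hpe hef heg hfg he hf hg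
    have hi : ∀ (x : ι) (A : Finset ι), x ∉ A →
        (-1 : ℂ) ^ ((insert x A).filter (· < e)).card =
          (if x < e then -1 else 1) * (-1) ^ (A.filter (· < e)).card := by
      intro x A hx
      rw [Finset.filter_insert]
      split_ifs
      · rw [Finset.card_insert_of_notMem (by simp [hx]), pow_succ, mul_comm]
      · rw [one_mul]
    have hsq : (-1 : ℂ) ^ (S.filter (· < e)).card * (-1) ^ (S.filter (· < e)).card = 1 := by
      rw [← mul_pow, neg_one_mul, neg_neg, one_pow]
    rw [hU, coord_contr b (by simp [hpe.ne', he]), Finset.insert_comm e p,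
      coord_insert_ι_mul b (by simp [hef, heg, he]), hi p S hp, hi f _ (by simp [hfg, hf]),
      hi g S hg, if_pos hpe]
    linear_combination (-((if f < e then -1 else 1) * (if g < e then -1 else 1)) *
        (b.ExteriorAlgebra.coord (insert p (insert e S)) v *
          b.ExteriorAlgebra.coord (insert f (insert g S)) v)) * hsq
  have h := sum_coord_contr_mul_coord b hX hv (insert p S) U
  rw [← Finset.sum_subset (Finset.subset_univ {q, r, s}), Finset.sum_insert (by
    simp [hqr.ne, hqs.ne]), Finset.sum_insert (by simp [hrs.ne]), Finset.sum_singleton,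
    hterm q r s rfl hpq hqr.ne hqs.ne hrs.ne hq hr hs,
    hterm r q s (Finset.insert_comm _ _ _) hpr hqr.ne' hrs.ne hqs.ne hr hq hs,
    hterm s q r (by rw [hUdef, Finset.insert_comm r s, Finset.insert_comm q s])
      hps hqs.ne' hrs.ne' hqr.ne hs hq hr] at h
  · simp only [hqr, hqs, hrs, hqr.not_gt, hqs.not_gt, hrs.not_gt, if_true, if_false] at h
    linear_combination h
  · intro e _ he
    simp only [Finset.mem_insert, Finset.mem_singleton, not_or] at he
    by_cases heS : e ∈ insert p S
    · rw [coord_contr_eq_zero b heS, zero_mul]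
    · simp only [Finset.mem_insert, not_or] at heS
      rw [coord_ι_mul_eq_zero b (by simp [hUdef, he, heS]), mul_zero]

end

end ElecOG

/-! ### Positivity -/

namespace ElecOG

open scoped ComplexOrder

variable {n : ℕ}

theorem pos_of_mul_eq_add_mul {z a b c d e : ℂ} (h : z * a = b * c + d * e) (ha : 0 < a)
    (hb : 0 < b) (hc : 0 < c) (hd : 0 < d) (he : 0 < e) : 0 < z := by
  have h1 : 0 < z * a := h ▸ add_pos (mul_pos hb hc) (mul_pos hd he)
  rw [Complex.pos_iff] at ha h1 ⊢
  have h2 : a = (a.re : ℂ) := Complex.ext rfl (by simp [← ha.2])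
  rw [h2, Complex.re_mul_ofReal, Complex.im_mul_ofReal] at h1
  exact ⟨pos_of_mul_pos_left h1.1 ha.1.le,
    ((mul_eq_zero.mp h1.2.symm).resolve_right ha.1.ne').symm⟩

theorem mem_lowPart {I : Finset (Fin (n + n))} {k : Fin n} :
    k ∈ lowPart I ↔ Fin.castAdd n k ∈ I := by simp [lowPart]

theorem mem_highPart {I : Finset (Fin (n + n))} {k : Fin n} :
    k ∈ highPart I ↔ Fin.natAdd n k ∈ I := by simp [highPart, -Fin.natAdd_eq_addNat]

/-- The three-term relations used for positivity: for two indices `i`, `p` with both `e_i`, `e_{n+i}`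
and both `e_p`, `e_{n+p}` in `I`, and an index `j` with neither, some `x` over `i` and `y` over `p`
are separated by `j` and `n + j`. -/
theorem exists_plucker_relation [NeZero n] (y : DecGr (n + 1) (n + n)) {I : Finset (Fin (n + n))}
    {i p j : Fin n} (hij : i ≠ j) (hpj : p ≠ j) (hp : Fin.castAdd n p ∈ I) (hp' : Fin.natAdd n p ∈ I)
    (hj : Fin.castAdd n j ∉ I) (hj' : Fin.natAdd n j ∉ I) :
    ∃ s t : Fin (n + n), (s = Fin.castAdd n i ∨ s = Fin.natAdd n i) ∧
      (t = Fin.castAdd n p ∨ t = Fin.natAdd n p) ∧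
      let S := (I.erase s).erase t
      let D := fun a b => (extBasis n).coord (insert a (insert b S)) y.v
      D s t * D (Fin.castAdd n j) (Fin.natAdd n j) =
        D s (Fin.castAdd n j) * D t (Fin.natAdd n j) +
          D s (Fin.natAdd n j) * D t (Fin.castAdd n j) := by
  have h1 : ∀ t, p < j ∧ t = Fin.natAdd n p ∨ j < p ∧ t = Fin.castAdd n p →
      Fin.castAdd n j < t ∧ t < Fin.natAdd n j := by
    rintro t (⟨h, rfl⟩ | ⟨h, rfl⟩)
    · simp only [Fin.lt_def, Fin.val_castAdd, Fin.val_natAdd] at h ⊢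
      omega
    · simp only [Fin.lt_def, Fin.val_castAdd, Fin.val_natAdd] at h ⊢
      omega
  obtain ⟨t, ht⟩ : ∃ t, p < j ∧ t = Fin.natAdd n p ∨ j < p ∧ t = Fin.castAdd n p := by
    rcases hpj.lt_or_gt with h | h
    · exact ⟨_, Or.inl ⟨h, rfl⟩⟩
    · exact ⟨_, Or.inr ⟨h, rfl⟩⟩
  obtain ⟨ht1, ht2⟩ := h1 t ht
  have htI : t ∈ I := by rcases ht with ⟨-, rfl⟩ | ⟨-, rfl⟩ <;> assumption
  have hjS : ∀ s, Fin.castAdd n j ∉ (I.erase s).erase t ∧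
      Fin.natAdd n j ∉ (I.erase s).erase t := fun s =>
    ⟨fun h => hj (Finset.mem_of_mem_erase (Finset.mem_of_mem_erase h)),
      fun h => hj' (Finset.mem_of_mem_erase (Finset.mem_of_mem_erase h))⟩
  have htt : t = Fin.castAdd n p ∨ t = Fin.natAdd n p := by
    rcases ht with ⟨-, rfl⟩ | ⟨-, rfl⟩ <;> simp
  rcases hij.lt_or_gt with h | h
  · refine ⟨Fin.castAdd n i, t, Or.inl rfl, htt, ?_⟩
    have hs : Fin.castAdd n i < Fin.castAdd n j := h
    have := plucker_three_term (Pi.basisFun ℂ (Fin (n + n))) y.finrank_eq y.v_mem hs ht1 ht2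
      (S := (I.erase (Fin.castAdd n i)).erase t) (by simp) (hjS _).1 (by simp) (hjS _).2
    rwa [Finset.insert_comm (Fin.castAdd n j) t] at this
  · refine ⟨Fin.natAdd n i, t, Or.inr rfl, htt, ?_⟩
    have hs : Fin.natAdd n j < Fin.natAdd n i := by
      simp only [Fin.lt_def, Fin.val_natAdd] at h ⊢
      omega
    have := plucker_three_term (Pi.basisFun ℂ (Fin (n + n))) y.finrank_eq y.v_mem ht1 ht2 hs
      (S := (I.erase (Fin.natAdd n i)).erase t) (hjS _).1 (by simp) (hjS _).2 (by simp)
    simp only [Finset.insert_comm _ (Fin.natAdd n i), Finset.insert_comm (Fin.castAdd n j) t] at this ⊢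
    linear_combination this

theorem exists_card_inter_eq {I : Finset (Fin (n + n))} {m : ℕ} (hI : I.card = n + 1)
    (h : (lowPart I ∩ highPart I).card = m + 2) :
    ∃ i p j : Fin n, i ≠ j ∧ p ≠ j ∧ i ≠ p ∧ Fin.castAdd n i ∈ I ∧ Fin.natAdd n i ∈ I ∧
      Fin.castAdd n p ∈ I ∧ Fin.natAdd n p ∈ I ∧ Fin.castAdd n j ∉ I ∧ Fin.natAdd n j ∉ I := by
  obtain ⟨i, hi, p, hp, hip⟩ := Finset.one_lt_card.mp (by omega : 1 < (lowPart I ∩ highPart I).card)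
  have h1 := Finset.card_union_add_card_inter (lowPart I) (highPart I)
  have h2 : (lowPart I).card + (highPart I).card = n + 1 := by
    rw [card_lowPart_add_card_highPart, hI]
  have h3 : ∃ j, j ∉ lowPart I ∪ highPart I := by
    by_contra! h3
    have : (lowPart I ∪ highPart I) = Finset.univ := Finset.eq_univ_iff_forall.mpr h3
    rw [this, Finset.card_univ, Fintype.card_fin] at h1
    omega
  obtain ⟨j, hj⟩ := h3
  simp only [Finset.mem_inter, Finset.mem_union, not_or, mem_lowPart, mem_highPart] at hi hp hj
  refine ⟨i, p, j, ?_, ?_, hip, hi.1, hi.2, hp.1, hp.2, hj.1, hj.2⟩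
  · rintro rfl; exact hj.1 hi.1
  · rintro rfl; exact hj.1 hp.1

/-- All index sets in `exists_plucker_relation` other than `I` contain one pair `k`, `n + k` less. -/
theorem card_inter_insert_insert {I : Finset (Fin (n + n))} {m : ℕ}
    (h : (lowPart I ∩ highPart I).card = m + 2) {i p j : Fin n} (hij : i ≠ j)
    (hpj : p ≠ j) (hip : i ≠ p) (hi : Fin.castAdd n i ∈ I)
    (hi' : Fin.natAdd n i ∈ I) (hp : Fin.castAdd n p ∈ I) (hp' : Fin.natAdd n p ∈ I)
    (hj : Fin.castAdd n j ∉ I) (hj' : Fin.natAdd n j ∉ I) {s t : Fin (n + n)}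
    (hs : s = Fin.castAdd n i ∨ s = Fin.natAdd n i)
    (ht : t = Fin.castAdd n p ∨ t = Fin.natAdd n p) :
    let S := (I.erase s).erase t
    let m' := fun a b => (lowPart (insert a (insert b S)) ∩ highPart (insert a (insert b S))).card
    m' s (Fin.castAdd n j) = m + 1 ∧ m' s (Fin.natAdd n j) = m + 1 ∧
      m' t (Fin.castAdd n j) = m + 1 ∧ m' t (Fin.natAdd n j) = m + 1 ∧
      m' (Fin.castAdd n j) (Fin.natAdd n j) = m + 1 := by
  intro S m'
  set E := lowPart I ∩ highPart I with hE
  have hmem : ∀ k, k ∈ E ↔ Fin.castAdd n k ∈ I ∧ Fin.natAdd n k ∈ I := fun k => by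
    rw [hE, Finset.mem_inter, mem_lowPart, mem_highPart]
  have hiE : i ∈ E := (hmem i).mpr ⟨hi, hi'⟩
  have hpE : p ∈ E := (hmem p).mpr ⟨hp, hp'⟩
  have hjE : j ∉ E := fun h => hj ((hmem j).mp h).1
  have e1 : (E.erase p).card = m + 1 := by rw [Finset.card_erase_of_mem hpE, h]; rfl
  have e2 : (E.erase i).card = m + 1 := by rw [Finset.card_erase_of_mem hiE, h]; rfl
  have e3 : (insert j ((E.erase i).erase p)).card = m + 1 := by
    rw [Finset.card_insert_of_notMem (by simp [hjE]),
      Finset.card_erase_of_mem (by simp [hip.symm, hpE]), e2]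
    rfl
  have hne : ∀ a b : Fin n, Fin.natAdd n a ≠ Fin.castAdd n b := fun a b =>
    (castAdd_ne_natAdd b a).symm
  have hcc : ∀ a b : Fin n, Fin.castAdd n a = Fin.castAdd n b ↔ a = b := fun a b =>
    (Fin.castAdd_injective n n).eq_iff
  have hnn : ∀ a b : Fin n, Fin.natAdd n a = Fin.natAdd n b ↔ a = b := fun a b =>
    (Fin.natAdd_injective n n).eq_iff
  have hcn : ∀ a b : Fin n, Fin.castAdd n a ≠ Fin.natAdd n b := castAdd_ne_natAdd
  refine ⟨e1 ▸ congrArg Finset.card ?_, e1 ▸ congrArg Finset.card ?_,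
    e2 ▸ congrArg Finset.card ?_, e2 ▸ congrArg Finset.card ?_, e3 ▸ congrArg Finset.card ?_⟩ <;>
  · ext k
    rcases hs with rfl | rfl <;> rcases ht with rfl | rfl <;>
    · simp only [S, Finset.mem_inter, mem_lowPart, mem_highPart, Finset.mem_insert,
        Finset.mem_erase, ne_eq, hcc, hnn, hne, hcn, hmem]
      grind

/-- `η` preserves positivity, by induction on the number of pairs `k`, `n + k` contained in `I`. -/
theorem eta_isPos [NeZero n] (x : DecOG n) (hx : x.IsPos) : (eta n x).IsPos := by
  suffices H : ∀ (m : ℕ) (I : Finset (Fin (n + n))), I.card = n + 1 →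
      (lowPart I ∩ highPart I).card = m + 1 → 0 < (extBasis n).coord I (eta n x).v by
    rintro ⟨I, (hI : I.card = n + 1)⟩
    have h1 := Finset.card_union_add_card_inter (lowPart I) (highPart I)
    have h2 : (lowPart I).card + (highPart I).card = n + 1 := by
      rw [card_lowPart_add_card_highPart, hI]
    have h3 := Finset.card_le_univ (lowPart I ∪ highPart I)
    rw [Fintype.card_fin] at h3
    obtain ⟨m, hm⟩ := Nat.exists_eq_add_of_le' (by omega : 1 ≤ (lowPart I ∩ highPart I).card)
    have h4 := H m I hI hm
    rwa [coord_coe_exteriorPower, dif_pos hI] at h4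
  intro m
  induction m with
  | zero =>
    intro I hI h
    have h1 := plucker_eta x ⟨I, hI⟩ h
    rw [coord_coe_exteriorPower, dif_pos hI]
    change 0 < (eta n x).plucker ⟨I, hI⟩
    rw [h1]
    exact mul_pos (hx _) (hx _)
  | succ m ih =>
    intro I hI h
    obtain ⟨i, p, j, hij, hpj, hip, hi, hi', hp, hp', hj, hj'⟩ := exists_card_inter_eq hI h
    obtain ⟨s, t, hs, ht, hrel⟩ :=
      exists_plucker_relation (eta n x) hij hpj hp hp' hj hj'
    obtain ⟨h1, h2, h3, h4, h5⟩ :=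
      card_inter_insert_insert h hij hpj hip hi hi' hp hp' hj hj' hs ht
    have hsI : s ∈ I := by rcases hs with rfl | rfl <;> assumption
    have htI : t ∈ I := by rcases ht with rfl | rfl <;> assumption
    have hst : t ≠ s := by
      rcases hs with rfl | rfl <;> rcases ht with rfl | rfl
      · exact fun h => hip ((Fin.castAdd_injective n n) h).symm
      · exact (castAdd_ne_natAdd _ _).symm
      · exact castAdd_ne_natAdd _ _
      · exact fun h => hip ((Fin.natAdd_injective n n) h).symm
    have htI' : t ∈ I.erase s := Finset.mem_erase.mpr ⟨hst, htI⟩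
    have hS : ∀ a b, a ≠ b → a ∉ (I.erase s).erase t → b ∉ (I.erase s).erase t →
        (insert a (insert b ((I.erase s).erase t))).card = n + 1 := by
      intro a b hab ha hb
      rw [Finset.card_insert_of_notMem (by simp [hab, ha]), Finset.card_insert_of_notMem hb,
        Finset.card_erase_of_mem htI', Finset.card_erase_of_mem hsI, hI]
      have : 0 < (I.erase s).card := Finset.card_pos.mpr ⟨t, htI'⟩
      rw [Finset.card_erase_of_mem hsI, hI] at this
      omega
    have hsS : s ∉ (I.erase s).erase t := by simp
    have htS : t ∉ (I.erase s).erase t := by simp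
    have hjS : Fin.castAdd n j ∉ (I.erase s).erase t := fun h =>
      hj (Finset.mem_of_mem_erase (Finset.mem_of_mem_erase h))
    have hjS' : Fin.natAdd n j ∉ (I.erase s).erase t := fun h =>
      hj' (Finset.mem_of_mem_erase (Finset.mem_of_mem_erase h))
    have hIeq : insert s (insert t ((I.erase s).erase t)) = I := by
      rw [Finset.insert_erase htI', Finset.insert_erase hsI]
    simp only [hIeq] at hrel
    refine pos_of_mul_eq_add_mul hrel (ih _ (hS _ _ (castAdd_ne_natAdd _ _) hjS hjS') h5)
      (ih _ (hS _ _ (fun h => hj (h ▸ hsI)) hsS hjS) h1)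
      (ih _ (hS _ _ (fun h => hj' (h ▸ htI)) htS hjS') h4)
      (ih _ (hS _ _ (fun h => hj' (h ▸ hsI)) hsS hjS') h2)
      (ih _ (hS _ _ (fun h => hj (h ▸ htI)) htS hjS) h3)

end ElecOG

/-! ### Medial strands -/

namespace ElecOG

/-- The index `j ± n` in `[2n]`. -/
def opp {n : ℕ} (j : Fin (n + n)) : Fin (n + n) :=
  ⟨if (j : ℕ) < n then j + n else j - n, by split_ifs <;> omega⟩

theorem opp_castAdd {n : ℕ} (i : Fin n) : opp (Fin.castAdd n i) = Fin.natAdd n i :=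
  Fin.ext (by simp [opp, add_comm])

theorem opp_natAdd {n : ℕ} (i : Fin n) : opp (Fin.natAdd n i) = Fin.castAdd n i :=
  Fin.ext (by simp [opp])

theorem opp_ne {n : ℕ} (j : Fin (n + n)) : opp j ≠ j := by
  intro h
  have h1 := congrArg Fin.val h
  simp only [opp] at h1
  split_ifs at h1 <;> omega

namespace DiskMap

variable {n : ℕ} (G : DiskMap n)

/-- The corner at `d` lies in the outer face. -/
def IsOuter (d : G.Dart) : Prop := ∃ i, d = G.flip (G.bdry i)

theorem exists_cyc_eq (i : Fin n) : ∃ k, cyc k = i := cyc_surjective i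

theorem rot_symm_bdry_cyc (i : Fin n) : G.rot.symm (G.bdry (cyc i)) = G.flip (G.bdry i) := by
  rw [Equiv.symm_apply_eq, G.rot_flip_bdry]

theorem not_isOuter_of_inner {x : G.Dart} (hx : G.Inner x) : ¬ G.IsOuter x := fun ⟨i, hi⟩ =>
  (hx i).2 hi

theorem not_isOuter_bdry (i : Fin n) : ¬ G.IsOuter (G.bdry i) := fun ⟨j, hj⟩ =>
  G.bdry_ne_flip i j hj

theorem inner_flip_iff {x : G.Dart} : G.Inner (G.flip x) ↔ G.Inner x :=
  ⟨fun h => by simpa [G.flip_flip] using G.inner_flip h, G.inner_flip⟩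

/-- A corner that ends at an inner dart, or at an arc in the direction of the outer face, is not in
the outer face. -/
theorem not_isOuter_rot_symm {x : G.Dart} (h : ∀ i, x ≠ G.bdry i) : ¬ G.IsOuter (G.rot.symm x) := by
  rintro ⟨i, hi⟩
  rw [Equiv.symm_apply_eq, G.rot_flip_bdry] at hi
  exact h _ hi

theorem isOuter_rot_symm_bdry (i : Fin n) : G.IsOuter (G.rot.symm (G.bdry i)) := by
  obtain ⟨k, rfl⟩ := exists_cyc_eq i
  exact ⟨k, G.rot_symm_bdry_cyc k⟩

/-- An edge of the medial graph with the opposite direction. -/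
def medialRev (a : G.Dart × Bool) : G.Dart × Bool := (a.1, !a.2)

theorem medialRev_medialRev (a : G.Dart × Bool) : G.medialRev (G.medialRev a) = a := by
  simp [medialRev]

theorem medialHead_medialRev_medialNext (a : G.Dart × Bool) :
    G.medialHead (G.medialRev (G.medialNext a)) = G.flip (G.medialHead a) := by
  obtain ⟨d, b⟩ := a
  cases b <;> simp [medialHead, medialRev, medialNext]

theorem medialNext_medialRev_medialNext (a : G.Dart × Bool) :
    G.medialNext (G.medialRev (G.medialNext a)) = G.medialRev a := by
  obtain ⟨d, b⟩ := a
  cases b <;> simp [medialRev, medialNext, G.flip_flip]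

theorem medialNext_injective : Function.Injective G.medialNext := by
  intro a b h
  have h1 := G.medialNext_medialRev_medialNext a
  rw [h, G.medialNext_medialRev_medialNext] at h1
  rw [← G.medialRev_medialRev a, ← h1, G.medialRev_medialRev]

theorem medialEnd_eq (j : Fin (n + n)) : G.medialEnd j = G.medialRev (G.medialStart j) := by
  rcases Nat.mod_two_eq_zero_or_one (j : ℕ) with h | h <;>
    simp [medialEnd, medialStart, medialRev, h]

theorem not_inner_medialHead_medialEnd (j : Fin (n + n)) :
    ¬ G.Inner (G.medialHead (G.medialEnd j)) := by
  rcases Nat.mod_two_eq_zero_or_one (j : ℕ) with h | h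
  · obtain ⟨k, hk⟩ := exists_cyc_eq (half j)
    simp only [medialHead, medialEnd, medialCorner, h, if_true, decide_true, Equiv.apply_symm_apply,
      zero_ne_one, if_false]
    rw [← hk, G.rot_symm_bdry_cyc]
    exact G.not_inner_flip_bdry k
  · simp only [medialHead, medialEnd, medialCorner, h, if_true, one_ne_zero, decide_false]
    exact G.not_inner_bdry _

/-- The first edge of a strand does not continue another edge through an inner midpoint. -/
theorem medialStart_ne_medialNext (j : Fin (n + n)) {a : G.Dart × Bool}
    (ha : G.Inner (G.medialHead a)) : G.medialStart j ≠ G.medialNext a := by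
  intro h
  have h1 := G.not_inner_medialHead_medialEnd j
  rw [medialEnd_eq, h, G.medialHead_medialRev_medialNext] at h1
  exact h1 (G.inner_flip ha)

theorem not_isOuter_medialCorner (j : Fin (n + n)) : ¬ G.IsOuter (G.medialCorner j) := by
  unfold medialCorner
  split_ifs
  · exact G.not_isOuter_bdry _
  · obtain ⟨k, hk⟩ := exists_cyc_eq (half j)
    rw [← hk, G.rot_symm_bdry_cyc]
    exact G.not_isOuter_rot_symm fun i h => G.bdry_ne_flip _ _ h.symm

theorem eq_of_half_eq {j k : Fin (n + n)} (h : half j = half k)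
    (h2 : (j : ℕ) % 2 = 1 ↔ (k : ℕ) % 2 = 1) : j = k := by
  have h3 : (j : ℕ) / 2 = (k : ℕ) / 2 := congrArg Fin.val h
  exact Fin.ext (by omega)

theorem medialStart_injective : Function.Injective G.medialStart := by
  intro j k h
  have h1 : G.medialCorner j = G.medialCorner k := congrArg Prod.fst h
  have h2 : (j : ℕ) % 2 = 1 ↔ (k : ℕ) % 2 = 1 := by
    have := congrArg Prod.snd h
    simpa [medialStart] using this
  refine eq_of_half_eq ?_ h2
  unfold medialCorner at h1
  by_cases h3 : (j : ℕ) % 2 = 1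
  · rw [if_pos h3, if_pos (h2.mp h3)] at h1
    exact G.bdry_injective h1
  · rw [if_neg h3, if_neg (fun h => h3 (h2.mpr h))] at h1
    exact G.bdry_injective (G.rot.symm.injective (G.rot.symm.injective h1))

variable {G}

theorem MedialStrand.eq_start_or {j : Fin (n + n)} {a : G.Dart × Bool} (h : G.MedialStrand j a) :
    a = G.medialStart j ∨
      ∃ b, G.MedialStrand j b ∧ G.Inner (G.medialHead b) ∧ a = G.medialNext b := by
  cases h with
  | start => exact Or.inl rfl
  | next b hb hi => exact Or.inr ⟨b, hb, hi, rfl⟩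

theorem MedialStrand.of_next {j : Fin (n + n)} {a : G.Dart × Bool}
    (h : G.MedialStrand j (G.medialNext a)) (ha : G.Inner (G.medialHead a)) :
    G.MedialStrand j a := by
  rcases h.eq_start_or with h | ⟨b, hb, -, h⟩
  · exact absurd h.symm (G.medialStart_ne_medialNext j ha)
  · rwa [G.medialNext_injective h]

theorem MedialStrand.not_isOuter {j : Fin (n + n)} {a : G.Dart × Bool} (h : G.MedialStrand j a) :
    ¬ G.IsOuter a.1 := by
  rcases h.eq_start_or with rfl | ⟨⟨d, b⟩, -, hi, rfl⟩
  · exact G.not_isOuter_medialCorner j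
  · cases b
    · exact G.not_isOuter_of_inner (G.inner_flip hi)
    · exact G.not_isOuter_rot_symm fun i => (G.inner_flip hi i).1

/-- Two strands that share a directed edge are equal. -/
theorem MedialStrand.index_unique {j k : Fin (n + n)} {a : G.Dart × Bool}
    (h : G.MedialStrand j a) (h' : G.MedialStrand k a) : j = k := by
  induction h with
  | start =>
    rcases h'.eq_start_or with h | ⟨b, -, hb, h⟩
    · exact G.medialStart_injective h
    · exact absurd h (G.medialStart_ne_medialNext j hb)
  | next a _ hi ih => exact ih (h'.of_next hi)

theorem StrandTo.symm {j k : Fin (n + n)} (h : G.StrandTo j k) : G.StrandTo k j := by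
  have H : ∀ a, G.MedialStrand j a → G.MedialStrand k (G.medialRev a) →
      G.MedialStrand k (G.medialRev (G.medialStart j)) := by
    intro a ha
    induction ha with
    | start => exact id
    | next a _ hi ih =>
      intro h1
      refine ih ?_
      rw [← G.medialNext_medialRev_medialNext]
      refine h1.next _ ?_
      rw [G.medialHead_medialRev_medialNext]
      exact G.inner_flip hi
  have h1 := H _ h
  rw [medialEnd_eq, G.medialRev_medialRev] at h1
  rw [StrandTo, medialEnd_eq]
  exact h1 MedialStrand.start

theorem StrandTo.medialRev {j k : Fin (n + n)} (h : G.StrandTo j k) {a : G.Dart × Bool}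
    (ha : G.MedialStrand k a) : G.MedialStrand j (G.medialRev a) := by
  induction ha with
  | start => rw [← medialEnd_eq]; exact h
  | next a _ hi ih =>
    rw [← G.medialNext_medialRev_medialNext] at ih
    refine ih.of_next ?_
    rw [G.medialHead_medialRev_medialNext]
    exact G.inner_flip hi

theorem StrandTo.medialRev_iff {j k : Fin (n + n)} (h : G.StrandTo j k) {a : G.Dart × Bool} :
    G.MedialStrand j (G.medialRev a) ↔ G.MedialStrand k a :=
  ⟨fun ha => by simpa [G.medialRev_medialRev] using h.symm.medialRev ha, h.medialRev⟩

theorem IsWellConnected.strandTo_opp (hG : G.IsWellConnected) (j : Fin (n + n)) :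
    G.StrandTo j (opp j) := by
  have H : ∀ i : Fin n, G.StrandTo (Fin.castAdd n i) (Fin.natAdd n i) := by
    intro i
    have h1 : s(Fin.castAdd n i, Fin.natAdd n i) ∈ G.medialPairing := hG.pairing ▸ ⟨i, rfl⟩
    obtain ⟨j, k, h2, h3⟩ := h1
    rcases Sym2.eq_iff.mp h2 with ⟨rfl, rfl⟩ | ⟨rfl, rfl⟩
    · exact h3
    · exact h3.symm
  refine Fin.addCases (fun i => ?_) (fun i => ?_) j
  · rw [opp_castAdd]; exact H i
  · rw [opp_natAdd]; exact (H i).symm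

theorem IsWellConnected.medialStrand_opp (hG : G.IsWellConnected) {j : Fin (n + n)} {d : G.Dart}
    {b : Bool} : G.MedialStrand (opp j) (d, b) ↔ G.MedialStrand j (d, !b) :=
  (hG.strandTo_opp j).medialRev_iff.symm

/-- The corner `d` lies on the strand starting at `t_j`, in one of the two directions. -/
def OnStrand (G : DiskMap n) (j : Fin (n + n)) (d : G.Dart) : Prop :=
  G.MedialStrand j (d, true) ∨ G.MedialStrand j (d, false)

theorem OnStrand.not_isOuter {j : Fin (n + n)} {d : G.Dart} (h : G.OnStrand j d) :
    ¬ G.IsOuter d := by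
  rcases h with h | h
  · exact h.not_isOuter
  · exact h.not_isOuter

theorem IsWellConnected.onStrand_opp (hG : G.IsWellConnected) {j : Fin (n + n)} {d : G.Dart} :
    G.OnStrand (opp j) d ↔ G.OnStrand j d := by
  unfold OnStrand
  rw [hG.medialStrand_opp, hG.medialStrand_opp, or_comm]
  rfl

/-- Every corner inside the disk lies on exactly one strand, up to its direction. -/
theorem IsWellConnected.exists_onStrand (hG : G.IsWellConnected) {d : G.Dart}
    (hd : ¬ G.IsOuter d) : ∃ j, G.OnStrand j d := by
  obtain ⟨j, b, h⟩ := hG.reduced.no_cycle d fun i hi => hd ⟨i, hi⟩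
  refine ⟨j, ?_⟩
  cases b
  · exact Or.inr h
  · exact Or.inl h

theorem IsWellConnected.onStrand_unique (hG : G.IsWellConnected) {d : G.Dart} {j k : Fin (n + n)}
    (hj : G.OnStrand j d) (hk : G.OnStrand k d) : k = j ∨ k = opp j := by
  rcases hj with hj | hj <;> rcases hk with hk | hk
  · exact Or.inl (hk.index_unique hj)
  · exact Or.inr (hk.index_unique (hG.medialStrand_opp.mpr hj))
  · exact Or.inr (hk.index_unique (hG.medialStrand_opp.mpr hj))
  · exact Or.inl (hk.index_unique hj)

theorem IsWellConnected.not_medialStrand_both (hG : G.IsWellConnected) {j : Fin (n + n)}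
    {d : G.Dart} {b : Bool} (h : G.MedialStrand j (d, b)) : ¬ G.MedialStrand j (d, !b) := fun h' =>
  opp_ne j ((hG.medialStrand_opp.mpr h').index_unique h)

/-- At an inner dart, two edges of the medial graph that continue each other lie on the same
strand. -/
theorem onStrand_flip_iff {j : Fin (n + n)} {x : G.Dart} (hx : G.Inner x) :
    G.OnStrand j (G.flip x) ↔ G.OnStrand j x := by
  have H : ∀ x, G.Inner x → G.MedialStrand j (x, false) → G.MedialStrand j (G.flip x, true) :=
    fun x hx h => h.next _ hx
  have H' : ∀ x, G.Inner x → G.MedialStrand j (x, true) → G.MedialStrand j (G.flip x, false) := by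
    intro x hx h
    refine MedialStrand.of_next (a := (G.flip x, false)) ?_ (G.inner_flip hx)
    simpa [medialNext, G.flip_flip] using h
  have H'' : ∀ x, G.Inner x → G.OnStrand j x → G.OnStrand j (G.flip x) := fun x hx h =>
    h.symm.imp (H x hx) (H' x hx)
  exact ⟨fun h => by simpa [G.flip_flip] using H'' _ (G.inner_flip hx) h, H'' x hx⟩

theorem onStrand_rot_symm_flip_iff {j : Fin (n + n)} {x : G.Dart} (hx : G.Inner x) :
    G.OnStrand j (G.rot.symm (G.flip x)) ↔ G.OnStrand j (G.rot.symm x) := by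
  have H : ∀ x, G.Inner x → G.MedialStrand j (G.rot.symm x, true) →
      G.MedialStrand j (G.rot.symm (G.flip x), false) := by
    intro x hx h
    simpa [medialNext] using h.next _ (by simpa [medialHead] using hx)
  have H' : ∀ x, G.Inner x → G.MedialStrand j (G.rot.symm x, false) →
      G.MedialStrand j (G.rot.symm (G.flip x), true) := by
    intro x hx h
    refine MedialStrand.of_next (a := (G.rot.symm (G.flip x), true)) ?_
      (by simpa [medialHead] using G.inner_flip hx)
    simpa [medialNext, G.flip_flip] using h
  have H'' : ∀ x, G.Inner x → G.OnStrand j (G.rot.symm x) →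
      G.OnStrand j (G.rot.symm (G.flip x)) := fun x hx h => (h.imp (H x hx) (H' x hx)).symm
  exact ⟨fun h => by simpa [G.flip_flip] using H'' _ (G.inner_flip hx) h, H'' x hx⟩

end DiskMap

end ElecOG

/-! ### Exactness of the medial graph over the field with two elements -/

namespace ElecOG

namespace DiskMap

variable {n : ℕ} (G : DiskMap n)

theorem tail_rot (x : G.Dart) : G.tail (G.rot x) = G.tail x :=
  (Quotient.sound (s := Equiv.Perm.SameCycle.setoid G.rot)
    (Equiv.Perm.sameCycle_apply_right.mpr (Equiv.Perm.SameCycle.refl _ x))).symm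

theorem tail_rot_symm (x : G.Dart) : G.tail (G.rot.symm x) = G.tail x := by
  rw [← G.tail_rot, Equiv.apply_symm_apply]

theorem rightFace_rot_symm_flip (x : G.Dart) :
    G.rightFace (G.rot.symm (G.flip x)) = G.rightFace x :=
  (Quotient.sound (s := Equiv.Perm.SameCycle.setoid G.faceRot) (b := G.faceRot x)
    (Equiv.Perm.sameCycle_apply_right.mpr (Equiv.Perm.SameCycle.refl _ x))).symm

theorem rightFace_rot_symm (x : G.Dart) :
    G.rightFace (G.rot.symm x) = G.rightFace (G.flip x) := by
  rw [← G.rightFace_rot_symm_flip (G.flip x), G.flip_flip]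

theorem rightFace_flip_rot (x : G.Dart) : G.rightFace (G.flip (G.rot x)) = G.rightFace x := by
  rw [← G.rightFace_rot_symm, Equiv.symm_apply_apply]

/-- The edges of the combinatorial map. -/
abbrev Edge : Type := Quotient (Equiv.Perm.SameCycle.setoid G.flip)

/-- The edge of a dart. -/
def edge (x : G.Dart) : G.Edge := Quotient.mk _ x

theorem edge_eq_iff {x y : G.Dart} : G.edge y = G.edge x ↔ y = x ∨ y = G.flip x := by
  have hsq : ∀ (m : ℕ) (z : G.Dart), (G.flip ^ m) z = z ∨ (G.flip ^ m) z = G.flip z := by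
    intro m z
    induction m with
    | zero => exact Or.inl rfl
    | succ m ih =>
      rw [pow_succ', Equiv.Perm.mul_apply]
      rcases ih with h | h <;> rw [h]
      · exact Or.inr rfl
      · exact Or.inl (G.flip_flip z)
  have := G.finite
  constructor
  · intro h
    obtain ⟨m, rfl⟩ := (Quotient.exact h : G.flip.SameCycle y x).symm.exists_nat_pow_eq
    exact hsq m x
  · rintro (rfl | rfl)
    · rfl
    · exact Quotient.sound (s := Equiv.Perm.SameCycle.setoid G.flip)
        (Equiv.Perm.sameCycle_apply_left.mpr (Equiv.Perm.SameCycle.refl _ x))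

theorem edge_flip (x : G.Dart) : G.edge (G.flip x) = G.edge x := G.edge_eq_iff.mpr (Or.inr rfl)

theorem card_dart [Fintype G.Dart] [Fintype G.Edge] :
    Fintype.card G.Dart = 2 * Fintype.card G.Edge := by
  classical
  rw [← Finset.card_univ, Finset.card_eq_sum_card_fiberwise (f := G.edge) (t := Finset.univ)
    (fun _ _ => Finset.mem_coe.mpr (Finset.mem_univ _)),
    Finset.sum_const_nat (m := 2), Finset.card_univ, mul_comm]
  intro e _
  induction e using Quotient.inductionOn with
  | h x =>
    have : Finset.univ.filter (fun y => G.edge y = G.edge x) = {x, G.flip x} := by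
      ext y
      simp [G.edge_eq_iff]
    change (Finset.univ.filter (fun y => G.edge y = G.edge x)).card = 2
    rw [this, Finset.card_pair (G.flip_ne x).symm]

variable {G}

theorem IsPlanar.eq_of_invariant (hG : G.IsPlanar) {α : Type*} {f : G.Dart → α}
    (h1 : ∀ x, f (G.rot x) = f x) (h2 : ∀ x, f (G.flip x) = f x) (x y : G.Dart) : f x = f y := by
  have h := hG.connected x y
  induction h with
  | refl => rfl
  | tail _ h ih =>
    rcases h with rfl | rfl
    · rw [h1, ih]
    · rw [h2, ih]

theorem IsPlanar.nonempty (hG : G.IsPlanar) : Nonempty G.Dart := by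
  by_contra h
  rw [not_nonempty_iff] at h
  have e1 : IsEmpty G.Vertex := ⟨fun v => v.inductionOn h.elim⟩
  have e2 : IsEmpty G.AllFace := ⟨fun v => v.inductionOn h.elim⟩
  have := hG.euler
  rw [Nat.card_of_isEmpty, Nat.card_of_isEmpty] at this
  omega

/-- The first cohomology of the sphere vanishes: a function on the corners that has even sum around
the midpoint of every edge is the sum of a function on the vertices and one on the faces. -/
theorem IsPlanar.exists_potential (hG : G.IsPlanar) {c : G.Dart → ZMod 2}
    (hc : ∀ x, c x + c (G.flip x) + (c (G.rot.symm x) + c (G.rot.symm (G.flip x))) = 0) :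
    ∃ (hV : G.Vertex → ZMod 2) (hF : G.AllFace → ZMod 2),
      ∀ d, c d = hV (G.tail d) + hF (G.rightFace d) := by
  classical
  have := G.finite
  have : Fintype G.Dart := Fintype.ofFinite _
  have : Fintype G.Edge := Fintype.ofFinite _
  have : Fintype G.Vertex := Fintype.ofFinite _
  have : Fintype G.AllFace := Fintype.ofFinite _
  have euler : Nat.card G.Vertex + Nat.card G.AllFace = Nat.card G.Edge + 2 := hG.euler
  obtain ⟨x0⟩ := hG.nonempty
  -- the incidence matrix of edges and corners
  let M : Matrix G.Dart G.Edge (ZMod 2) := Matrix.of fun d e =>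
    (if e = G.edge d then 1 else 0) + (if e = G.edge (G.rot d) then 1 else 0)
  have hM : ∀ (l : G.Edge → ZMod 2) d, M.mulVec l d = l (G.edge d) + l (G.edge (G.rot d)) := by
    intro l d
    simp [M, Matrix.mulVec, dotProduct, add_mul, Finset.sum_add_distrib]
  have hMt : ∀ (c : G.Dart → ZMod 2) x, M.transpose.mulVec c (G.edge x) =
      c x + c (G.flip x) + (c (G.rot.symm x) + c (G.rot.symm (G.flip x))) := by
    intro c x
    have h1 : Finset.univ.filter (fun d => G.edge x = G.edge d) = {x, G.flip x} := by
      ext y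
      simp [eq_comm (a := G.edge x), G.edge_eq_iff]
    have h2 : Finset.univ.filter (fun d => G.edge x = G.edge (G.rot d)) =
        {G.rot.symm x, G.rot.symm (G.flip x)} := by
      ext y
      simp [eq_comm (a := G.edge x), G.edge_eq_iff, Equiv.eq_symm_apply]
    simp only [M, Matrix.mulVec, dotProduct, Matrix.transpose_apply, Matrix.of_apply, add_mul,
      Finset.sum_add_distrib, ite_mul, one_mul, zero_mul, ← Finset.sum_filter, h1, h2]
    rw [Finset.sum_pair (G.flip_ne x).symm,
      Finset.sum_pair (G.rot.symm.injective.ne (G.flip_ne x).symm)]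
  let δ : ((G.Vertex → ZMod 2) × (G.AllFace → ZMod 2)) →ₗ[ZMod 2] (G.Dart → ZMod 2) :=
    LinearMap.coprod (LinearMap.funLeft _ _ G.tail) (LinearMap.funLeft _ _ G.rightFace)
  have hδ : ∀ p d, δ p d = p.1 (G.tail d) + p.2 (G.rightFace d) := fun p d => rfl
  have hker : Module.finrank (ZMod 2) (LinearMap.ker δ) ≤ 1 := by
    have h1 : ∀ p ∈ LinearMap.ker δ, ∀ d, p.1 (G.tail d) = p.2 (G.rightFace d) := fun p hp d => by
      have := congrFun (LinearMap.mem_ker.mp hp) d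
      rw [hδ] at this
      exact CharTwo.add_eq_zero.mp this
    have h2 : ∀ p ∈ LinearMap.ker δ, ∀ d, p.1 (G.tail d) = p.1 (G.tail x0) := fun p hp d =>
      hG.eq_of_invariant (f := fun d => p.1 (G.tail d)) (fun x => by rw [G.tail_rot]) (fun x => by
        rw [h1 p hp, ← G.rightFace_rot_symm, ← h1 p hp, G.tail_rot_symm]) d x0
    have h3 : ((fun _ => 1, fun _ => 1) : (G.Vertex → ZMod 2) × (G.AllFace → ZMod 2)) ∈
        LinearMap.ker δ := by
      rw [LinearMap.mem_ker]
      ext d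
      rw [hδ]
      exact CharTwo.add_self_eq_zero (1 : ZMod 2)
    refine finrank_le_one (⟨_, h3⟩ : LinearMap.ker δ) fun p => ⟨p.1.1 (G.tail x0), ?_⟩
    refine Subtype.ext (Prod.ext (funext fun v => ?_) (funext fun f => ?_))
    · induction v using Quotient.inductionOn with
      | h d => exact (mul_one _).trans (h2 p.1 p.2 d).symm
    · induction f using Quotient.inductionOn with
      | h d => exact (mul_one _).trans ((h2 p.1 p.2 d).symm.trans (h1 p.1 p.2 d))
  have hkerM : Module.finrank (ZMod 2) (LinearMap.ker M.mulVecLin) ≤ 1 := by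
    have h1 : ∀ l ∈ LinearMap.ker M.mulVecLin, ∀ d, l (G.edge d) = l (G.edge x0) := fun l hl d => by
      refine hG.eq_of_invariant (f := fun d => l (G.edge d)) (fun x => ?_)
        (fun x => by rw [G.edge_flip]) d x0
      have := congrFun (LinearMap.mem_ker.mp hl) x
      rw [Matrix.mulVecLin_apply, hM] at this
      exact (CharTwo.add_eq_zero.mp this).symm
    have h3 : (fun _ => 1 : G.Edge → ZMod 2) ∈ LinearMap.ker M.mulVecLin := by
      rw [LinearMap.mem_ker]
      ext d
      rw [Matrix.mulVecLin_apply, hM]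
      exact CharTwo.add_self_eq_zero (1 : ZMod 2)
    refine finrank_le_one (⟨_, h3⟩ : LinearMap.ker M.mulVecLin) fun l => ⟨l.1 (G.edge x0), ?_⟩
    refine Subtype.ext (funext fun v => ?_)
    induction v using Quotient.inductionOn with
    | h d => exact (mul_one _).trans (h1 l.1 l.2 d).symm
  have hle : LinearMap.range δ ≤ LinearMap.ker M.transpose.mulVecLin := by
    rintro _ ⟨p, rfl⟩
    rw [LinearMap.mem_ker]
    ext e
    induction e using Quotient.inductionOn with
    | h x =>
      change M.transpose.mulVec (δ p) (G.edge x) = 0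
      rw [hMt, hδ, hδ, hδ, hδ, G.tail_rot_symm, G.tail_rot_symm, G.rightFace_rot_symm_flip,
        G.rightFace_rot_symm]
      linear_combination CharTwo.add_self_eq_zero (p.1 (G.tail x) + p.2 (G.rightFace x) +
        (p.1 (G.tail (G.flip x)) + p.2 (G.rightFace (G.flip x))))
  have h1 := LinearMap.finrank_range_add_finrank_ker δ
  have h2 := LinearMap.finrank_range_add_finrank_ker M.mulVecLin
  have h3 := LinearMap.finrank_range_add_finrank_ker M.transpose.mulVecLin
  have h4 := M.rank_transpose
  rw [Matrix.rank, Matrix.rank] at h4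
  rw [Module.finrank_prod, Module.finrank_fintype_fun_eq_card,
    Module.finrank_fintype_fun_eq_card] at h1
  rw [Module.finrank_fintype_fun_eq_card] at h2
  rw [Module.finrank_fintype_fun_eq_card, G.card_dart] at h3
  simp only [← Nat.card_eq_fintype_card] at h1 h2 h3
  have heq := Submodule.eq_of_le_of_finrank_le hle (by omega)
  have hmem : c ∈ LinearMap.ker M.transpose.mulVecLin := by
    rw [LinearMap.mem_ker]
    ext e
    induction e using Quotient.inductionOn with
    | h x => exact (hMt c x).trans (hc x)
  rw [← heq] at hmem
  obtain ⟨p, rfl⟩ := hmem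
  exact ⟨p.1, p.2, hδ p⟩

end DiskMap

end ElecOG

/-! ### The two sides of a strand -/

namespace ElecOG

namespace DiskMap

variable {n : ℕ} {G : DiskMap n}

theorem IsWellConnected.onStrand_medialCorner_iff (hG : G.IsWellConnected) {j m : Fin (n + n)} :
    G.OnStrand j (G.medialCorner m) ↔ j = m ∨ j = opp m := by
  have h : G.OnStrand m (G.medialCorner m) := by
    have h1 : G.MedialStrand m (G.medialStart m) := MedialStrand.start
    rcases Nat.mod_two_eq_zero_or_one (m : ℕ) with h | h <;>
      simp only [medialStart, h, zero_ne_one, decide_false, decide_true] at h1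
    · exact Or.inr h1
    · exact Or.inl h1
  constructor
  · exact hG.onStrand_unique h
  · rintro (rfl | rfl)
    · exact h
    · exact hG.onStrand_opp.mpr h

/-- The index of the endpoint `t` that follows `b_i`. -/
def oddIndex (i : Fin n) : Fin (n + n) := ⟨2 * i + 1, by omega⟩

/-- The index of the endpoint `t` that precedes `b_i`. -/
def evenIndex (i : Fin n) : Fin (n + n) := ⟨2 * i, by omega⟩

theorem medialCorner_oddIndex (i : Fin n) : G.medialCorner (oddIndex i) = G.bdry i := by
  have h1 : ((oddIndex i : Fin (n + n)) : ℕ) % 2 = 1 := by simp only [oddIndex]; omega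
  have h2 : half (oddIndex i) = i := Fin.ext (by simp only [half, oddIndex]; omega)
  rw [medialCorner, if_pos h1, h2]

theorem medialCorner_evenIndex (i : Fin n) :
    G.medialCorner (evenIndex i) = G.rot.symm (G.rot.symm (G.bdry i)) := by
  have h1 : ¬ ((evenIndex i : Fin (n + n)) : ℕ) % 2 = 1 := by simp only [evenIndex]; omega
  have h2 : half (evenIndex i) = i := Fin.ext (by simp only [half, evenIndex]; omega)
  rw [medialCorner, if_neg h1, h2]

theorem cyc_val (i : Fin n) : (cyc i : ℕ) = if (i : ℕ) + 1 = n then 0 else (i : ℕ) + 1 := by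
  have := i.isLt
  split_ifs with h
  · simp [cyc, h]
  · exact Nat.mod_eq_of_lt (by omega)

theorem sum_indicator_eq_zero {p q r s : Prop} [Decidable p] [Decidable q] [Decidable r]
    [Decidable s] (h : (p ↔ q) ↔ (r ↔ s)) :
    ((if p then 1 else 0) + (if q then 1 else 0) +
      ((if r then 1 else 0) + (if s then 1 else 0)) : ZMod 2) = 0 := by
  by_cases hp : p <;> by_cases hq : q <;> by_cases hr : r <;> by_cases hs : s <;>
    simp only [hp, hq, hr, hs, if_true, if_false] at h ⊢ <;> first | decide | (simp at h)

/-- Jordan curve theorem for the strand `β` between `t_j` and `t_{j ± n}`: it separates the regions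
into two sides. -/
theorem IsWellConnected.exists_sides (hG : G.IsWellConnected) (j : Fin (n + n)) :
    ∃ (hV : G.Vertex → ZMod 2) (hF : G.AllFace → ZMod 2),
      (∀ d, ¬ G.IsOuter d → G.OnStrand j d → hV (G.tail d) + hF (G.rightFace d) = 1) ∧
      ∀ d, ¬ G.IsOuter d → ¬ G.OnStrand j d → hV (G.tail d) + hF (G.rightFace d) = 0 := by
  classical
  -- `β` is closed up along the boundary circle, through the corners of the outer face between
  -- `t_j` and `t_{j ± n}`
  let a : ℕ := if (j : ℕ) < n then j else j - n
  let P : Fin n → Prop := fun i => a ≤ 2 * i ∧ 2 * i < a + n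
  let C : G.Dart → Prop := fun d => G.OnStrand j d ∨ ∃ i, d = G.rot.symm (G.bdry i) ∧ P i
  have hC1 : ∀ d, ¬ G.IsOuter d → (C d ↔ G.OnStrand j d) := by
    intro d hd
    refine ⟨fun h => h.resolve_right ?_, Or.inl⟩
    rintro ⟨i, rfl, -⟩
    exact hd (G.isOuter_rot_symm_bdry i)
  have hC2 : ∀ i, C (G.rot.symm (G.bdry i)) ↔ P i := by
    intro i
    refine ⟨?_, fun h => Or.inr ⟨i, rfl, h⟩⟩
    rintro (h | ⟨k, hk, h⟩)
    · exact absurd (G.isOuter_rot_symm_bdry i) h.not_isOuter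
    · rwa [G.bdry_injective (G.rot.symm.injective hk)]
  have hb : ∀ i, ((C (G.bdry i) ↔ C (G.flip (G.bdry i))) ↔
      (C (G.rot.symm (G.bdry i)) ↔ C (G.rot.symm (G.flip (G.bdry i))))) := by
    intro i
    have h0 : ∀ m : Fin (n + n), (j = m ∨ j = opp m) ↔ ((m : ℕ) = a ∨ (m : ℕ) = a + n) := by
      intro m
      simp only [a, Fin.ext_iff, opp]
      have := m.isLt
      split_ifs <;> omega
    have h1 : C (G.bdry i) ↔ ((oddIndex i : ℕ) = a ∨ (oddIndex i : ℕ) = a + n) := by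
      rw [hC1 _ (G.not_isOuter_bdry i), ← medialCorner_oddIndex, hG.onStrand_medialCorner_iff, h0]
    have h2 : C (G.rot.symm (G.flip (G.bdry i))) ↔
        ((evenIndex (cyc i) : ℕ) = a ∨ (evenIndex (cyc i) : ℕ) = a + n) := by
      rw [← G.rot_symm_bdry_cyc, ← medialCorner_evenIndex, hC1 _ (G.not_isOuter_medialCorner _),
        hG.onStrand_medialCorner_iff, h0]
    have ha : a < n := by
      simp only [a]
      split_ifs <;> omega
    rw [h1, h2, ← G.rot_symm_bdry_cyc, hC2, hC2]
    simp only [P, oddIndex, evenIndex, cyc_val]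
    have := i.isLt
    by_cases h4 : (i : ℕ) + 1 = n <;> simp only [h4, if_true, if_false] <;> omega
  obtain ⟨hV, hF, h⟩ := hG.planar.exists_potential (c := fun d => if C d then 1 else 0) (by
    intro x
    refine sum_indicator_eq_zero ?_
    by_cases hx : G.Inner x
    · rw [hC1 _ (G.not_isOuter_of_inner hx), hC1 _ (G.not_isOuter_of_inner (G.inner_flip hx)),
        hC1 _ (G.not_isOuter_rot_symm fun i => (hx i).1),
        hC1 _ (G.not_isOuter_rot_symm fun i => (G.inner_flip hx i).1),
        onStrand_flip_iff hx, onStrand_rot_symm_flip_iff hx]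
      exact iff_of_true Iff.rfl Iff.rfl
    · rcases G.not_inner hx with ⟨i, rfl⟩ | ⟨i, rfl⟩
      · exact hb i
      · rw [G.flip_flip, iff_comm (a := C (G.flip _)), iff_comm (a := C (G.rot.symm (G.flip _)))]
        exact hb i)
  refine ⟨hV, hF, fun d hd hj => ?_, fun d hd hj => ?_⟩
  · rw [← h, if_pos ((hC1 d hd).mpr hj)]
  · rw [← h, if_neg (fun h => hj ((hC1 d hd).mp h))]

/-- A strand does not meet itself: at the inner midpoint where the edge `a` ends, the other two
edges of the medial graph do not belong to the strand of `a`. -/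
theorem IsReduced.not_onStrand_rot (hG : G.IsReduced) {j : Fin (n + n)} {d : G.Dart}
    (h : G.MedialStrand j (d, true)) (hd : G.Inner (G.rot d)) : ¬ G.OnStrand j (G.rot d) := by
  rintro (h1 | h1)
  · have h2 : G.MedialStrand j (G.flip (G.rot d), false) := by
      refine MedialStrand.of_next ?_ (G.inner_flip hd)
      simpa [medialNext, G.flip_flip] using h1
    have := hG.no_self_intersection j _ _ h h2 hd (Or.inr (G.flip_flip _).symm)
    simp at this
  · have := hG.no_self_intersection j _ _ h h1 hd (Or.inl rfl)
    simp at this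

theorem IsReduced.not_onStrand_rot_symm (hG : G.IsReduced) {j : Fin (n + n)} {d : G.Dart}
    (h : G.MedialStrand j (d, false)) (hd : G.Inner d) : ¬ G.OnStrand j (G.rot.symm d) := by
  rintro (h1 | h1)
  · have := hG.no_self_intersection j _ _ h h1 hd (Or.inl (by simp [medialHead]))
    simp at this
  · have h2 : G.MedialStrand j (G.rot.symm (G.flip d), true) := by
      refine MedialStrand.of_next ?_ (by simpa [medialHead] using G.inner_flip hd)
      simpa [medialNext, G.flip_flip] using h1
    have := hG.no_self_intersection j _ _ h h2 hd
      (Or.inr (by simp [medialHead, G.flip_flip]))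
    simp at this

theorem not_isOuter_of_face {f : G.Face} {d : G.Dart} (h : f.1 = G.rightFace d) :
    ¬ G.IsOuter d := by
  rintro ⟨i, rfl⟩
  exact f.2 i h

/-- No region is on the left of both strands between `t_j` and `t_{j ± n}`. -/
theorem IsWellConnected.not_leftOfStrand_both (hG : G.IsWellConnected) {j : Fin (n + n)}
    {u : G.Region} (h : G.LeftOfStrand j u) : ¬ G.LeftOfStrand (opp j) u := by
  intro h'
  obtain ⟨hV, hF, h1, h0⟩ := hG.exists_sides j
  let S : G.Region → ZMod 2 := Sum.elim hV fun f => hF f.1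
  let L : G.Dart × Bool → ZMod 2 := fun a => if a.2 then hF (G.rightFace a.1) else hV (G.tail a.1)
  have hL : ∀ a u, G.OnLeft a u → S u = L a := by
    rintro ⟨d, b⟩ (v | f) ⟨rfl, h⟩
    · simp [S, L, h]
    · simp [S, L, h]
  have hconst : ∀ a, G.MedialStrand j a → L a = L (G.medialStart j) := by
    intro a ha
    induction ha with
    | start => rfl
    | next a ha hi ih =>
      rw [← ih]
      obtain ⟨d, b⟩ := a
      cases b
      · have := h0 _ (G.not_isOuter_rot_symm fun i => (hi i).1)
          (hG.reduced.not_onStrand_rot_symm ha hi)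
        rw [G.tail_rot_symm, G.rightFace_rot_symm] at this
        simpa [L, medialNext, medialHead] using (CharTwo.add_eq_zero.mp this).symm
      · have := h0 _ (G.not_isOuter_of_inner (G.inner_flip hi)) (fun h =>
          hG.reduced.not_onStrand_rot ha hi ((onStrand_flip_iff hi).mp h))
        rw [← G.tail_rot_symm, ← G.rightFace_rot_symm, medialHead, if_pos rfl,
          Equiv.symm_apply_apply] at this
        simpa [L, medialNext, medialHead] using CharTwo.add_eq_zero.mp this
  have hadj : ∀ k, (∀ d, G.OnStrand k d ↔ G.OnStrand j d) → ∀ u w,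
      Relation.EqvGen (G.AdjOff k) u w → S u = S w := by
    intro k hk u w huw
    induction huw with
    | rel u w h =>
      obtain ⟨d, f, hf, rfl, rfl, h2, h3⟩ := h
      have := h0 d (not_isOuter_of_face hf) (fun h => (not_or.mpr ⟨h2, h3⟩) ((hk d).mpr h))
      rw [← hf] at this
      exact CharTwo.add_eq_zero.mp this
    | refl => rfl
    | symm _ _ _ ih => exact ih.symm
    | trans _ _ _ _ _ ih ih' => exact ih.trans ih'
  obtain ⟨a, w, ha, hw, hwu⟩ := h
  obtain ⟨⟨d, b⟩, w', ha', hw', hwu'⟩ := h'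
  have e1 := hadj j (fun _ => Iff.rfl) _ _ hwu
  have e2 := hadj (opp j) (fun _ => hG.onStrand_opp) _ _ hwu'
  rw [hL _ _ hw, hconst _ ha] at e1
  rw [hL _ _ hw'] at e2
  rw [hG.medialStrand_opp] at ha'
  have e3 := hconst _ ha'
  have e4 : G.OnStrand j d := by
    cases b
    · exact Or.inl ha'
    · exact Or.inr ha'
  have e5 := h1 d e4.not_isOuter e4
  have e6 : L (d, b) + L (d, !b) = 1 := by
    cases b
    · simpa [L] using e5
    · simpa [L, add_comm] using e5
  rw [e2, e3, ← e1, CharTwo.add_self_eq_zero] at e6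
  exact zero_ne_one e6

/-- The faces at the arcs of the boundary circle are distinct: for two of them some strand has them
on different sides. -/
theorem IsWellConnected.rightFace_bdry_injective (hG : G.IsWellConnected) {i k : Fin n}
    (h : G.rightFace (G.bdry i) = G.rightFace (G.bdry k)) : i = k := by
  have key : ∀ a : ℕ, a < n → ∀ i k : Fin n, G.rightFace (G.bdry i) = G.rightFace (G.bdry k) →
      ((a ≤ 2 * i + 1 ∧ 2 * (i : ℕ) + 1 < a + n) ↔ (a ≤ 2 * k + 1 ∧ 2 * (k : ℕ) + 1 < a + n)) := by
    intro a ha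
    let j : Fin (n + n) := ⟨a, by omega⟩
    obtain ⟨hV, hF, h1, h0⟩ := hG.exists_sides j
    let Q : ℕ → ZMod 2 := fun i => if a ≤ 2 * i + 1 ∧ 2 * i + 1 < a + n then 1 else 0
    have hc : ∀ m : Fin (n + n), hV (G.tail (G.medialCorner m)) +
        hF (G.rightFace (G.medialCorner m)) =
          if (m : ℕ) = a ∨ (m : ℕ) = a + n then 1 else 0 := by
      intro m
      have h3 : G.OnStrand j (G.medialCorner m) ↔ (m : ℕ) = a ∨ (m : ℕ) = a + n := by
        rw [hG.onStrand_medialCorner_iff]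
        simp only [j, Fin.ext_iff, opp]
        have := m.isLt
        split_ifs <;> omega
      split_ifs with h4
      · exact h1 _ (G.not_isOuter_medialCorner m) (h3.mpr h4)
      · exact h0 _ (G.not_isOuter_medialCorner m) (fun h => h4 (h3.mp h))
    have hstep : ∀ m (hm : m < n), hF (G.rightFace (G.bdry ⟨m, hm⟩)) + Q m =
        hF (G.rightFace (G.bdry ⟨0, by omega⟩)) + Q 0 := by
      intro m
      induction m with
      | zero => intro hm; rfl
      | succ m ih =>
        intro hm
        rw [← ih (by omega)]
        have e1 := hc (oddIndex ⟨m + 1, hm⟩)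
        have e2 := hc (evenIndex ⟨m + 1, hm⟩)
        have e3 : cyc (⟨m, by omega⟩ : Fin n) = ⟨m + 1, hm⟩ := Fin.ext (by
          rw [cyc_val]; simp only; split_ifs <;> omega)
        rw [medialCorner_oddIndex] at e1
        rw [medialCorner_evenIndex, ← e3, G.rot_symm_bdry_cyc, G.tail_rot_symm, ← G.tail_rot,
          G.rot_flip_bdry, G.rightFace_rot_symm_flip, e3] at e2
        have e4 := congrArg₂ (· + ·) e1 e2
        have e5 : Q (m + 1) + Q m = (if 2 * (m + 1) + 1 = a ∨ 2 * (m + 1) + 1 = a + n then 1 else 0)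
            + (if 2 * (m + 1) = a ∨ 2 * (m + 1) = a + n then 1 else 0) := by
          have := sum_indicator_eq_zero (p := a ≤ 2 * (m + 1) + 1 ∧ 2 * (m + 1) + 1 < a + n)
            (q := a ≤ 2 * m + 1 ∧ 2 * m + 1 < a + n)
            (r := 2 * (m + 1) + 1 = a ∨ 2 * (m + 1) + 1 = a + n)
            (s := 2 * (m + 1) = a ∨ 2 * (m + 1) = a + n) (by omega)
          exact CharTwo.add_eq_zero.mp this
        have e6 := e4.trans e5.symm
        linear_combination e6 - CharTwo.add_self_eq_zero (hV (G.tail (G.bdry ⟨m + 1, hm⟩))) -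
          CharTwo.add_self_eq_zero (hF (G.rightFace (G.bdry ⟨m, by omega⟩))) +
          CharTwo.add_self_eq_zero (Q (m + 1))
    intro i k hik
    have e1 := hstep i i.isLt
    have e2 := hstep k k.isLt
    rw [← e2, Fin.eta, Fin.eta, hik, add_left_cancel_iff] at e1
    simp only [Q] at e1
    split_ifs at e1 with h3 h4 h4
    · exact iff_of_true h3 h4
    · exact absurd e1 one_ne_zero
    · exact absurd e1 zero_ne_one
    · exact iff_of_false h3 h4
  -- an interval of an even number of the `2n` endpoints contains one but not both of some pair
  have H : ∀ i k : Fin n, i < k → G.rightFace (G.bdry i) = G.rightFace (G.bdry k) → False := by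
    intro i k hik h
    have hk := k.isLt
    have hik' : (i : ℕ) < k := hik
    by_cases h1 : 2 * ((k : ℕ) - i) ≤ n
    · by_cases h2 : 2 * (i : ℕ) + 2 < n
      · have := key (2 * i + 2) h2 i k h
        omega
      · have := key (2 * i + 2 - n) (by omega) i k h
        omega
    · have := key (2 * i + 1) (by omega) i k h
      omega
  rcases lt_trichotomy i k with h1 | h1 | h1
  · exact (H i k h1 h).elim
  · exact h1
  · exact (H k i h1 h.symm).elim

end DiskMap

end ElecOG

/-! ### The faces of `G_+` -/

namespace ElecOG

namespace DiskMap

variable {n : ℕ} (G : DiskMap n)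

/-- A function on the darts that is invariant under `rot` descends to the vertices. -/
theorem eq_of_tail_eq {α : Type*} {f : G.Dart → α} (hf : ∀ z, f (G.rot z) = f z) {x y : G.Dart}
    (h : G.tail x = G.tail y) : f x = f y := by
  have := G.finite
  obtain ⟨m, rfl⟩ := (Quotient.exact h : G.rot.SameCycle x y).exists_nat_pow_eq
  induction m with
  | zero => rfl
  | succ m ih =>
    rw [pow_succ', Equiv.Perm.mul_apply, hf]
    exact ih (Quotient.sound (s := Equiv.Perm.SameCycle.setoid G.rot)
      (Equiv.Perm.sameCycle_pow_right.mpr (Equiv.Perm.SameCycle.refl _ x)))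

/-- A function on the corners that is invariant under `faceRot` descends to the faces. -/
theorem eq_of_rightFace_eq {α : Type*} {f : G.Dart → α}
    (hf : ∀ z, f (G.flip (G.rot z)) = f z) {x y : G.Dart}
    (h : G.rightFace x = G.rightFace y) : f x = f y := by
  have := G.finite
  have hf' : ∀ z, f (G.faceRot z) = f z := by
    intro z
    rw [← hf]
    change f (G.flip (G.rot (G.rot.symm (G.flip z)))) = f z
    rw [Equiv.apply_symm_apply, G.flip_flip]
  obtain ⟨m, rfl⟩ := (Quotient.exact h : G.faceRot.SameCycle x y).exists_nat_pow_eq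
  induction m with
  | zero => rfl
  | succ m ih =>
    rw [pow_succ', Equiv.Perm.mul_apply, hf']
    exact ih (Quotient.sound (s := Equiv.Perm.SameCycle.setoid G.faceRot)
      (Equiv.Perm.sameCycle_pow_right.mpr (Equiv.Perm.SameCycle.refl _ x)))

theorem isOuter_flip_rot (x : G.Dart) : G.IsOuter (G.flip (G.rot x)) ↔ G.IsOuter x := by
  constructor
  · rintro ⟨i, hi⟩
    rw [← Equiv.symm_apply_apply G.rot x, G.flip.injective hi]
    exact G.isOuter_rot_symm_bdry i
  · rintro ⟨i, rfl⟩
    exact ⟨cyc i, by rw [G.rot_flip_bdry]⟩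

theorem isOuter_iff_of_rightFace_eq {x y : G.Dart} (h : G.rightFace x = G.rightFace y) :
    G.IsOuter x ↔ G.IsOuter y :=
  iff_of_eq (G.eq_of_rightFace_eq (fun z => propext (G.isOuter_flip_rot z)) h)

/-- The face of the corner `d`, which must not lie in the outer face. -/
def faceAt (d : G.Dart) (hd : ¬ G.IsOuter d) : G.Face :=
  ⟨G.rightFace d, fun i h => hd ((G.isOuter_iff_of_rightFace_eq h).mpr ⟨i, rfl⟩)⟩

theorem exists_faceAt (f : G.Face) : ∃ d hd, f = G.faceAt d hd := by
  obtain ⟨f, hf⟩ := f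
  induction f using Quotient.inductionOn with
  | h d => exact ⟨d, fun ⟨i, hi⟩ => hf i (by rw [← hi]; rfl), rfl⟩

/-- The corner of `G` in which a dart of `G_+` has its right side.  (The faces of `G_+` are the
quadrilaterals around the corners of `G`, and triangles at the boundary.) -/
def cornerOf : G.PlusDart → G.Dart
  | PlusDart.wv x => x
  | PlusDart.vw x => G.rot.symm x
  | PlusDart.wf x _ => G.rot.symm (G.flip x)
  | PlusDart.fw x _ => x

theorem plus_rot_vw_of_inner {x : G.Dart} (h : G.Inner x) :
    G.plus.rot (PlusDart.vw x) = PlusDart.fw (G.flip x) (G.inner_flip h) :=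
  dif_pos h

theorem plus_rot_vw_bdry (i : Fin n) :
    G.plus.rot (PlusDart.vw (G.bdry i)) = PlusDart.vw (G.flip (G.bdry i)) :=
  (dif_neg (G.not_inner_bdry i)).trans (if_pos ⟨i, rfl⟩)

theorem plus_rot_vw_flip_bdry (i : Fin n) : G.plus.rot (PlusDart.vw (G.flip (G.bdry i))) =
    G.faceDart (G.rot.symm (G.flip (G.bdry i))) := by
  refine (dif_neg (G.not_inner_flip_bdry i)).trans ((if_neg ?_).trans ?_)
  · rintro ⟨k, hk⟩
    exact G.bdry_ne_flip k i hk.symm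
  · rw [G.flip_flip]
    rfl

theorem cornerOf_flip_faceDart (x : G.Dart) : G.cornerOf (G.plus.flip (G.faceDart x)) = x := by
  unfold faceDart
  split_ifs <;> rfl

theorem cornerOf_flip_rot {z : G.plus.Dart} (hz : ∀ i, z ≠ PlusDart.vw (G.bdry i)) :
    G.cornerOf (G.plus.flip (G.plus.rot z)) = G.cornerOf z := by
  rcases z with x | x | ⟨x, h⟩ | ⟨x, h⟩
  · exact Equiv.symm_apply_apply _ _
  · by_cases hx : G.Inner x
    · rw [G.plus_rot_vw_of_inner hx]
      change G.rot.symm (G.flip (G.flip x)) = G.rot.symm x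
      rw [G.flip_flip]
    · obtain ⟨i, rfl⟩ := (G.not_inner hx).resolve_left (fun ⟨i, hi⟩ => hz i (by rw [hi]))
      rw [G.plus_rot_vw_flip_bdry]
      exact G.cornerOf_flip_faceDart _
  · exact G.cornerOf_flip_faceDart _
  · rfl

theorem plusBdry_evenIndex (i : Fin n) : G.plusBdry (evenIndex i) = PlusDart.wv (G.bdry i) := by
  have h1 : ((evenIndex i : Fin (n + n)) : ℕ) % 2 = 0 := by simp only [evenIndex]; omega
  have h2 : half (evenIndex i) = i := Fin.ext (by simp only [half, evenIndex]; omega)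
  rw [plusBdry, if_pos h1, h2]

theorem plusBdry_oddIndex (i : Fin n) :
    G.plusBdry (oddIndex i) = PlusDart.vw (G.flip (G.bdry i)) := by
  have h1 : ¬ ((oddIndex i : Fin (n + n)) : ℕ) % 2 = 0 := by simp only [oddIndex]; omega
  have h2 : half (oddIndex i) = i := Fin.ext (by simp only [half, oddIndex]; omega)
  rw [plusBdry, if_neg h1, h2]

theorem eq_evenIndex_or_oddIndex (j : Fin (n + n)) :
    (∃ i, j = evenIndex i) ∨ ∃ i, j = oddIndex i := by
  rcases Nat.mod_two_eq_zero_or_one (j : ℕ) with h | h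
  · exact Or.inl ⟨half j, Fin.ext (by simp only [half, evenIndex]; omega)⟩
  · exact Or.inr ⟨half j, Fin.ext (by simp only [half, oddIndex]; omega)⟩

theorem plus_isOuter_iff {y : G.plus.Dart} :
    G.plus.IsOuter y ↔ G.IsOuter (G.cornerOf y) := by
  constructor
  · rintro ⟨j, rfl⟩
    change G.IsOuter (G.cornerOf (G.plusFlipFun (G.plusBdry j)))
    rcases eq_evenIndex_or_oddIndex j with ⟨i, rfl⟩ | ⟨i, rfl⟩
    · rw [plusBdry_evenIndex]
      exact G.isOuter_rot_symm_bdry i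
    · rw [plusBdry_oddIndex]
      exact ⟨i, rfl⟩
  · have h1 : ∀ i, G.plus.IsOuter (PlusDart.wv (G.flip (G.bdry i))) := fun i =>
      ⟨oddIndex i, by
        change _ = G.plusFlipFun (G.plusBdry _)
        rw [plusBdry_oddIndex]
        rfl⟩
    have h2 : ∀ i, G.plus.IsOuter (PlusDart.vw (G.bdry i)) := fun i =>
      ⟨evenIndex i, by
        change _ = G.plusFlipFun (G.plusBdry _)
        rw [plusBdry_evenIndex]
        rfl⟩
    rcases y with x | x | ⟨x, h⟩ | ⟨x, h⟩
    · rintro ⟨i, rfl⟩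
      exact h1 i
    · intro h
      by_contra hx
      refine G.not_isOuter_rot_symm (fun i hi => hx ?_) h
      rw [hi]
      exact h2 i
    · exact fun h3 => absurd h3 (G.not_isOuter_rot_symm fun i => (G.inner_flip h i).1)
    · exact fun h3 => absurd h3 (G.not_isOuter_of_inner h)

/-- The face of `G_+` on the right of a dart depends only on its corner. -/
theorem plus_rightFace (y : G.plus.Dart) :
    G.plus.rightFace y = G.plus.rightFace (PlusDart.wv (G.cornerOf y)) := by
  have hvw : ∀ x, G.plus.rightFace (PlusDart.vw x) =
      G.plus.rightFace (PlusDart.wv (G.rot.symm x)) := by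
    intro x
    rw [← G.plus.rightFace_flip_rot (PlusDart.wv (G.rot.symm x))]
    change _ = G.plus.rightFace (PlusDart.vw (G.rot (G.rot.symm x)))
    rw [Equiv.apply_symm_apply]
  rcases y with x | x | ⟨x, h⟩ | ⟨x, h⟩
  · rfl
  · exact hvw x
  · refine Eq.trans ?_ (hvw (G.flip x))
    rw [← G.plus.rightFace_flip_rot (PlusDart.vw (G.flip x)),
      G.plus_rot_vw_of_inner (G.inner_flip h)]
    congr 1
    change PlusDart.wf x h = PlusDart.wf (G.flip (G.flip x)) _
    congr 1
    exact (G.flip_flip x).symm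
  · exact (G.plus.rightFace_flip_rot (PlusDart.fw x h)).symm

/-- Distinct faces of `G_+` lie around distinct corners of `G`. -/
theorem cornerOf_eq_of_rightFace_eq {y z : G.plus.Dart}
    (h : G.plus.rightFace y = G.plus.rightFace z) (hy : ¬ G.IsOuter (G.cornerOf y)) :
    G.cornerOf y = G.cornerOf z := by
  classical
  let F : G.plus.Dart → Option G.Dart := fun y =>
    if G.IsOuter (G.cornerOf y) then none else some (G.cornerOf y)
  have hF : ∀ z, F (G.plus.flip (G.plus.rot z)) = F z := by
    intro z
    by_cases hz : ∃ i, z = PlusDart.vw (G.bdry i)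
    · obtain ⟨i, rfl⟩ := hz
      have h1 : G.plus.IsOuter (PlusDart.vw (G.bdry i)) :=
        G.plus_isOuter_iff.mpr (G.isOuter_rot_symm_bdry i)
      have h2 := (G.plus.isOuter_flip_rot _).mpr h1
      exact (if_pos (G.plus_isOuter_iff.mp h2)).trans (if_pos (G.isOuter_rot_symm_bdry i)).symm
    · simp only [F]
      rw [G.cornerOf_flip_rot fun i hi => hz ⟨i, hi⟩]
  have h1 := G.plus.eq_of_rightFace_eq hF h
  simp only [F] at h1
  rw [if_neg hy] at h1
  split_ifs at h1
  exact Option.some.inj h1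

/-- The face of `G_+` around the corner `d`, which must not lie in the outer face. -/
noncomputable def plusFaceAt (d : G.Dart) (hd : ¬ G.IsOuter d) : G.plus.Face :=
  G.plus.faceAt (PlusDart.wv d) (fun h => hd (G.plus_isOuter_iff.mp h))

theorem exists_plusFaceAt (g : G.plus.Face) : ∃ d hd, g = G.plusFaceAt d hd := by
  obtain ⟨y, hy, rfl⟩ := G.plus.exists_faceAt g
  exact ⟨G.cornerOf y, fun h => hy (G.plus_isOuter_iff.mpr h), Subtype.ext (G.plus_rightFace y)⟩

theorem plusFaceAt_val_eq_iff {d : G.Dart} {hd : ¬ G.IsOuter d} {y : G.plus.Dart} :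
    (G.plusFaceAt d hd).1 = G.plus.rightFace y ↔ G.cornerOf y = d := by
  constructor
  · intro h
    exact (G.cornerOf_eq_of_rightFace_eq (y := PlusDart.wv d) h hd).symm
  · rintro rfl
    exact (G.plus_rightFace y).symm

theorem incident_inl_iff {d : G.Dart} {hd : ¬ G.IsOuter d} {v : G.Vertex} :
    G.Incident (G.plusFaceAt d hd) (Sum.inl v) ↔ v = G.tail d := by
  constructor
  · rintro ⟨y, ⟨x, rfl, hx⟩, hy⟩
    rw [plusFaceAt_val_eq_iff] at hy
    let F : G.plus.Dart → Option G.Vertex := fun y => match y with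
      | PlusDart.wv x => some (G.tail x)
      | _ => none
    have hFf : ∀ x, F (G.faceDart x) = none := by
      intro x
      unfold faceDart
      split_ifs <;> rfl
    have hF : ∀ z, F (G.plus.rot z) = F z := by
      rintro (x | x | ⟨x, h⟩ | ⟨x, h⟩)
      · exact congrArg some (G.tail_rot x)
      · by_cases hx : G.Inner x
        · rw [G.plus_rot_vw_of_inner hx]
        · rcases G.not_inner hx with ⟨i, rfl⟩ | ⟨i, rfl⟩
          · rw [G.plus_rot_vw_bdry]
          · rw [G.plus_rot_vw_flip_bdry, hFf]
      · exact hFf _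
      · rfl
    have h1 : F y = some (G.tail x) := G.plus.eq_of_tail_eq hF hx
    rcases y with z | z | ⟨z, h⟩ | ⟨z, h⟩ <;> simp only [F, Option.some.injEq, reduceCtorEq] at h1
    rw [← hy, ← h1]
    rfl
  · rintro rfl
    exact ⟨PlusDart.wv d, ⟨d, rfl, rfl⟩, rfl⟩

theorem incident_inr_iff {d : G.Dart} {hd : ¬ G.IsOuter d} {f : G.Face} :
    G.Incident (G.plusFaceAt d hd) (Sum.inr f) ↔ f = G.faceAt d hd := by
  classical
  constructor
  · rintro ⟨y, ⟨x, hf, hx⟩, hy⟩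
    rw [plusFaceAt_val_eq_iff] at hy
    let F : G.plus.Dart → Option G.AllFace := fun y => match y with
      | PlusDart.wf x _ => some (G.rightFace x)
      | PlusDart.vw x => if G.Inner x then none else
          if ∃ i, x = G.bdry i then some (G.rightFace x) else some (G.rightFace (G.flip x))
      | _ => none
    have hb : ∀ i, F (PlusDart.vw (G.bdry i)) = some (G.rightFace (G.bdry i)) := fun i =>
      (if_neg (G.not_inner_bdry i)).trans (if_pos ⟨i, rfl⟩)
    have hb' : ∀ i, F (PlusDart.vw (G.flip (G.bdry i))) = some (G.rightFace (G.bdry i)) := fun i =>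
      (if_neg (G.not_inner_flip_bdry i)).trans ((if_neg (fun ⟨k, hk⟩ =>
        G.bdry_ne_flip k i hk.symm)).trans (by rw [G.flip_flip]))
    have hFf : ∀ x, ¬ G.IsOuter x → F (G.faceDart x) = some (G.rightFace x) := by
      intro x h
      unfold faceDart
      split_ifs with hx
      · rfl
      · obtain ⟨i, rfl⟩ := (G.not_inner hx).resolve_right h
        exact hb i
    have hFf' : ∀ x, (∀ i, G.flip x ≠ G.bdry i) →
        F (G.faceDart (G.rot.symm (G.flip x))) = some (G.rightFace x) := by
      intro x h
      rw [hFf _ (G.not_isOuter_rot_symm h), G.rightFace_rot_symm_flip]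
    have hF : ∀ z, F (G.plus.rot z) = F z := by
      rintro (x | x | ⟨x, h⟩ | ⟨x, h⟩)
      · rfl
      · by_cases hx : G.Inner x
        · rw [G.plus_rot_vw_of_inner hx]
          exact (if_pos hx).symm
        · rcases G.not_inner hx with ⟨i, rfl⟩ | ⟨i, rfl⟩
          · rw [G.plus_rot_vw_bdry, hb, hb']
          · rw [G.plus_rot_vw_flip_bdry, hb', hFf' _ fun k h => G.bdry_ne_flip k i h.symm]
      · exact hFf' x fun i => (G.inner_flip h i).1
      · exact if_pos h
    have h1 : F y = some f.1 := by
      rw [hf, ← hFf x (not_isOuter_of_face hf)]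
      exact G.plus.eq_of_tail_eq hF hx
    refine Subtype.ext ?_
    change f.1 = G.rightFace d
    rcases y with z | z | ⟨z, h⟩ | ⟨z, h⟩
    · simp [F] at h1
    · by_cases hz : G.Inner z
      · simp [F, hz] at h1
      · rcases G.not_inner hz with ⟨i, rfl⟩ | ⟨i, rfl⟩
        · exact absurd (hy ▸ G.isOuter_rot_symm_bdry i) hd
        · rw [hb'] at h1
          rw [← Option.some.inj h1, ← hy]
          exact (G.rightFace_rot_symm_flip _).symm
    · rw [← Option.some.inj h1, ← hy]
      exact (G.rightFace_rot_symm_flip _).symm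
    · simp [F] at h1
  · rintro rfl
    let x := G.flip (G.rot d)
    have hx : G.rot.symm (G.flip x) = d := by simp [x, G.flip_flip]
    have hf : G.rightFace d = G.rightFace x := by rw [← hx, G.rightFace_rot_symm_flip]
    by_cases h : G.Inner x
    · refine ⟨PlusDart.wf x h, ⟨x, hf, ?_⟩, G.plusFaceAt_val_eq_iff.mpr hx⟩
      rw [faceDart, dif_pos h]
    · obtain ⟨i, hi⟩ := (G.not_inner h).resolve_right (fun ⟨i, hi⟩ => hd (by
        rw [← hx, hi, G.flip_flip]
        exact G.isOuter_rot_symm_bdry i))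
      refine ⟨PlusDart.vw (G.flip x), ⟨x, hf, ?_⟩, G.plusFaceAt_val_eq_iff.mpr hx⟩
      rw [faceDart, dif_neg h, hi, ← G.plus_rot_vw_bdry]
      exact G.plus.tail_rot _

theorem plus_inner_wv_iff {x : G.Dart} : G.plus.Inner (PlusDart.wv x) ↔ G.Inner x := by
  constructor
  · intro h i
    refine ⟨fun hi => (h (evenIndex i)).1 ?_, fun hi => (h (oddIndex i)).2 ?_⟩
    · rw [hi]
      exact (G.plusBdry_evenIndex i).symm
    · rw [hi]
      change _ = G.plusFlipFun (G.plusBdry _)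
      rw [plusBdry_oddIndex]
      rfl
  · intro h j
    change PlusDart.wv x ≠ G.plusBdry j ∧ PlusDart.wv x ≠ G.plusFlipFun (G.plusBdry j)
    rcases eq_evenIndex_or_oddIndex j with ⟨i, rfl⟩ | ⟨i, rfl⟩
    · rw [plusBdry_evenIndex]
      exact ⟨fun hi => (h i).1 (by injection hi), fun hi => by cases hi⟩
    · rw [plusBdry_oddIndex]
      exact ⟨fun hi => (by cases hi), fun hi => (h i).2 (by injection hi)⟩

theorem plus_inner_vw_iff {x : G.Dart} : G.plus.Inner (PlusDart.vw x) ↔ G.Inner x :=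
  (G.plus.inner_flip_iff (x := PlusDart.wv x)).trans G.plus_inner_wv_iff

theorem plus_inner_wf {x : G.Dart} (h : G.Inner x) : G.plus.Inner (PlusDart.wf x h) := by
  intro j
  change PlusDart.wf x h ≠ G.plusBdry j ∧ PlusDart.wf x h ≠ G.plusFlipFun (G.plusBdry j)
  rcases eq_evenIndex_or_oddIndex j with ⟨i, rfl⟩ | ⟨i, rfl⟩
  · rw [plusBdry_evenIndex]
    exact ⟨fun hi => (by cases hi), fun hi => by cases hi⟩
  · rw [plusBdry_oddIndex]
    exact ⟨fun hi => (by cases hi), fun hi => by cases hi⟩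

theorem plus_inner_fw {x : G.Dart} (h : G.Inner x) : G.plus.Inner (PlusDart.fw x h) :=
  (G.plus.inner_flip_iff (x := PlusDart.wf x h)).mpr (G.plus_inner_wf h)

end DiskMap

end ElecOG

/-! ### The strands of `G_+` -/

namespace ElecOG

namespace DiskMap

variable {n : ℕ} (G : DiskMap n)

theorem plus_zigNext_vw (x : G.Dart) :
    G.plus.zigNext (PlusDart.vw x) = PlusDart.wv (G.rot x) :=
  if_neg (fun h => h)

theorem plus_zigNext_wv {x : G.Dart} (h : G.Inner x) :
    G.plus.zigNext (PlusDart.wv x) = PlusDart.fw x h := by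
  refine (if_pos (c := G.plus.black (PlusDart.vw x)) h).trans ?_
  exact (Equiv.symm_apply_eq G.plus.rot).mpr rfl

theorem plus_zigNext_fw {x : G.Dart} (h : G.Inner x) :
    G.plus.zigNext (PlusDart.fw x h) = G.faceDart (G.rot.symm (G.flip x)) :=
  if_neg (fun h => h)

theorem plus_zigNext_wf {x : G.Dart} (h : G.Inner x) :
    G.plus.zigNext (PlusDart.wf x h) = PlusDart.vw (G.flip x) := by
  refine (if_pos (c := G.plus.black (PlusDart.fw x h)) trivial).trans ?_
  refine (Equiv.symm_apply_eq G.plus.rot).mpr ?_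
  rw [G.plus_rot_vw_of_inner (G.inner_flip h)]
  change PlusDart.fw x h = PlusDart.fw (G.flip (G.flip x)) _
  congr 1
  exact (G.flip_flip x).symm

/-- The directed edge of the medial graph that runs along a dart of `G_+`, on its left side.
The strands of `G_+` run along the medial strands. -/
def medialOf : G.PlusDart → G.Dart × Bool
  | PlusDart.wv x => (G.rot.symm x, true)
  | PlusDart.vw x => (x, true)
  | PlusDart.wf x _ => (x, false)
  | PlusDart.fw x _ => (G.rot.symm (G.flip x), false)

theorem cornerOf_plus_flip (y : G.plus.Dart) :
    G.cornerOf (G.plus.flip y) = (G.medialOf y).1 := by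
  rcases y with x | x | ⟨x, h⟩ | ⟨x, h⟩ <;> rfl

theorem medialEnd_evenIndex (i : Fin n) :
    G.medialEnd (evenIndex i) = (G.rot.symm (G.rot.symm (G.bdry i)), true) := by
  have h1 : ((evenIndex i : Fin (n + n)) : ℕ) % 2 = 0 := by simp only [evenIndex]; omega
  rw [medialEnd, medialCorner_evenIndex, decide_eq_true h1]

theorem medialEnd_oddIndex (i : Fin n) : G.medialEnd (oddIndex i) = (G.bdry i, false) := by
  have h1 : ¬ ((oddIndex i : Fin (n + n)) : ℕ) % 2 = 0 := by simp only [oddIndex]; omega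
  rw [medialEnd, medialCorner_oddIndex, decide_eq_false h1]

theorem plus_rot_symm_bdry_evenIndex (i : Fin n) :
    G.plus.rot.symm (G.plus.bdry (evenIndex i)) = PlusDart.wv (G.rot.symm (G.bdry i)) := by
  refine (Equiv.symm_apply_eq G.plus.rot).mpr ?_
  refine (G.plusBdry_evenIndex i).trans ?_
  change _ = PlusDart.wv (G.rot (G.rot.symm (G.bdry i)))
  rw [Equiv.apply_symm_apply]

theorem plus_rot_symm_bdry_oddIndex (i : Fin n) :
    G.plus.rot.symm (G.plus.bdry (oddIndex i)) = PlusDart.vw (G.bdry i) := by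
  refine (Equiv.symm_apply_eq G.plus.rot).mpr ?_
  rw [G.plus_rot_vw_bdry]
  exact G.plusBdry_oddIndex i

theorem plus_zigEndsAt_vw {j : Fin (n + n)} {x : G.Dart} :
    G.plus.ZigEndsAt j (PlusDart.vw x) ↔
      PlusDart.wv (G.rot x) = G.plus.rot.symm (G.plus.bdry j) := by
  unfold BipDiskMap.ZigEndsAt
  rw [G.plus_zigNext_vw]
  exact iff_of_eq (congrArg _ (if_neg (fun h => h)))

theorem plus_zigEndsAt_fw {j : Fin (n + n)} {x : G.Dart} {h : G.Inner x} :
    G.plus.ZigEndsAt j (PlusDart.fw x h) ↔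
      G.faceDart (G.rot.symm (G.flip x)) = G.plus.rot.symm (G.plus.bdry j) := by
  unfold BipDiskMap.ZigEndsAt
  rw [G.plus_zigNext_fw]
  exact iff_of_eq (congrArg _ (if_neg (fun h => h)))

variable {G}

/-- A strand of `G_+` that leaves the disk at `d_j` runs along a medial strand that ends at `t_j`. -/
theorem medialOf_eq_medialEnd {j : Fin (n + n)} {y : G.plus.Dart} (hy : G.plus.Inner y)
    (h : G.plus.ZigEndsAt j y) : G.medialOf y = G.medialEnd j := by
  rcases y with x | x | ⟨x, hx⟩ | ⟨x, hx⟩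
  · exfalso
    have hx := G.plus_inner_wv_iff.mp hy
    unfold BipDiskMap.ZigEndsAt at h
    rw [G.plus_zigNext_wv hx] at h
    replace h := h.trans (if_pos (c := G.plus.black (PlusDart.vw x)) hx)
    exact (G.plus_inner_fw hx j).1 h
  · rw [plus_zigEndsAt_vw] at h
    rcases eq_evenIndex_or_oddIndex j with ⟨i, rfl⟩ | ⟨i, rfl⟩
    · rw [G.plus_rot_symm_bdry_evenIndex] at h
      rw [G.medialEnd_evenIndex, ← PlusDart.wv.inj h, Equiv.symm_apply_apply]
      rfl
    · rw [G.plus_rot_symm_bdry_oddIndex] at h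
      cases h
  · exfalso
    unfold BipDiskMap.ZigEndsAt at h
    rw [G.plus_zigNext_wf hx] at h
    replace h := h.trans (if_pos (c := G.plus.black (PlusDart.fw x hx)) trivial)
    exact (G.plus_inner_vw_iff.mpr (G.inner_flip hx) j).1 h
  · rw [plus_zigEndsAt_fw] at h
    rcases eq_evenIndex_or_oddIndex j with ⟨i, rfl⟩ | ⟨i, rfl⟩
    · rw [G.plus_rot_symm_bdry_evenIndex] at h
      unfold faceDart at h
      split_ifs at h
    · rw [G.plus_rot_symm_bdry_oddIndex] at h
      rw [G.medialEnd_oddIndex]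
      unfold faceDart at h
      split_ifs at h
      rw [← PlusDart.vw.inj h]
      rfl

theorem zigStrand_inner {j : Fin (n + n)} {y : G.plus.Dart} (h : G.plus.ZigStrand j y) :
    G.plus.Inner y := by
  cases h <;> assumption

theorem medialStrand_of_zigStrand {j : Fin (n + n)} {y : G.plus.Dart}
    (h : G.plus.ZigStrand j y) : G.MedialStrand j (G.medialRev (G.medialOf y)) := by
  have key : ∀ a, G.Inner (G.medialHead a) →
      G.MedialStrand j (G.medialRev (G.medialNext a)) → G.MedialStrand j (G.medialRev a) := by
    intro a ha h
    rw [← G.medialNext_medialRev_medialNext]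
    refine h.next _ ?_
    rw [G.medialHead_medialRev_medialNext]
    exact G.inner_flip ha
  induction h with
  | last y hy h =>
    rw [medialOf_eq_medialEnd hy h, medialEnd_eq, G.medialRev_medialRev]
    exact MedialStrand.start
  | pred y hy h ih =>
    have hn := zigStrand_inner h
    rcases y with x | x | ⟨x, hx⟩ | ⟨x, hx⟩
    · have hx := G.plus_inner_wv_iff.mp hy
      rw [G.plus_zigNext_wv hx] at ih
      refine key (G.rot.symm x, true) (by simpa [medialHead] using hx) ?_
      change G.MedialStrand j (G.rot.symm (G.flip (G.rot (G.rot.symm x))), true)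
      rw [Equiv.apply_symm_apply]
      exact ih
    · rw [G.plus_zigNext_vw] at ih
      change G.MedialStrand j (G.rot.symm (G.rot x), false) at ih
      rwa [Equiv.symm_apply_apply] at ih
    · rw [G.plus_zigNext_wf hx] at ih
      exact key (x, false) hx ih
    · rw [G.plus_zigNext_fw hx] at ih hn
      unfold faceDart at ih hn
      split_ifs at ih hn with h1
      · exact ih
      · exact absurd (G.plus_inner_vw_iff.mp hn) h1

theorem zigStrand_of_medialStrand {j : Fin (n + n)} {a : G.Dart × Bool} (h : G.MedialStrand j a) :
    ∀ y : G.plus.Dart, G.plus.Inner y → G.medialOf y = G.medialRev a → G.plus.ZigStrand j y := by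
  induction h with
  | start =>
    intro y hy h
    refine BipDiskMap.ZigStrand.last y hy ?_
    rw [← medialEnd_eq] at h
    rcases eq_evenIndex_or_oddIndex j with ⟨i, rfl⟩ | ⟨i, rfl⟩
    · rw [G.medialEnd_evenIndex] at h
      rcases y with x | x | ⟨x, hx⟩ | ⟨x, hx⟩ <;> simp only [medialOf, Prod.mk.injEq] at h
      · have h1 := G.rot.symm.injective h.1
        have h2 := G.plus_inner_wv_iff.mp hy
        exact absurd (h1 ▸ G.isOuter_rot_symm_bdry i) (G.not_isOuter_of_inner h2)
      · rw [plus_zigEndsAt_vw, G.plus_rot_symm_bdry_evenIndex, h.1, Equiv.apply_symm_apply]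
      · cases h.2
      · cases h.2
    · rw [G.medialEnd_oddIndex] at h
      rcases y with x | x | ⟨x, hx⟩ | ⟨x, hx⟩ <;> simp only [medialOf, Prod.mk.injEq] at h
      · cases h.2
      · cases h.2
      · exact absurd h.1 (hx i).1
      · rw [plus_zigEndsAt_fw, G.plus_rot_symm_bdry_oddIndex, h.1, faceDart,
          dif_neg (G.not_inner_bdry i)]
  | next a _ hi ih =>
    obtain ⟨d, b⟩ := a
    cases b
    · have hd : G.Inner d := hi
      have h1 : G.plus.ZigStrand j (PlusDart.wf (G.flip d) (G.inner_flip hd)) := by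
        refine BipDiskMap.ZigStrand.pred _ (G.plus_inner_wf _) ?_
        rw [G.plus_zigNext_wf, G.flip_flip]
        exact ih _ (G.plus_inner_vw_iff.mpr hd) rfl
      intro y hy h
      change _ = (G.flip d, false) at h
      rcases y with x | x | ⟨x, hx⟩ | ⟨x, hx⟩ <;> simp only [medialOf, Prod.mk.injEq] at h
      · cases h.2
      · cases h.2
      · obtain ⟨rfl, -⟩ := h
        exact h1
      · refine BipDiskMap.ZigStrand.pred _ hy ?_
        rw [G.plus_zigNext_fw, h.1, faceDart, dif_pos (G.inner_flip hd)]
        exact h1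
    · have hx : G.Inner (G.rot d) := hi
      have h1 : G.plus.ZigStrand j (PlusDart.wv (G.flip (G.rot d))) := by
        refine BipDiskMap.ZigStrand.pred _ (G.plus_inner_wv_iff.mpr (G.inner_flip hx)) ?_
        rw [G.plus_zigNext_wv (G.inner_flip hx)]
        refine ih _ (G.plus_inner_fw _) ?_
        change (G.rot.symm (G.flip (G.flip (G.rot d))), false) = (d, false)
        rw [G.flip_flip, Equiv.symm_apply_apply]
      intro y hy h
      change _ = (G.rot.symm (G.flip (G.rot d)), true) at h
      rcases y with x | x | ⟨x, hx⟩ | ⟨x, hx⟩ <;> simp only [medialOf, Prod.mk.injEq] at h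
      · rwa [G.rot.symm.injective h.1]
      · refine BipDiskMap.ZigStrand.pred _ hy ?_
        rw [G.plus_zigNext_vw, h.1, Equiv.apply_symm_apply]
        exact h1
      · cases h.2
      · cases h.2

theorem zigStrand_iff {j : Fin (n + n)} {y : G.plus.Dart} (hy : G.plus.Inner y) :
    G.plus.ZigStrand j y ↔ G.MedialStrand j (G.medialRev (G.medialOf y)) :=
  ⟨medialStrand_of_zigStrand, fun h =>
    zigStrand_of_medialStrand h y hy (G.medialRev_medialRev _).symm⟩

end DiskMap

end ElecOG

/-! ### The face labels of `G_+` -/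

namespace ElecOG

/-- A property that is preserved by all steps around a cycle of a permutation but one holds
everywhere on the cycle or nowhere. -/
theorem sameCycle_iff_of_step {α : Type*} [Finite α] {σ : Equiv.Perm α} {P : α → Prop} {z : α}
    (h : ∀ x, σ.SameCycle z x → σ x ≠ z → (P x ↔ P (σ x))) {x y : α} (hx : σ.SameCycle z x)
    (hy : σ.SameCycle z y) : P x ↔ P y := by
  classical
  have key : ∀ x, σ.SameCycle z x → (P x ↔ P z) := by
    intro x hx
    have hex : ∃ m : ℕ, (σ ^ m) z = x := hx.exists_nat_pow_eq
    obtain ⟨hk, hmin⟩ := And.intro (Nat.find_spec hex) fun m => Nat.find_min hex (m := m)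
    generalize Nat.find hex = k at hk hmin
    have H : ∀ m ≤ k, (P ((σ ^ m) z) ↔ P z) := by
      intro m
      induction m with
      | zero => exact fun _ => Iff.rfl
      | succ m ih =>
        intro hm
        rw [← ih (by omega), pow_succ', Equiv.Perm.mul_apply]
        refine (h _ (Equiv.Perm.sameCycle_pow_right.mpr (Equiv.Perm.SameCycle.refl _ z))
          fun h1 => hmin (k - (m + 1)) (by omega) ?_).symm
        rw [← Equiv.Perm.mul_apply, ← pow_succ'] at h1
        rw [← hk, ← Nat.sub_add_cancel hm, pow_add, Equiv.Perm.mul_apply, h1, Nat.add_sub_cancel]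
    rw [← hk]
    exact H k le_rfl
  rw [key x hx, key y hy]

namespace DiskMap

variable {n : ℕ} {G : DiskMap n}

/-- Two faces of `G_+` around corners at the same vertex, separated by one edge of `G_+`. -/
theorem plus_adjOff_rot_symm {j : Fin (n + n)} {x : G.Dart} (hx : G.Inner x)
    {h : ¬ G.IsOuter x} {h' : ¬ G.IsOuter (G.rot.symm x)}
    (h1 : ¬ G.MedialStrand j (x, false)) (h2 : ¬ G.MedialStrand j (G.rot.symm x, false)) :
    G.plus.AdjOff j (G.plusFaceAt x h) (G.plusFaceAt (G.rot.symm x) h') := by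
  refine ⟨PlusDart.wv x, G.plus_inner_wv_iff.mpr hx, rfl, G.plusFaceAt_val_eq_iff.mpr rfl, ?_, ?_⟩
  · exact fun h => h2 (medialStrand_of_zigStrand h)
  · exact fun h => h1 (medialStrand_of_zigStrand h)

/-- Two faces of `G_+` around corners of the same face, separated by one edge of `G_+`. -/
theorem plus_adjOff_rot_symm_flip {j : Fin (n + n)} {x : G.Dart} (hx : G.Inner x)
    {h : ¬ G.IsOuter x} {h' : ¬ G.IsOuter (G.rot.symm (G.flip x))}
    (h1 : ¬ G.MedialStrand j (x, true)) (h2 : ¬ G.MedialStrand j (G.rot.symm (G.flip x), true)) :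
    G.plus.AdjOff j (G.plusFaceAt x h) (G.plusFaceAt (G.rot.symm (G.flip x)) h') := by
  refine ⟨PlusDart.fw x hx, G.plus_inner_fw hx, G.plusFaceAt_val_eq_iff.mpr rfl,
    G.plusFaceAt_val_eq_iff.mpr rfl, ?_, ?_⟩
  · exact fun h => h2 (medialStrand_of_zigStrand h)
  · exact fun h => h1 (medialStrand_of_zigStrand h)

theorem leftOfStrand_tail {k : Fin (n + n)} {d : G.Dart} (h : G.MedialStrand k (d, false)) :
    G.LeftOfStrand k (Sum.inl (G.tail d)) :=
  ⟨(d, false), Sum.inl (G.tail d), h, ⟨rfl, rfl⟩, Relation.EqvGen.refl _⟩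

theorem leftOfStrand_face {k : Fin (n + n)} {d : G.Dart} (hd : ¬ G.IsOuter d)
    (h : G.MedialStrand k (d, true)) : G.LeftOfStrand k (Sum.inr (G.faceAt d hd)) :=
  ⟨(d, true), Sum.inr (G.faceAt d hd), h, ⟨rfl, rfl⟩, Relation.EqvGen.refl _⟩

theorem leftOfStrand_tail_of_face {k : Fin (n + n)} {d : G.Dart} {hd : ¬ G.IsOuter d}
    (h : ¬ G.MedialStrand k (d, true)) (h1 : G.LeftOfStrand k (Sum.inr (G.faceAt d hd))) :
    G.LeftOfStrand k (Sum.inl (G.tail d)) := by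
  by_cases h2 : G.MedialStrand k (d, false)
  · exact leftOfStrand_tail h2
  · obtain ⟨a, w, ha, hw, hwu⟩ := h1
    exact ⟨a, w, ha, hw, hwu.trans _ _ _ (.symm _ _ (.rel _ _ ⟨d, _, rfl, rfl, rfl, h, h2⟩))⟩

theorem leftOfStrand_face_of_tail {k : Fin (n + n)} {d : G.Dart} {hd : ¬ G.IsOuter d}
    (h : ¬ G.MedialStrand k (d, false)) (h1 : G.LeftOfStrand k (Sum.inl (G.tail d))) :
    G.LeftOfStrand k (Sum.inr (G.faceAt d hd)) := by
  by_cases h2 : G.MedialStrand k (d, true)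
  · exact leftOfStrand_face hd h2
  · obtain ⟨a, w, ha, hw, hwu⟩ := h1
    exact ⟨a, w, ha, hw, hwu.trans _ _ _ (.rel _ _ ⟨d, _, rfl, rfl, rfl, h2, h⟩)⟩

/-- The vertex or the face of `G` at the corner `d` is on the left of the strand starting at
`t_k`. -/
def CornerLeft (G : DiskMap n) (k : Fin (n + n)) (d : G.Dart) : Prop :=
  G.LeftOfStrand k (Sum.inl (G.tail d)) ∨
    ∃ hd : ¬ G.IsOuter d, G.LeftOfStrand k (Sum.inr (G.faceAt d hd))

theorem cornerLeft_iff_tail {k : Fin (n + n)} {d : G.Dart} (h : ¬ G.MedialStrand k (d, true)) :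
    G.CornerLeft k d ↔ G.LeftOfStrand k (Sum.inl (G.tail d)) :=
  ⟨fun h1 => h1.elim id fun ⟨_, h2⟩ => leftOfStrand_tail_of_face h h2, Or.inl⟩

theorem cornerLeft_iff_face {k : Fin (n + n)} {d : G.Dart} (hd : ¬ G.IsOuter d)
    (h : ¬ G.MedialStrand k (d, false)) :
    G.CornerLeft k d ↔ G.LeftOfStrand k (Sum.inr (G.faceAt d hd)) :=
  ⟨fun h1 => h1.elim (leftOfStrand_face_of_tail h) fun ⟨_, h2⟩ => h2, fun h1 => Or.inr ⟨hd, h1⟩⟩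

/-- Crossing an edge of `G_+` that is not on the strand ending at `d_j` does not change whether the
vertex or the face at the corner is on the left. -/
theorem IsWellConnected.cornerLeft_iff_of_inner (hG : G.IsWellConnected) {j : Fin (n + n)}
    {z : G.plus.Dart} (hz : G.plus.Inner z) (h1 : ¬ G.plus.ZigStrand j z)
    (h2 : ¬ G.plus.ZigStrand j (G.plus.flip z)) :
    G.CornerLeft (opp j) (G.cornerOf z) ↔ G.CornerLeft (opp j) (G.cornerOf (G.plus.flip z)) := by
  have H1 : ∀ x, ¬ G.plus.ZigStrand j (PlusDart.wv x) → ¬ G.plus.ZigStrand j (PlusDart.vw x) →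
      G.Inner x → (G.CornerLeft (opp j) x ↔ G.CornerLeft (opp j) (G.rot.symm x)) := by
    intro x h1 h2 hx
    rw [zigStrand_iff (G.plus_inner_wv_iff.mpr hx), medialRev,
      ← hG.medialStrand_opp] at h1
    rw [zigStrand_iff (G.plus_inner_vw_iff.mpr hx), medialRev,
      ← hG.medialStrand_opp] at h2
    have e1 := cornerLeft_iff_tail (d := x) h2
    have e2 := cornerLeft_iff_tail (d := G.rot.symm x) h1
    rw [e1, e2, G.tail_rot_symm]
  have H2 : ∀ x hx, ¬ G.plus.ZigStrand j (PlusDart.wf x hx) →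
      ¬ G.plus.ZigStrand j (PlusDart.fw x hx) →
      (G.CornerLeft (opp j) x ↔ G.CornerLeft (opp j) (G.rot.symm (G.flip x))) := by
    intro x hx h1 h2
    rw [zigStrand_iff (G.plus_inner_wf hx), medialRev, ← hG.medialStrand_opp] at h1
    rw [zigStrand_iff (G.plus_inner_fw hx), medialRev, ← hG.medialStrand_opp] at h2
    have hf : G.faceAt (G.rot.symm (G.flip x)) (G.not_isOuter_rot_symm fun i =>
        (G.inner_flip hx i).1) = G.faceAt x (G.not_isOuter_of_inner hx) :=
      Subtype.ext (G.rightFace_rot_symm_flip x)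
    rw [cornerLeft_iff_face (G.not_isOuter_of_inner hx) h1,
      cornerLeft_iff_face (G.not_isOuter_rot_symm fun i => (G.inner_flip hx i).1) h2, hf]
  rcases z with x | x | ⟨x, hx⟩ | ⟨x, hx⟩
  · exact H1 x h1 h2 (G.plus_inner_wv_iff.mp hz)
  · exact (H1 x h2 h1 (G.plus_inner_vw_iff.mp hz)).symm
  · exact (H2 x hx h1 h2).symm
  · exact H2 x hx h2 h1

/-- A face of `G_+` on the left of the strand ending at `d_j` belongs to a corner whose vertex or
face is on the left of the medial strand ending at `t_j`. -/
theorem IsWellConnected.cornerLeft_of_plus_leftOfStrand (hG : G.IsWellConnected) {j : Fin (n + n)}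
    {d : G.Dart} {hd : ¬ G.IsOuter d} (h : G.plus.LeftOfStrand j (G.plusFaceAt d hd)) :
    G.CornerLeft (opp j) d := by
  have hadj : ∀ f g : G.plus.Face, Relation.EqvGen (G.plus.AdjOff j) f g →
      ∀ d hd e he, f = G.plusFaceAt d hd → g = G.plusFaceAt e he →
        (G.CornerLeft (opp j) d ↔ G.CornerLeft (opp j) e) := by
    have hinj : ∀ d hd e he, G.plusFaceAt d hd = G.plusFaceAt e he → d = e := by
      intro d hd e he h
      exact (G.plusFaceAt_val_eq_iff (y := PlusDart.wv e) (hd := hd)).mp (congrArg Subtype.val h) |>.symm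
    intro f g h
    induction h with
    | rel f g h =>
      rintro d hd e he rfl rfl
      obtain ⟨z, hz, h1, h2, h3, h4⟩ := h
      rw [plusFaceAt_val_eq_iff] at h1 h2
      rw [← h1, ← h2]
      exact hG.cornerLeft_iff_of_inner hz h3 h4
    | refl f =>
      rintro d hd e he rfl h
      rw [hinj _ _ _ _ h]
    | symm f g _ ih => exact fun d hd e he h1 h2 => (ih e he d hd h2 h1).symm
    | trans f g k _ _ ih ih' =>
      intro d hd e he h1 h2
      obtain ⟨c, hc, h3⟩ := G.exists_plusFaceAt g
      exact (ih d hd c hc h1 h3).trans (ih' c hc e he h3 h2)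
  obtain ⟨y, g, hy, hg, hgd⟩ := h
  obtain ⟨e, he, rfl⟩ := G.exists_plusFaceAt g
  rw [← hadj _ _ hgd e he d hd rfl rfl]
  rw [plusFaceAt_val_eq_iff, cornerOf_plus_flip] at hg
  have h1 := medialStrand_of_zigStrand hy
  rw [medialRev, ← hG.medialStrand_opp, Prod.mk.eta] at h1
  rcases hm : G.medialOf y with ⟨c, b⟩
  rw [hm] at hg h1
  obtain rfl : c = e := hg
  cases b
  · exact Or.inl (leftOfStrand_tail h1)
  · exact Or.inr ⟨he, leftOfStrand_face he h1⟩

/-- If there are at least two boundary vertices, then one of the two sides of a corner is an edge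
of the graph itself. -/
theorem IsWellConnected.inner_or_inner_rot (hG : G.IsWellConnected) (hn : 2 ≤ n) {d : G.Dart}
    (hd : ¬ G.IsOuter d) : G.Inner d ∨ G.Inner (G.rot d) := by
  by_contra! h
  obtain ⟨i, rfl⟩ := (G.not_inner h.1).resolve_right hd
  rcases G.not_inner h.2 with ⟨k, hk⟩ | ⟨k, hk⟩
  · refine hd ?_
    rw [← Equiv.symm_apply_apply G.rot (G.bdry i), hk]
    exact G.isOuter_rot_symm_bdry k
  · have h1 : G.tail (G.bdry i) = G.tail (G.bdry (cyc k)) := by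
      rw [← G.tail_rot, hk, ← G.tail_rot, G.rot_flip_bdry]
    obtain rfl := hG.planar.boundary_distinct _ _ h1
    have h2 : G.medialCorner (evenIndex (cyc k)) = G.bdry (cyc k) := by
      rw [medialCorner_evenIndex, G.rot_symm_bdry_cyc, ← hk, Equiv.symm_apply_apply]
    have h3 : G.OnStrand (oddIndex (cyc k)) (G.medialCorner (evenIndex (cyc k))) := by
      rw [h2, ← medialCorner_oddIndex, hG.onStrand_medialCorner_iff]
      exact Or.inl rfl
    rw [hG.onStrand_medialCorner_iff] at h3
    have h4 := (cyc k).isLt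
    have h5 : ∀ j : Fin (n + n), (opp j : ℕ) = j + n ∨ (opp j : ℕ) + n = j := by
      intro j
      simp only [opp]
      split_ifs <;> omega
    have h6 := h5 (evenIndex (cyc k))
    simp only [Fin.ext_iff] at h3
    generalize (opp (evenIndex (cyc k)) : ℕ) = m at h3 h6
    simp only [oddIndex, evenIndex] at h3 h6
    omega

/-- The face of `G_+` around a corner on a medial strand is on the left of both strands of `G_+`
that run along this medial strand. -/
theorem IsWellConnected.plus_leftOfStrand_of_onStrand (hG : G.IsWellConnected) (hn : 2 ≤ n)
    {j : Fin (n + n)} {d : G.Dart} (hd : ¬ G.IsOuter d) (h : G.OnStrand j d) :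
    G.plus.LeftOfStrand j (G.plusFaceAt d hd) := by
  have key : ∀ y : G.plus.Dart, G.plus.Inner y → ∀ b, G.medialOf y = (d, !b) →
      G.MedialStrand j (d, b) → G.plus.LeftOfStrand j (G.plusFaceAt d hd) := by
    intro y hy b h1 h2
    refine ⟨y, _, (zigStrand_iff hy).mpr ?_, ?_, Relation.EqvGen.refl _⟩
    · rwa [h1, medialRev, Bool.not_not]
    · rw [plusFaceAt_val_eq_iff, cornerOf_plus_flip, h1]
  have e1 : G.rot.symm (G.flip (G.flip (G.rot d))) = d := by
    rw [G.flip_flip, Equiv.symm_apply_apply]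
  rcases h with h | h <;> rcases hG.inner_or_inner_rot hn hd with h1 | h1
  · exact key (PlusDart.wf d h1) (G.plus_inner_wf h1) true rfl h
  · exact key (PlusDart.fw _ (G.inner_flip h1)) (G.plus_inner_fw _) true
      (congrArg (·, false) e1) h
  · exact key (PlusDart.vw d) (G.plus_inner_vw_iff.mpr h1) false rfl h
  · exact key (PlusDart.wv (G.rot d)) (G.plus_inner_wv_iff.mpr h1) false
      (congrArg (·, true) (Equiv.symm_apply_apply _ _)) h

/-- The face of `G_+` around the corner `d` is on the left of one of the two strands of `G_+` ending
at `d_j` and at `d_{j ± n}`. -/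
def PlusLeftOfSome (G : DiskMap n) (j : Fin (n + n)) (d : G.Dart) : Prop :=
  ∃ hd : ¬ G.IsOuter d, G.plus.LeftOfStrand j (G.plusFaceAt d hd) ∨
    G.plus.LeftOfStrand (opp j) (G.plusFaceAt d hd)

/-- Crossing an edge of `G_+`, here between the faces around `d` and `e`: if `d` lies on the strand,
then the edge belongs to only one of the two strands of `G_+`, and the other one has the same sides
at `d` and `e`. -/
theorem IsWellConnected.plusLeftOfSome_of_adjOff (hG : G.IsWellConnected) (hn : 2 ≤ n)
    {j : Fin (n + n)} {d e : G.Dart} (he : ¬ G.IsOuter e) (b : Bool)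
    (h : ∀ k hd, ¬ G.MedialStrand k (d, b) → ¬ G.MedialStrand k (e, b) →
      Relation.EqvGen (G.plus.AdjOff k) (G.plusFaceAt d hd) (G.plusFaceAt e he))
    (H : G.PlusLeftOfSome j d) : G.PlusLeftOfSome j e := by
  obtain ⟨hd, H⟩ := H
  refine ⟨he, ?_⟩
  have hl : ∀ k, ¬ G.MedialStrand k (d, b) → ¬ G.MedialStrand k (e, b) →
      G.plus.LeftOfStrand k (G.plusFaceAt d hd) → G.plus.LeftOfStrand k (G.plusFaceAt e he) := by
    rintro k h1 h2 ⟨y, g, hy, hg, hgd⟩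
    exact ⟨y, g, hy, hg, hgd.trans _ _ _ (h k hd h1 h2)⟩
  have hon : ∀ k c x, G.MedialStrand k (x, c) → G.OnStrand k x := by
    intro k c x h
    cases c
    · exact Or.inr h
    · exact Or.inl h
  by_cases h1 : G.OnStrand j e
  · exact Or.inl (hG.plus_leftOfStrand_of_onStrand hn he h1)
  have h2 : ¬ G.MedialStrand j (e, b) := fun h => h1 (hon _ _ _ h)
  have h3 : ¬ G.MedialStrand (opp j) (e, b) := fun h => h1 (hG.onStrand_opp.mp (hon _ _ _ h))
  by_cases h4 : G.OnStrand j d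
  · by_cases h5 : G.MedialStrand j (d, b)
    · refine Or.inr (hl _ (fun h6 => ?_) h3
        (hG.plus_leftOfStrand_of_onStrand hn hd (hG.onStrand_opp.mpr h4)))
      exact hG.not_medialStrand_both h5 (hG.medialStrand_opp.mp h6)
    · exact Or.inl (hl _ h5 h2 (hG.plus_leftOfStrand_of_onStrand hn hd h4))
  · refine H.imp (hl _ (fun h => h4 (hon _ _ _ h)) h2) (hl _ (fun h => h4 ?_) h3)
    exact hG.onStrand_opp.mp (hon _ _ _ h)

theorem IsWellConnected.plusLeftOfSome_rot_symm_iff (hG : G.IsWellConnected) (hn : 2 ≤ n)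
    {j : Fin (n + n)} {x : G.Dart} (hx : G.Inner x) :
    G.PlusLeftOfSome j (G.rot.symm x) ↔ G.PlusLeftOfSome j x := by
  have h1 := G.not_isOuter_of_inner hx
  have h2 := G.not_isOuter_rot_symm fun i => (hx i).1
  constructor
  · refine hG.plusLeftOfSome_of_adjOff hn h1 false fun k _ h3 h4 => ?_
    exact .symm _ _ (.rel _ _ (plus_adjOff_rot_symm hx h4 h3))
  · refine hG.plusLeftOfSome_of_adjOff hn h2 false fun k _ h3 h4 => ?_
    exact .rel _ _ (plus_adjOff_rot_symm hx h3 h4)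

theorem IsWellConnected.plusLeftOfSome_rot_symm_flip_iff (hG : G.IsWellConnected) (hn : 2 ≤ n)
    {j : Fin (n + n)} {x : G.Dart} (hx : G.Inner x) :
    G.PlusLeftOfSome j (G.rot.symm (G.flip x)) ↔ G.PlusLeftOfSome j x := by
  have h1 := G.not_isOuter_of_inner hx
  have h2 := G.not_isOuter_rot_symm fun i => (G.inner_flip hx i).1
  constructor
  · refine hG.plusLeftOfSome_of_adjOff hn h1 true fun k _ h3 h4 => ?_
    exact .symm _ _ (.rel _ _ (plus_adjOff_rot_symm_flip hx h4 h3))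
  · refine hG.plusLeftOfSome_of_adjOff hn h2 true fun k _ h3 h4 => ?_
    exact .rel _ _ (plus_adjOff_rot_symm_flip hx h3 h4)

/-- Walking around a vertex: only the step across the outer face, at most one for each vertex, is not a
step across an edge of `G_+`. -/
theorem IsWellConnected.plusLeftOfSome_of_tail_eq (hG : G.IsWellConnected) (hn : 2 ≤ n)
    {j : Fin (n + n)} {d e : G.Dart} (hd : ¬ G.IsOuter d) (he : ¬ G.IsOuter e)
    (h : G.tail d = G.tail e) : G.PlusLeftOfSome j d ↔ G.PlusLeftOfSome j e := by
  classical
  have := G.finite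
  -- the outer corner at a boundary vertex gets the value of its predecessor
  let P : G.Dart → Prop := fun x =>
    if G.IsOuter x then G.PlusLeftOfSome j (G.rot.symm x) else G.PlusLeftOfSome j x
  have hP : ∀ x, ¬ G.IsOuter x → (P x ↔ G.PlusLeftOfSome j x) := fun x hx => by
    simp only [P, if_neg hx]
  have hstep : ∀ x, (∀ i, G.rot x ≠ G.bdry i) → (P x ↔ P (G.rot x)) := by
    intro x hx
    have h1 : ¬ G.IsOuter x := by
      have := G.not_isOuter_rot_symm hx
      rwa [Equiv.symm_apply_apply] at this
    by_cases h2 : G.IsOuter (G.rot x)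
    · simp only [P, if_neg h1, if_pos h2, Equiv.symm_apply_apply]
    · have h3 : G.Inner (G.rot x) := ?_
      · rw [hP _ h1, hP _ h2, ← hG.plusLeftOfSome_rot_symm_iff hn h3, Equiv.symm_apply_apply]
      by_contra h3
      exact (G.not_inner h3).elim (fun ⟨i, hi⟩ => hx i hi) h2
  rw [← hP _ hd, ← hP _ he]
  by_cases hi : ∃ i, G.tail d = G.tail (G.bdry i)
  · obtain ⟨i, hi⟩ := hi
    refine sameCycle_iff_of_step (z := G.bdry i) (fun x hx hxi => hstep x fun k hk => hxi ?_)
      (Quotient.exact hi.symm) (Quotient.exact (hi.symm.trans h))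
    have h1 : G.tail (G.bdry i) = G.tail (G.bdry k) := by
      rw [← hk, G.tail_rot]
      exact Quotient.sound hx
    rw [hk, hG.planar.boundary_distinct _ _ h1]
  · refine sameCycle_iff_of_step (z := d) (fun x hx _ => hstep x fun k hk => hi ⟨k, ?_⟩)
      (Equiv.Perm.SameCycle.refl _ _) (Quotient.exact h)
    rw [← hk, G.tail_rot]
    exact Quotient.sound hx

/-- Walking around a face: only the step along an arc of the boundary circle, at most one for each
face, is not a step across an edge of `G_+`. -/
theorem IsWellConnected.plusLeftOfSome_of_rightFace_eq (hG : G.IsWellConnected) (hn : 2 ≤ n)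
    {j : Fin (n + n)} {d e : G.Dart} (hd : ¬ G.IsOuter d)
    (h : G.rightFace d = G.rightFace e) : G.PlusLeftOfSome j d ↔ G.PlusLeftOfSome j e := by
  have := G.finite
  have hsound : ∀ {x y}, G.faceRot.SameCycle x y → G.rightFace x = G.rightFace y :=
    fun h => Quotient.sound h
  have hstep : ∀ x, G.rightFace d = G.rightFace x → (∀ i, x ≠ G.bdry i) →
      (G.PlusLeftOfSome j x ↔ G.PlusLeftOfSome j (G.faceRot x)) := by
    intro x hx hxi
    have h1 := (G.isOuter_iff_of_rightFace_eq hx).not.mp hd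
    refine (hG.plusLeftOfSome_rot_symm_flip_iff hn ?_).symm
    by_contra h3
    exact (G.not_inner h3).elim (fun ⟨i, hi⟩ => hxi i hi) h1
  by_cases hi : ∃ i, G.rightFace d = G.rightFace (G.bdry i)
  · obtain ⟨i, hi⟩ := hi
    have h1 : G.rightFace (G.faceRot (G.bdry i)) = G.rightFace d := by
      rw [hi]
      exact G.rightFace_rot_symm_flip _
    refine sameCycle_iff_of_step (z := G.faceRot (G.bdry i)) (fun x hx hxi =>
      hstep x (h1.symm.trans (hsound hx)) fun k hk => hxi ?_)
      (Quotient.exact h1) (Quotient.exact (h1.trans h))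
    have h2 : G.rightFace (G.bdry i) = G.rightFace (G.bdry k) := by
      rw [← hk, ← hsound hx, h1, hi]
    rw [hk, hG.rightFace_bdry_injective h2]
  · refine sameCycle_iff_of_step (z := d) (fun x hx _ => hstep x (hsound hx) fun k hk =>
      hi ⟨k, ?_⟩) (Equiv.Perm.SameCycle.refl _ _) (Quotient.exact h)
    rw [← hk]
    exact hsound hx

/-- Every face of `G_+` is on the left of at least one of the two strands ending at `d_j` and
`d_{j ± n}`. -/
theorem IsWellConnected.plusLeftOfSome (hG : G.IsWellConnected) (hn : 2 ≤ n) (j : Fin (n + n))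
    {d : G.Dart} (hd : ¬ G.IsOuter d) : G.PlusLeftOfSome j d := by
  let F : G.Dart → Prop := fun x => ∀ d, ¬ G.IsOuter d → G.tail d = G.tail x → G.PlusLeftOfSome j d
  have hF : ∀ {x d}, ¬ G.IsOuter d → G.tail d = G.tail x → (F x ↔ G.PlusLeftOfSome j d) := by
    intro x d hd hdx
    refine ⟨fun h => h d hd hdx, fun h e he hex => ?_⟩
    exact (hG.plusLeftOfSome_of_tail_eq hn hd he (hdx.trans hex.symm)).mp h
  have hflip : ∀ x, ¬ G.IsOuter x → (F (G.flip x) ↔ F x) := by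
    intro x hx
    have h1 : G.rightFace (G.rot.symm (G.flip x)) = G.rightFace x := G.rightFace_rot_symm_flip x
    have h2 : ¬ G.IsOuter (G.rot.symm (G.flip x)) :=
      (G.isOuter_iff_of_rightFace_eq h1).not.mpr hx
    rw [hF h2 (G.tail_rot_symm _), hF hx rfl]
    exact hG.plusLeftOfSome_of_rightFace_eq hn h2 h1
  have h0 : F (G.medialCorner j) := by
    refine (hF (G.not_isOuter_medialCorner j) rfl).mpr ⟨G.not_isOuter_medialCorner j, Or.inl ?_⟩
    exact hG.plus_leftOfStrand_of_onStrand hn _ (hG.onStrand_medialCorner_iff.mpr (Or.inl rfl))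
  rw [hG.planar.eq_of_invariant (f := F) (fun x => by simp only [F, G.tail_rot])
    (fun x => propext ?_) _ d] at h0
  · exact h0 d hd rfl
  · by_cases hx : G.IsOuter x
    · obtain ⟨i, rfl⟩ := hx
      rw [← hflip (G.flip (G.flip (G.bdry i)))]
      · rw [G.flip_flip]
      · rw [G.flip_flip]
        exact G.not_isOuter_bdry i
    · exact hflip x hx

theorem mem_labelS {N : ℕ} {Γ : BipDiskMap N} {g : Γ.Face} {i : Fin N} :
    i ∈ Γ.labelS g ↔ Γ.LeftOfStrand i g := by
  simp [BipDiskMap.labelS]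

theorem mem_labelJ {u : G.Region} {i : Fin n} :
    i ∈ G.labelJ u ↔ G.LeftOfStrand (Fin.natAdd n i) u := by
  simp [labelJ, -Fin.natAdd_eq_addNat]

/-- The labels at a corner `d` on the strand `β_i`: the labels `J(v)` and `J(f)` of the vertex and
the face at `d` differ by `i`, and the label of the face of `G_+` around `d` is the union of the
larger one in the first half of `[2n]` and the complement of the smaller one in the second half. -/
theorem IsWellConnected.labelS_plusFaceAt (hG : G.IsWellConnected) (hn : 2 ≤ n) {d : G.Dart}
    (hd : ¬ G.IsOuter d) :
    (lowPart (G.plus.labelS (G.plusFaceAt d hd)) ∩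
      highPart (G.plus.labelS (G.plusFaceAt d hd))).card = 1 ∧
    (lowPart (G.plus.labelS (G.plusFaceAt d hd)) ∪
      highPart (G.plus.labelS (G.plusFaceAt d hd))).card = n ∧
    ((lowPart (G.plus.labelS (G.plusFaceAt d hd)) = G.labelJ (Sum.inl (G.tail d)) ∧
      Finset.univ \ highPart (G.plus.labelS (G.plusFaceAt d hd)) =
        G.labelJ (Sum.inr (G.faceAt d hd))) ∨
    (lowPart (G.plus.labelS (G.plusFaceAt d hd)) = G.labelJ (Sum.inr (G.faceAt d hd)) ∧
      Finset.univ \ highPart (G.plus.labelS (G.plusFaceAt d hd)) =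
        G.labelJ (Sum.inl (G.tail d)))) := by
  obtain ⟨i, hi⟩ : ∃ i : Fin n, G.OnStrand (Fin.castAdd n i) d := by
    obtain ⟨j, hj⟩ := hG.exists_onStrand hd
    induction j using Fin.addCases with
    | left i => exact ⟨i, hj⟩
    | right i => exact ⟨i, by rwa [← opp_natAdd, hG.onStrand_opp]⟩
  have hi' : G.OnStrand (Fin.natAdd n i) d := by rwa [← opp_castAdd, hG.onStrand_opp]
  have htot : ∀ k : Fin n, G.plus.LeftOfStrand (Fin.castAdd n k) (G.plusFaceAt d hd) ∨
      G.plus.LeftOfStrand (Fin.natAdd n k) (G.plusFaceAt d hd) := by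
    intro k
    obtain ⟨_, h⟩ := hG.plusLeftOfSome hn (Fin.castAdd n k) hd
    rwa [opp_castAdd] at h
  have hboth : ∀ (k : Fin n) u, G.LeftOfStrand (Fin.castAdd n k) u →
      ¬ G.LeftOfStrand (Fin.natAdd n k) u := by
    intro k u h
    rw [← opp_castAdd]
    exact hG.not_leftOfStrand_both h
  have hoff : ∀ k : Fin n, k ≠ i → ∀ b, ¬ G.MedialStrand (Fin.castAdd n k) (d, b) ∧
      ¬ G.MedialStrand (Fin.natAdd n k) (d, b) := by
    intro k hk b
    have h1 : ¬ G.OnStrand (Fin.castAdd n k) d := by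
      intro h
      rcases hG.onStrand_unique hi h with h2 | h2
      · exact hk (Fin.castAdd_injective n n h2)
      · rw [opp_castAdd] at h2
        have := congrArg Fin.val h2
        simp only [Fin.val_castAdd, Fin.val_natAdd] at this
        omega
    have h2 : ¬ G.OnStrand (Fin.natAdd n k) d := by rwa [← opp_castAdd, hG.onStrand_opp]
    unfold OnStrand at h1 h2
    cases b <;> tauto
  have hcast : ∀ k : Fin n, G.plus.LeftOfStrand (Fin.castAdd n k) (G.plusFaceAt d hd) →
      G.CornerLeft (Fin.natAdd n k) d := by
    intro k h
    rw [← opp_castAdd]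
    exact hG.cornerLeft_of_plus_leftOfStrand h
  have hnat : ∀ k : Fin n, G.plus.LeftOfStrand (Fin.natAdd n k) (G.plusFaceAt d hd) →
      G.CornerLeft (Fin.castAdd n k) d := by
    intro k h
    rw [← opp_natAdd]
    exact hG.cornerLeft_of_plus_leftOfStrand h
  have hv : ∀ k : Fin n, k ≠ i → (G.plus.LeftOfStrand (Fin.castAdd n k) (G.plusFaceAt d hd) ↔
      G.LeftOfStrand (Fin.natAdd n k) (Sum.inl (G.tail d))) := by
    intro k hk
    rw [← cornerLeft_iff_tail (hoff k hk true).2]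
    refine ⟨hcast k, fun h => (htot k).resolve_right fun h1 => ?_⟩
    exact hboth k _ ((cornerLeft_iff_tail (hoff k hk true).1).mp (hnat k h1))
      ((cornerLeft_iff_tail (hoff k hk true).2).mp h)
  have hf : ∀ k : Fin n, k ≠ i → (G.plus.LeftOfStrand (Fin.castAdd n k) (G.plusFaceAt d hd) ↔
      G.LeftOfStrand (Fin.natAdd n k) (Sum.inr (G.faceAt d hd))) := by
    intro k hk
    rw [hv k hk, ← cornerLeft_iff_tail (hoff k hk true).2,
      ← cornerLeft_iff_face hd (hoff k hk false).2]
  have hnot : ∀ k : Fin n, k ≠ i → (¬ G.plus.LeftOfStrand (Fin.natAdd n k) (G.plusFaceAt d hd) ↔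
      G.plus.LeftOfStrand (Fin.castAdd n k) (G.plusFaceAt d hd)) := by
    intro k hk
    refine ⟨(htot k).resolve_right, fun h h1 => ?_⟩
    exact hboth k _ ((cornerLeft_iff_tail (hoff k hk true).1).mp (hnat k h1)) ((hv k hk).mp h)
  have hci := hG.plus_leftOfStrand_of_onStrand hn hd hi
  have hni := hG.plus_leftOfStrand_of_onStrand hn hd hi'
  refine ⟨?_, ?_, ?_⟩
  · rw [Finset.card_eq_one]
    refine ⟨i, Finset.ext fun k => ?_⟩
    rw [Finset.mem_inter, mem_lowPart, mem_highPart, mem_labelS, mem_labelS, Finset.mem_singleton]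
    by_cases hk : k = i
    · subst hk
      exact iff_of_true ⟨hci, hni⟩ rfl
    · refine iff_of_false (fun h => (hnot k hk).mpr h.1 h.2) hk
  · convert Finset.card_fin n
    refine Finset.eq_univ_of_forall fun k => ?_
    rw [Finset.mem_union, mem_lowPart, mem_highPart, mem_labelS, mem_labelS]
    exact htot k
  · simp only [Finset.ext_iff, Finset.mem_sdiff, Finset.mem_univ, true_and, mem_lowPart,
      mem_highPart, mem_labelS, mem_labelJ]
    rcases hi' with h | h
    · right
      have h1 : G.LeftOfStrand (Fin.natAdd n i) (Sum.inr (G.faceAt d hd)) :=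
        leftOfStrand_face hd h
      have h2 : G.LeftOfStrand (Fin.castAdd n i) (Sum.inl (G.tail d)) := by
        rw [← opp_castAdd, hG.medialStrand_opp] at h
        exact leftOfStrand_tail h
      refine ⟨fun k => ?_, fun k => ?_⟩ <;> by_cases hk : k = i
      · subst hk
        exact iff_of_true hci h1
      · exact hf k hk
      · subst hk
        exact iff_of_false (fun h => h hni) (hboth _ _ h2)
      · rw [hnot k hk, hv k hk]
    · left
      have h1 : G.LeftOfStrand (Fin.natAdd n i) (Sum.inl (G.tail d)) :=
        leftOfStrand_tail h
      have h2 : G.LeftOfStrand (Fin.castAdd n i) (Sum.inr (G.faceAt d hd)) := by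
        rw [← opp_castAdd, hG.medialStrand_opp] at h
        exact leftOfStrand_face hd h
      refine ⟨fun k => ?_, fun k => ?_⟩ <;> by_cases hk : k = i
      · subst hk
        exact iff_of_true hci h1
      · exact hv k hk
      · subst hk
        exact iff_of_false (fun h => h hni) (hboth _ _ h2)
      · rw [hnot k hk, hf k hk]

theorem IsWellConnected.card_labelS (hG : G.IsWellConnected) (hn : 2 ≤ n) (g : G.plus.Face) :
    (G.plus.labelS g).card = n + 1 := by
  obtain ⟨d, hd, rfl⟩ := G.exists_plusFaceAt g
  obtain ⟨h1, h2, -⟩ := hG.labelS_plusFaceAt hn hd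
  rw [← card_lowPart_add_card_highPart, ← Finset.card_union_add_card_inter, h1, h2]

/-- The Plücker coordinate at a face of `G_+` is the product of the Cartan coordinates at the vertex
and the face of `G` to which it is incident. -/
theorem IsWellConnected.plucker_eta_labelS [NeZero n] (hG : G.IsWellConnected) (hn : 2 ≤ n)
    (x : DecOG n) {g : G.plus.Face} {v : G.Vertex} {f : G.Face}
    (hv : G.Incident g (Sum.inl v)) (hf : G.Incident g (Sum.inr f)) :
    (eta n x).plucker ⟨G.plus.labelS g, hG.card_labelS hn g⟩ =
      x.cartan (G.labelJ (Sum.inl v)) * x.cartan (G.labelJ (Sum.inr f)) := by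
  obtain ⟨d, hd, rfl⟩ := G.exists_plusFaceAt g
  rw [incident_inl_iff] at hv
  rw [incident_inr_iff] at hf
  subst hv hf
  obtain ⟨h1, -, h2⟩ := hG.labelS_plusFaceAt hn hd
  rw [plucker_eta x ⟨_, hG.card_labelS hn _⟩ h1]
  rcases h2 with ⟨h2, h3⟩ | ⟨h2, h3⟩
  · rw [h2, h3]
  · rw [h2, h3, mul_comm]

theorem IsWellConnected.Phi_map_eta [NeZero n] (hG : G.IsWellConnected) (hn : 2 ≤ n)
    (hpos : ∀ x : DecOG n, x.IsPos → (eta n x).IsPos) (x : DecOGPos n) {g : G.plus.Face}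
    {v : G.Vertex} {f : G.Face} (hv : G.Incident g (Sum.inl v)) (hf : G.Incident g (Sum.inr f)) :
    G.plus.Phi (hG.card_labelS hn) (Subtype.map (eta n) hpos x) g =
      G.Psi x (Sum.inl v) * G.Psi x (Sum.inr f) := by
  refine Subtype.ext ?_
  change ((eta n x.1).plucker ⟨G.plus.labelS g, hG.card_labelS hn g⟩).re =
    (x.1.cartan (G.labelJ (Sum.inl v))).re * (x.1.cartan (G.labelJ (Sum.inr f))).re
  rw [hG.plucker_eta_labelS hn x.1 hv hf, Complex.mul_re,
    ← (Complex.pos_iff.mp (x.2 (G.labelJ (Sum.inl v)))).2, zero_mul, sub_zero]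

theorem existsUnique_incident (G : DiskMap n) (g : G.plus.Face) :
    (∃! v : G.Vertex, G.Incident g (Sum.inl v)) ∧ ∃! f : G.Face, G.Incident g (Sum.inr f) := by
  obtain ⟨d, hd, rfl⟩ := G.exists_plusFaceAt g
  exact ⟨⟨_, G.incident_inl_iff.mpr rfl, fun _ => G.incident_inl_iff.mp⟩,
    ⟨_, G.incident_inr_iff.mpr rfl, fun _ => G.incident_inr_iff.mp⟩⟩

theorem iPlus_apply (B : G.BSpace) {g : G.plus.Face} {v : G.Vertex} {f : G.Face}
    (hv : G.Incident g (Sum.inl v)) (hv' : ∀ w, G.Incident g (Sum.inl w) → w = v)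
    (hf : G.Incident g (Sum.inr f)) (hf' : ∀ k, G.Incident g (Sum.inr k) → k = f) :
    G.iPlus B g = B (Sum.inl v) * B (Sum.inr f) := by
  have h1 : ∀ w, G.Incident g (Sum.inl w) ↔ w = v := fun w => ⟨hv' w, fun h => h ▸ hv⟩
  have h2 : ∀ k, G.Incident g (Sum.inr k) ↔ k = f := fun k => ⟨hf' k, fun h => h ▸ hf⟩
  simp only [iPlus, h1, h2, finprod_cond_eq_left]

end DiskMap

end ElecOG


theorem mainTheorem5 (n : ℕ) [NeZero n] :
    ∃ η : ElecOG.DecOG n → ElecOG.DecGr (n + 1) (n + n),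
      ElecOG.IsEta η ∧ (∀ η', ElecOG.IsEta η' → η' = η) ∧
      (∀ (x : ElecOG.DecOG n) (I : Set.powersetCard (Fin (n + n)) (n + 1)),
        (ElecOG.lowPart I.1 ∩ ElecOG.highPart I.1).card = 1 →
          (η x).plucker I =
            x.cartan (ElecOG.lowPart I.1) * x.cartan (Finset.univ \ ElecOG.highPart I.1)) ∧
      ∃ hpos : ∀ x : ElecOG.DecOG n, x.IsPos → (η x).IsPos,
        ∀ G : ElecOG.DiskMap n, 2 ≤ n → G.IsWellConnected →
          (∀ g : G.plus.Face, (∃! v : G.Vertex, G.Incident g (Sum.inl v)) ∧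
            ∃! f : G.Face, G.Incident g (Sum.inr f)) ∧
          ∃ hS : ∀ g : G.plus.Face, (G.plus.labelS g).card = n + 1,
            (∀ (x : ElecOG.DecOGPos n) (g : G.plus.Face) (v : G.Vertex) (f : G.Face),
              G.Incident g (Sum.inl v) → G.Incident g (Sum.inr f) →
                (G.plus.Phi hS (Subtype.map η hpos x) g : ℝ) =
                  G.Psi x (Sum.inl v) * G.Psi x (Sum.inr f)) ∧
            G.plus.Phi hS ∘ Subtype.map η hpos = G.iPlus ∘ G.Psi := by
  refine ⟨ElecOG.eta n, ElecOG.isEta_eta n, fun _ h => h.eq_eta, ElecOG.plucker_eta,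
    ElecOG.eta_isPos, fun G hn hG => ⟨G.existsUnique_incident, hG.card_labelS hn, ?_, ?_⟩⟩
  · intro x g v f hv hf
    exact congrArg Subtype.val (hG.Phi_map_eta hn ElecOG.eta_isPos x hv hf)
  · funext x g
    obtain ⟨⟨v, hv, hv'⟩, f, hf, hf'⟩ := G.existsUnique_incident g
    refine (hG.Phi_map_eta hn ElecOG.eta_isPos x hv hf).trans ?_
    exact (ElecOG.DiskMap.iPlus_apply _ hv hv' hf hf').symm
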